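/- **Setting.** $\mathbb N=\{0,1,2,\dots\}$. Fix $d$, a scaling vector $\mathfrak s\in\{1,2,\dots\}^d$, and write $\|x\|_{\mathfrak s}=\sum_i|x_i|^{1/\mathfrak s_i}$, $|k|_{\mathfrak s}=\sum_i k_i\mathfrak s_i$ for $k\in\mathbb N^d$, $|\mathfrak s|=\sum_i\mathfrak s_i$, $a^{\mathfrak s}=\mathrm{diag}(a^{\mathfrak s_1},\dots,a^{\mathfrak s_d})$ for $a>0$. Fix an even $\varphi_{-1}\in C_c^\infty(\mathbb R^d;[0,1])$ that equals $1$ on an open set containing $[-1,1]^d$ and has support in $2^{\mathfrak s}[-1,1]^d$; for $j\ge 0$ put $\varphi_j=\varphi_{-1}(2^{-(j+1)\mathfrak s}\cdot)-\varphi_{-1}(2^{-j\mathfrak s}\cdot)$; for $j\ge-1$ put $\Psi^j=\mathcal F^{-1}\varphi_j$, $\Psi^{<j}=\sum_{-1\le i<j}\Psi^i$, with $\mathcal F^{-1}\varphi(x)=\int e^{2\pi i x\cdot\xi}\varphi(\xi)\,d\xi$. For a complex Banach space $X$ and $r\in\mathbb R$, $\mathcal B^r_{\mathfrak s}(\mathbb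 R^d;X)$ is the space of $f\in\mathcal S'(\mathbb R^d;X)$ with $\|f\|_{\mathcal B^r_{\mathfrak s}}=\sup_{j\ge-1}2^{jr}\|\Psi^j*f\|_{L^\infty(\mathbb R^d;X)}<\infty$. A *regularity structure* $(A,\mathcal T,G)$ consists of a locally finite $A\subseteq\mathbb R$, bounded below, with $0\in A$; of $\mathcal T=\bigoplus_{\alpha\in A}\mathcal T_\alpha$ with complex Banach spaces $\mathcal T_\alpha$, where $\mathcal T_0$ is spanned by one unit vector; and of a group $G$ of linear operators on $\mathcal T$ with $g\tau-\tau\in\bigoplus_{\beta<\alpha}\mathcal T_\beta$ for $g\in G$, $\tau\in\mathcal T_\alpha$. Write $\tau^\alpha$ for the $\mathcal T_\alpha$-component of $\tau\in\mathcal T$, and $g^\alpha\tau=(g\tau)^\alpha$. A *model with scaling $\mathfrak s$* consists of $\Gamma_{xy}\in G$ and linear $\Pi_x:\mathcal T\to\mathcal S'(\mathbb R^d)$, $x,y\in\mathbb R^d$, with $\Gamma_{xx}=\mathrm{Id}$, $\Gamma_{xy}\Gamma_{yz}=\Gamma_{xz}$, $\Pi_x=\Pi_y\Gamma_{yx}$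 and, for all $\alpha,\beta\in A$ with $\beta<\alpha$ and $\tau\in\mathcal T_\alpha$, the global bounds $\|\Gamma^\beta_{yx}\tau\|\lesssim\|\tau\|\,\|x-y\|_{\mathfrak s}^{\alpha-\beta}$ and (for every $\alpha\in A$) $|\Pi_x\tau(\lambda^{-|\mathfrak s|}\varphi(\lambda^{-\mathfrak s}(\cdot-x)))|\lesssim\|\tau\|\lambda^\alpha$, uniformly in $\tau$, in $x,y\in\mathbb R^d$, in $\lambda\in(0,1]$ and in $\varphi\in C^\infty_c(\mathbb R^d)$ with support in $\{\|x\|_{\mathfrak s}<1\}$ and $\|\varphi\|_{C^r}\le1$, where $r$ is the smallest natural number strictly bigger than $-\min A$. Put $$\|\Gamma\|_\gamma=\sup_{x\ne y}\ \sup_{\alpha,\beta\in A,\ \beta<\alpha<\gamma}\ \sup_{\tau\in\mathcal T_\alpha,\,\|\tau\|\le1}\|\Gamma^\beta_{yx}\tau\|\,\|x-y\|_{\mathfrak s}^{\beta-\alpha}.$$ Let $\gamma\in\mathbb R$ and consider $F:\mathbb R^d\to\mathcal T_\gamma^-:=\bigoplus_{\alpha<\gamma}\mathcal T_\alpha$.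 Put $\|F\|_{C_b}=\sup_{\alpha\in A,\,x}\|F^\alpha_x\|$, and write $F\in C_b$ if this is finite and every $F^\alpha$ is continuous. The space $\mathscr D^\gamma$ consists of the $F$ with $$\|F\|_{\mathscr D^\gamma}=\|F\|_{C_b}+\sup_{\alpha\in A,\ x\ne y}\frac{\|F^\alpha_y-\Gamma^\alpha_{yx}F_x\|}{\|y-x\|_{\mathfrak s}^{\gamma-\alpha}}<\infty .$$ The paraproduct is $$P(F,\Gamma^\alpha)_x=\sum_{j>0}\iint \Psi^{<j-1}_{x-u}\,\Psi^j_{x-v}\,\Gamma^\alpha_{vu}F_u\,du\,dv ,$$ with convergence of the sum in $\mathcal S'(\mathbb R^d;\mathcal T_\alpha)$, and $F^{\sharp,\alpha}=F^\alpha-P(F,\Gamma^\alpha)$. The space $\mathscr B^\gamma_{\mathfrak s}$ consists of the $F\in C_b$ such that $F^{\sharp,\alpha}\in\mathcal B^{\gamma-\alpha}_{\mathfrak s}(\mathbb R^d;\mathcal T_\alpha)$ for all $\alpha\in A$ with $\alpha<\gamma$, and such that $F$ satisfies the *structure condition below $\gamma$*: for all $x\in\mathbb R^d$, $k\in\mathbb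 N^d$ and $\alpha\in A$ with $\alpha<\gamma$ and $|k|_{\mathfrak s}<\gamma-\alpha$, the map $v\mapsto\partial^k\Psi^{<N}_{x-v}(F^\alpha_v-\Gamma^\alpha_{vx}F_x)$ is in $L^1(\mathbb R^d;\mathcal T_\alpha)$ for all large $N$, and its integral tends to $0$ in $\mathcal T_\alpha$ as $N\to\infty$. Its norm is $\|F\|_{\mathscr B^\gamma_{\mathfrak s}}=\|F\|_{C_b}+\sup_{\alpha\in A}\|F^{\sharp,\alpha}\|_{\mathcal B^{\gamma-\alpha}_{\mathfrak s}}$. **Theorem.** Let $(A,\mathcal T,G)$ be a regularity structure and let $\gamma\in\mathbb R\setminus(A+\mathbb N)$. There are polynomials $p,q$ with non-negative coefficients such that for every model $(\Pi,\Gamma)$ with scaling $\mathfrak s$ one has $\mathscr D^\gamma=\mathscr B^\gamma_{\mathfrak s}$ and, for every $F$ in this space, $$\|F\|_{\mathscr B^\gamma_{\mathfrak s}}\le p(\|\Gamma\|_\gamma)\,\|F\|_{\mathscr D^\gamma},\qquad \|F\|_{\mathscr D^\gamma}\le q(\|\Gamma\|_\gamma)\,\|F\|_{\mathscr B^\gamma_{\mathfrak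 s}} .$$ -/

import Mathlib

open MeasureTheory Filter Topology
open scoped ENNReal NNReal ContDiff DirectSum SchwartzMap FourierTransform LineDeriv Polynomial

universe u

noncomputable section

/-! ### Anisotropic scalings -/

/-- The space `ℝᵈ`. -/
abbrev Rd (d : ℕ) : Type := EuclideanSpace ℝ (Fin d)

namespace Scaling

variable {d : ℕ} (s : Fin d → ℕ+)

/-- The scaled "norm" `‖x‖_𝔰 = ∑ᵢ |xᵢ| ^ (1 / 𝔰ᵢ)`. -/
def snorm (x : Rd d) : ℝ := ∑ i, |x i| ^ (1 / (s i : ℝ))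

/-- `|k|_𝔰 = ∑ᵢ kᵢ 𝔰ᵢ` for a multi-index `k`. -/
def deg (k : Fin d → ℕ) : ℕ := ∑ i, k i * (s i : ℕ)

/-- `|𝔰| = ∑ᵢ 𝔰ᵢ`. -/
def total : ℕ := ∑ i, (s i : ℕ)

/-- The linear map `x ↦ a^𝔰 x`, with `a^𝔰 = diag (a^𝔰₁, …, a^𝔰_d)`. -/
def scale (a : ℝ) (x : Rd d) : Rd d := WithLp.toLp 2 (fun i => a ^ (s i : ℕ) * x i)

/-- The box `𝔅ⱼ = 2^((j+1)𝔰) [-1,1]ᵈ`, for `j ≥ -1`. -/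
def box (j : ℤ) : Set (Rd d) := scale s ((2 : ℝ) ^ (j + 1)) '' {x | ∀ i, x i ∈ Set.Icc (-1 : ℝ) 1}

/-- `2^(j𝔰)` as an invertible linear map. -/
def dyadic (j : ℤ) : Rd d ≃L[ℝ] Rd d :=
  LinearEquiv.toContinuousLinearEquiv
    { toFun := scale s ((2 : ℝ) ^ j)
      invFun := scale s ((2 : ℝ) ^ (-j))
      map_add' := fun x y => by ext i; simp [scale, mul_add]
      map_smul' := fun c x => by ext i; simp [scale, mul_left_comm]
      left_inv := fun x => by
        ext i
        have h : ((2 : ℝ) ^ j) ^ (s i : ℕ) ≠ 0 := by positivity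
        simp [scale, h]
      right_inv := fun x => by
        ext i
        have h : ((2 : ℝ) ^ j) ^ (s i : ℕ) ≠ 0 := by positivity
        simp [scale, h] }

theorem dyadic_apply (j : ℤ) (x : Rd d) : dyadic s j x = scale s ((2 : ℝ) ^ j) x := rfl

end Scaling

open Scaling

/-- The partial derivative `∂ᵏ f` of a Schwartz function, for a multi-index `k`. -/
def multiDeriv {d : ℕ} (k : Fin d → ℕ) (f : 𝓢(Rd d, ℂ)) : 𝓢(Rd d, ℂ) :=
  (List.finRange d).foldr
    (fun i g => (fun h : 𝓢(Rd d, ℂ) => ∂_{EuclideanSpace.single i (1 : ℝ)} h)^[k i] g) f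

/-! ### Anisotropic dyadic partitions of unity -/

/-- The function `φ₋₁` from which an anisotropic dyadic partition of unity is built. -/
structure DyadicCutoff {d : ℕ} (s : Fin d → ℕ+) where
  /-- the function `φ₋₁` -/
  toFun : Rd d → ℝ
  smooth : ContDiff ℝ ∞ toFun
  symm : ∀ x, toFun (-x) = toFun x
  mem_Icc : ∀ x, toFun x ∈ Set.Icc (0 : ℝ) 1
  eq_one : ∃ U : Set (Rd d), IsOpen U ∧ box s (-1) ⊆ U ∧ ∀ x ∈ U, toFun x = 1
  tsupport_subset : tsupport toFun ⊆ box s 0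

namespace DyadicCutoff

variable {d : ℕ} {s : Fin d → ℕ+} (φ : DyadicCutoff s)

theorem hasCompactSupport : HasCompactSupport (fun x => (φ.toFun x : ℂ)) := by
  have hK : IsCompact (box s 0) := by
    have h1 : IsCompact {x : Rd d | ∀ i, x i ∈ Set.Icc (-1 : ℝ) 1} := by
      have h2 : IsCompact (Set.univ.pi fun _ : Fin d => Set.Icc (-1 : ℝ) 1) :=
        isCompact_univ_pi fun _ => isCompact_Icc
      have h3 := h2.image (PiLp.continuous_toLp 2 (fun _ : Fin d => ℝ))
      convert h3 using 1
      ext x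
      constructor
      · intro hx
        exact ⟨x.ofLp, fun i _ => hx i, rfl⟩
      · rintro ⟨y, hy, rfl⟩
        exact fun i => hy i trivial
    have h4 := h1.image (dyadic s (0 + 1)).continuous
    exact h4
  have h : HasCompactSupport φ.toFun := hK.of_isClosed_subset (isClosed_tsupport _)
    φ.tsupport_subset
  exact h.comp_left (g := fun t : ℝ => (t : ℂ)) (by simp)

/-- `φ₋₁` as a complex-valued Schwartz function. -/
def base : 𝓢(Rd d, ℂ) :=
  φ.hasCompactSupport.toSchwartzMap (Complex.ofRealCLM.contDiff.comp φ.smooth)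

theorem base_apply (x : Rd d) : φ.base x = (φ.toFun x : ℂ) := rfl

/-- The dilate `φ₋₁(2^(-j𝔰) ·)`. -/
def dilate (j : ℤ) : 𝓢(Rd d, ℂ) :=
  SchwartzMap.compCLMOfContinuousLinearEquiv ℂ (dyadic s (-j)) φ.base

/-- The partition of unity `(φⱼ)`, `j ≥ -1`: the function `φ₋₁` for `j = -1`, and
`φⱼ = φ₋₁(2^(-(j+1)𝔰) ·) - φ₋₁(2^(-j𝔰) ·)` for `j ≥ 0`. -/
def part (j : ℤ) : 𝓢(Rd d, ℂ) :=
  if j = -1 then φ.base else φ.dilate (j + 1) - φ.dilate j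

/-- `Ψʲ = 𝓕⁻¹ φⱼ`, for `j ≥ -1`. -/
def psi (j : ℤ) : 𝓢(Rd d, ℂ) := 𝓕⁻ (φ.part j)

/-- `Ψ^{<j} = ∑_{-1 ≤ i < j} Ψⁱ`. -/
def psiLT (j : ℤ) : 𝓢(Rd d, ℂ) := ∑ i ∈ Finset.Ico (-1 : ℤ) j, φ.psi i

variable {X : Type*} [NormedAddCommGroup X] [NormedSpace ℂ X]

/-- The Littlewood–Paley block `Δⱼ f = Ψʲ ∗ f` of an `X`-valued tempered distribution, which is the
function `x ↦ f (Ψʲ(x - ·))`. -/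
def block (j : ℤ) (f : 𝓢'(Rd d, X)) (x : Rd d) : X :=
  f (SchwartzMap.compSubConstCLM ℂ x
    (SchwartzMap.compCLMOfContinuousLinearEquiv ℂ (ContinuousLinearEquiv.neg ℝ) (φ.psi j)))

/-- The norm of the anisotropic Besov space `𝓑^r_𝔰(ℝᵈ; X)`; a distribution belongs to the space
if and only if its norm is finite. -/
def besovNorm (r : ℝ) (f : 𝓢'(Rd d, X)) : ℝ≥0∞ :=
  ⨆ j : ℤ, ⨆ _ : -1 ≤ j, ENNReal.ofReal ((2 : ℝ) ^ ((j : ℝ) * r)) * eLpNorm (φ.block j f) ∞ volume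

end DyadicCutoff

/-- The tempered distribution `u` is the one given by integration against the function `f`. -/
def Represents {d : ℕ} {X : Type*} [NormedAddCommGroup X] [NormedSpace ℂ X]
    (f : Rd d → X) (u : 𝓢'(Rd d, X)) : Prop :=
  ∀ η : 𝓢(Rd d, ℂ), Integrable (fun x => η x • f x) ∧ u η = ∫ x, η x • f x

/-! ### Regularity structures and models -/

/-- A regularity structure `(A, 𝓣, G)`. -/
structure RegularityStructure where
  /-- the set of homogeneities -/
  A : Set ℝ
  locallyFinite : ∀ a b : ℝ, (A ∩ Set.Icc a b).Finite
  bddBelow : BddBelow A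
  zero_mem : (0 : ℝ) ∈ A
  /-- the homogeneous spaces, whose direct sum is the model space -/
  T : A → Type u
  [normedAddCommGroup : ∀ α, NormedAddCommGroup (T α)]
  [normedSpace : ∀ α, NormedSpace ℂ (T α)]
  [completeSpace : ∀ α, CompleteSpace (T α)]
  /-- the unit vector spanning `T₀` -/
  one : T ⟨0, zero_mem⟩
  norm_one : ‖one‖ = 1
  span_one : Submodule.span ℂ {one} = ⊤
  /-- the structure group -/
  G : Subgroup ((⨁ α, T α) ≃ₗ[ℂ] (⨁ α, T α))
  triangular : ∀ g ∈ G, ∀ (α : A) (τ : T α) (β : A), ¬ β < α →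
    (g (DirectSum.lof ℂ A T α τ) - DirectSum.lof ℂ A T α τ) β = 0

attribute [instance] RegularityStructure.normedAddCommGroup RegularityStructure.normedSpace
  RegularityStructure.completeSpace

/-- The model space `𝓣 = ⨁_{α ∈ A} 𝓣_α`. -/
abbrev RegularityStructure.Space (R : RegularityStructure.{u}) : Type u := ⨁ α, R.T α

/-- The smallest natural number strictly bigger than `-min A`. -/
def RegularityStructure.order (R : RegularityStructure.{u}) : ℕ := ⌊-sInf R.A⌋₊ + 1

/-- A model `(Π, Γ)` with scaling `𝔰` on a regularity structure, satisfying global bounds. -/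
structure Model (R : RegularityStructure.{u}) {d : ℕ} (s : Fin d → ℕ+) where
  /-- the maps `Γ_{xy}` -/
  Γ : Rd d → Rd d → (R.Space ≃ₗ[ℂ] R.Space)
  Γ_mem : ∀ x y, Γ x y ∈ R.G
  /-- the maps `Π_x` -/
  Pi : Rd d → R.Space →ₗ[ℂ] 𝓢'(Rd d, ℂ)
  Γ_self : ∀ x τ, Γ x x τ = τ
  Γ_comp : ∀ x y z τ, Γ x y (Γ y z τ) = Γ x z τ
  Pi_eq : ∀ x y τ, Pi x τ = Pi y (Γ y x τ)
  Γ_bound : ∀ α β : R.A, β < α → ∃ C : ℝ, ∀ (x y : Rd d) (τ : R.T α),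
    ‖(Γ y x (DirectSum.lof ℂ R.A R.T α τ)) β‖ ≤ C * ‖τ‖ * snorm s (x - y) ^ ((α : ℝ) - β)
  /-- Here `ρ` is the test function, supported in the scaled unit ball and of `Cʳ`-norm at most one,
  and `η` is its rescaled and recentred version `l^{-|𝔰|} ρ(l^{-𝔰}(· - x))`. -/
  Pi_bound : ∀ α : R.A, ∃ C : ℝ, ∀ (x : Rd d) (τ : R.T α) (l : ℝ) (ρ η : 𝓢(Rd d, ℂ)),
    0 < l → l ≤ 1 → tsupport ρ ⊆ {z | snorm s z < 1} →
    (∀ k : Fin d → ℕ, ∑ i, k i ≤ R.order → ∀ z, ‖multiDeriv k ρ z‖ ≤ 1) →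
    (∀ z, η z = (((l ^ total s)⁻¹ : ℝ) : ℂ) * ρ (scale s l⁻¹ (z - x))) →
    ‖Pi x (DirectSum.lof ℂ R.A R.T α τ) η‖ ≤ C * ‖τ‖ * l ^ (α : ℝ)

namespace Model

variable {R : RegularityStructure.{u}} {d : ℕ} {s : Fin d → ℕ+} (M : Model R s)

/-- The norm `‖Γ‖_γ`. -/
def normΓ (γ : ℝ) : ℝ≥0∞ :=
  ⨆ (x : Rd d) (y : Rd d) (_ : x ≠ y) (α : R.A) (β : R.A) (_ : β < α) (_ : (α : ℝ) < γ)
    (τ : R.T α) (_ : ‖τ‖ ≤ 1),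
    ‖(M.Γ y x (DirectSum.lof ℂ R.A R.T α τ)) β‖ₑ *
      ENNReal.ofReal (snorm s (x - y) ^ ((β : ℝ) - α))

end Model

/-! ### The two function spaces -/

section Spaces

variable {R : RegularityStructure.{u}} {d : ℕ} {s : Fin d → ℕ+}

/-- `F` takes its values in `𝓣_γ^- = ⨁_{α < γ} 𝓣_α`. -/
def ValuesBelow (γ : ℝ) (F : Rd d → R.Space) : Prop :=
  ∀ x (α : R.A), γ ≤ (α : ℝ) → F x α = 0

/-- The norm `‖F‖_{C_b(ℝᵈ; 𝓣)} = sup_{α, x} ‖F^α_x‖`. -/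
def cbNorm (F : Rd d → R.Space) : ℝ≥0∞ := ⨆ (α : R.A) (x : Rd d), ‖F x α‖ₑ

/-- `F ∈ C_b(ℝᵈ; 𝓣)`. -/
def MemCb (F : Rd d → R.Space) : Prop :=
  (∀ α : R.A, Continuous fun x => F x α) ∧ cbNorm F < ⊤

namespace Model

variable (M : Model R s)

/-- The norm of `𝒟^γ(ℝᵈ; 𝓣)`. -/
def modelledNorm (γ : ℝ) (F : Rd d → R.Space) : ℝ≥0∞ :=
  cbNorm F +
    ⨆ (α : R.A) (x : Rd d) (y : Rd d) (_ : x ≠ y),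
      ‖F y α - (M.Γ y x (F x)) α‖ₑ / ENNReal.ofReal (snorm s (y - x) ^ (γ - α))

/-- The space `𝒟^γ(ℝᵈ; 𝓣)` of modelled distributions. -/
def modelled (γ : ℝ) : Set (Rd d → R.Space) :=
  {F | ValuesBelow γ F ∧ M.modelledNorm γ F < ⊤}

variable (φ : DyadicCutoff s)

/-- The integrand `(u, v) ↦ Ψ^{<j-1}(x - u) Ψʲ(x - v) Γ^α_{vu} F_u` of the paraproduct. -/
def paraIntegrand (F : Rd d → R.Space) (α : R.A) (j : ℤ) (x : Rd d) (z : Rd d × Rd d) : R.T α :=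
  (φ.psiLT (j - 1) (x - z.1) * φ.psi j (x - z.2)) • (M.Γ z.2 z.1 (F z.1)) α

/-- `P(F, Γ^α)` is well defined and equal to the distribution `P`: the integrals
`∫∫ Ψ^{<j-1}(x - u) Ψʲ(x - v) Γ^α_{vu} F_u du dv` converge, they are tempered distributions in `x`,
and their sum over `j > 0` converges to `P` in `𝓢'(ℝᵈ; 𝓣_α)`. -/
def IsParaproduct (F : Rd d → R.Space) (α : R.A) (P : 𝓢'(Rd d, R.T α)) : Prop :=
  (∀ j : ℤ, 0 < j → ∀ x, Integrable (M.paraIntegrand φ F α j x)) ∧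
  ∃ p : ℕ → 𝓢'(Rd d, R.T α),
    (∀ n : ℕ, Represents (fun x => ∫ z, M.paraIntegrand φ F α (n + 1) x z) (p n)) ∧ HasSum p P

/-- The distribution `g` is `F^{♯,α} = F^α - P(F, Γ^α)`. -/
def IsSharp (F : Rd d → R.Space) (α : R.A) (g : 𝓢'(Rd d, R.T α)) : Prop :=
  ∃ f P : 𝓢'(Rd d, R.T α), Represents (fun x => F x α) f ∧ M.IsParaproduct φ F α P ∧ g = f - P

/-- The norm `‖F^{♯,α}‖` in `𝓑^{γ-α}_𝔰(ℝᵈ; 𝓣_α)`. There is at most one `g` with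
`M.IsSharp φ F α g`; if there is none, the value is infinite. -/
def sharpNorm (γ : ℝ) (F : Rd d → R.Space) (α : R.A) : ℝ≥0∞ :=
  ⨅ (g : 𝓢'(Rd d, R.T α)) (_ : M.IsSharp φ F α g), φ.besovNorm (γ - α) g

/-- The structure condition below `γ`. -/
def StructureCondition (γ : ℝ) (F : Rd d → R.Space) : Prop :=
  ∀ (x : Rd d) (k : Fin d → ℕ) (α : R.A), (α : ℝ) < γ → (deg s k : ℝ) < γ - α →
    (∀ᶠ N : ℕ in atTop, Integrable fun v =>
      multiDeriv k (φ.psiLT N) (x - v) • (F v α - (M.Γ v x (F x)) α)) ∧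
    Tendsto (fun N : ℕ => ∫ v, multiDeriv k (φ.psiLT N) (x - v) • (F v α - (M.Γ v x (F x)) α))
      atTop (𝓝 0)

/-- The norm of `𝓑^γ_𝔰(ℝᵈ; 𝓣)`. -/
def paraNorm (γ : ℝ) (F : Rd d → R.Space) : ℝ≥0∞ :=
  cbNorm F + ⨆ α : R.A, M.sharpNorm φ γ F α

/-- The paraproduct-based Besov-type space `𝓑^γ_𝔰(ℝᵈ; 𝓣)`. -/
def paramodelled (γ : ℝ) : Set (Rd d → R.Space) :=
  {F | ValuesBelow γ F ∧ MemCb F ∧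
    (∀ α : R.A, (α : ℝ) < γ → ∃ g, M.IsSharp φ F α g ∧ φ.besovNorm (γ - α) g < ⊤) ∧
    M.StructureCondition φ γ F}

end Model

end Spaces

end

open Scaling

set_option linter.unusedSectionVars false

/-! ### Anisotropic distance, dilations and weighted kernel estimates. -/

namespace Scaling

variable {d : ℕ} (s : Fin d → ℕ+)

/-! Everything rests on comparing, scale by scale, a function E with the i-th term of the
paraproduct. Because Ψ^{<i-1} has integral 1, the block Ψ^i ∗ E minus this term is the double
integral of E_v - Γ^α_{vu} F_u against Ψ^{<i-1}_{x-u} Ψ^i_{x-v}; because Ψ^i has integral 0, any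
function of u alone may be subtracted from the integrand. Fourier supports then make the l-th block
of E - P(F, Γ^α) depend only on the scales i in a window [l-2, l+gap), for l ≥ 3
(`IsParaproduct.smear_psi_sub_block`).

From 𝒟^γ to 𝓑^γ, take E = F^α. The integrand is at most a multiple of ‖v-u‖^{γ-α}, so each
difference is of order 2^{-i(γ-α)}, which is the Besov bound on F^{♯,α} (`besovNorm_sharp_le`). The
structure condition follows by scaling, since a derivative of degree |k| costs only 2^{N|k|} with
|k| < γ-α.

From 𝓑^γ to 𝒟^γ, argue by induction downwards in α. Fix x and put h = F^α - Γ^α_{·x} F_x. Now take E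
= Γ^α_{·x} F_x and subtract the function Γ^α_{ux} F_x - F^α_u of u. The integrand becomes a sum,
over β between α and γ, of Γ_{vu} applied to the β-components of F_u - Γ_{ux} F_x, which the
induction hypothesis controls (`norm_smear_psi_orbit_sub_paraTerm_le`). Together with the bound on
F^{♯,α} this gives blocks of h at w of size 2^{-lε} (2^{-l} + ‖w-x‖)^b, where ε + b = γ-α and ε > 0
(`ae_norm_smear_psi_le`).

Such block bounds determine h near x only up to a Taylor polynomial, and the structure condition
says that this polynomial vanishes. Quantitatively (`TaylorData.norm_le`), choose n with 2^{-n}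
comparable to ‖y-x‖. Regularised derivatives at x of degree below γ-α are tails of a convergent
geometric series with limit zero; those of degree above γ-α are sums dominated by their last term.
Taylor's formula for Ψ^{<n} ∗ h and summation of the blocks beyond n at y (this uses ε > 0) give
|h(y)| ≲ ‖y-x‖^{γ-α}. The hypothesis γ ∉ A + ℕ excludes the critical degree |k| = γ-α, where the
geometric ratio would be 1. -/

theorem snorm_nonneg (x : Rd d) : 0 ≤ snorm s x :=
  Finset.sum_nonneg fun _ _ => Real.rpow_nonneg (abs_nonneg _) _

theorem one_div_scaling_pos (i : Fin d) : 0 < 1 / (s i : ℝ) := by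
  have : (0 : ℝ) < (s i : ℝ) := by exact_mod_cast (s i).pos
  positivity

theorem one_div_scaling_le_one (i : Fin d) : 1 / (s i : ℝ) ≤ 1 := by
  have : (1 : ℝ) ≤ (s i : ℝ) := by exact_mod_cast (one_le : 1 ≤ s i)
  rw [div_le_one (by linarith)]
  exact this

@[simp]
theorem snorm_zero : snorm s (0 : Rd d) = 0 := by
  simp [snorm]

@[simp]
theorem snorm_neg (x : Rd d) : snorm s (-x) = snorm s x := by
  simp [snorm]

theorem snorm_sub_comm (x y : Rd d) : snorm s (x - y) = snorm s (y - x) := by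
  rw [← snorm_neg, neg_sub]

/-- Since 1/𝔰ᵢ ≤ 1, each power t ↦ t^{1/𝔰ᵢ} is subadditive on the non-negative reals. -/
theorem snorm_add_le (x y : Rd d) : snorm s (x + y) ≤ snorm s x + snorm s y := by
  unfold snorm
  rw [← Finset.sum_add_distrib]
  refine Finset.sum_le_sum fun i _ => ?_
  have h1 : |(x + y) i| ^ (1 / (s i : ℝ)) ≤ (|x i| + |y i|) ^ (1 / (s i : ℝ)) :=
    Real.rpow_le_rpow (abs_nonneg _) (abs_add_le _ _) (one_div_scaling_pos s i).le
  refine h1.trans ?_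
  have h2 := NNReal.rpow_add_le_add_rpow ‖x i‖₊ ‖y i‖₊ (one_div_scaling_pos s i).le
    (one_div_scaling_le_one s i)
  exact_mod_cast h2

theorem snorm_sub_le (x y z : Rd d) : snorm s (x - z) ≤ snorm s (x - y) + snorm s (y - z) := by
  have := snorm_add_le s (x - y) (y - z)
  rwa [sub_add_sub_cancel] at this

theorem snorm_pos {x : Rd d} (hx : x ≠ 0) : 0 < snorm s x := by
  obtain ⟨i, hi⟩ : ∃ i, x i ≠ 0 := by
    by_contra! h
    exact hx (by ext i; simpa using h i)
  refine lt_of_lt_of_le (Real.rpow_pos_of_pos (abs_pos.2 hi) (1 / (s i : ℝ))) ?_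
  exact Finset.single_le_sum (f := fun i => |x i| ^ (1 / (s i : ℝ)))
    (fun _ _ => Real.rpow_nonneg (abs_nonneg _) _) (Finset.mem_univ i)

theorem abs_apply_le_snorm_pow (x : Rd d) (i : Fin d) : |x i| ≤ snorm s x ^ (s i : ℕ) := by
  have h : |x i| ^ (1 / (s i : ℝ)) ≤ snorm s x :=
    Finset.single_le_sum (f := fun i => |x i| ^ (1 / (s i : ℝ)))
      (fun _ _ => Real.rpow_nonneg (abs_nonneg _) _) (Finset.mem_univ i)
  calc |x i| = (|x i| ^ (1 / (s i : ℝ))) ^ (s i : ℕ) := by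
        rw [← Real.rpow_natCast, ← Real.rpow_mul (abs_nonneg _), one_div, inv_mul_cancel₀,
          Real.rpow_one]
        exact_mod_cast (s i).ne_zero
    _ ≤ _ := pow_le_pow_left₀ (Real.rpow_nonneg (abs_nonneg _) _) h _

theorem snorm_scale {a : ℝ} (ha : 0 ≤ a) (x : Rd d) : snorm s (scale s a x) = a * snorm s x := by
  unfold snorm scale
  rw [Finset.mul_sum]
  refine Finset.sum_congr rfl fun i _ => ?_
  have h0 : (s i : ℝ) ≠ 0 := by exact_mod_cast (s i).ne_zero
  simp only
  rw [abs_mul, Real.mul_rpow (abs_nonneg _) (abs_nonneg _), abs_of_nonneg (pow_nonneg ha _),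
    ← Real.rpow_natCast, ← Real.rpow_mul ha, mul_one_div_cancel h0, Real.rpow_one]

theorem snorm_dyadic (m : ℤ) (x : Rd d) : snorm s (dyadic s m x) = (2 : ℝ) ^ m * snorm s x := by
  rw [dyadic_apply, snorm_scale s (by positivity)]

theorem continuous_snorm : Continuous (snorm s) := by
  unfold snorm
  refine continuous_finsetSum _ fun i _ => ?_
  refine Continuous.rpow_const ?_ fun x => Or.inr (one_div_scaling_pos s i).le
  fun_prop

theorem snorm_le_norm (x : Rd d) : snorm s x ≤ d * (1 + ‖x‖) := by
  have : ∀ i ∈ Finset.univ, |x i| ^ (1 / (s i : ℝ)) ≤ 1 + ‖x‖ := fun i _ => by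
    have h1 : |x i| ≤ 1 + ‖x‖ := by
      have := EuclideanSpace.norm_eq x ▸ PiLp.norm_apply_le x i
      rw [← Real.norm_eq_abs]
      linarith [PiLp.norm_apply_le x i]
    calc |x i| ^ (1 / (s i : ℝ)) ≤ (1 + ‖x‖) ^ (1 / (s i : ℝ)) :=
          Real.rpow_le_rpow (abs_nonneg _) h1 (one_div_scaling_pos s i).le
      _ ≤ (1 + ‖x‖) ^ (1 : ℝ) :=
          Real.rpow_le_rpow_of_exponent_le (by linarith [norm_nonneg x])
            (one_div_scaling_le_one s i)
      _ = _ := Real.rpow_one _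
  refine (Finset.sum_le_sum this).trans (le_of_eq ?_)
  simp [mul_add]

/-- The determinant of the dilation `2^(m𝔰)`. -/
noncomputable def dyadicDet (m : ℤ) : ℝ :=
  |LinearMap.det ((dyadic s m : Rd d →L[ℝ] Rd d) : Rd d →ₗ[ℝ] Rd d)|

theorem dyadicDet_pos (m : ℤ) : 0 < dyadicDet s m := by
  refine abs_pos.2 ?_
  exact (LinearEquiv.isUnit_det' (dyadic s m).toLinearEquiv).ne_zero

/-- The determinant stays abstract. Only its positivity matters, since kernels are normalised by
exactly the factor that the change of variables produces. -/
theorem map_dyadic_volume (m : ℤ) :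
    Measure.map (dyadic s m) volume = ENNReal.ofReal (dyadicDet s m)⁻¹ • (volume : Measure (Rd d)) := by
  have := Measure.map_linearMap_addHaar_eq_smul_addHaar (volume : Measure (Rd d))
    (f := ((dyadic s m : Rd d →L[ℝ] Rd d) : Rd d →ₗ[ℝ] Rd d))
    (LinearEquiv.isUnit_det' (dyadic s m).toLinearEquiv).ne_zero
  rw [dyadicDet, ← abs_inv]
  exact this

section

variable {E : Type*} [NormedAddCommGroup E]

theorem integral_comp_dyadic [NormedSpace ℝ E] (m : ℤ) (g : Rd d → E) :
    ∫ v, g (dyadic s m v) = (dyadicDet s m)⁻¹ • ∫ v, g v := by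
  have h := (dyadic s m).toHomeomorph.measurableEmbedding.integral_map (μ := volume) g
  have h2 : Measure.map (dyadic s m).toHomeomorph volume
    = ENNReal.ofReal (dyadicDet s m)⁻¹ • (volume : Measure (Rd d)) := map_dyadic_volume s m
  rw [h2, integral_smul_measure, ENNReal.toReal_ofReal (inv_nonneg.2 (dyadicDet_pos s m).le)] at h
  exact h.symm

theorem integrable_comp_dyadic (m : ℤ) {g : Rd d → E} (hg : Integrable g) :
    Integrable fun v => g (dyadic s m v) := by
  have h := (dyadic s m).toHomeomorph.measurableEmbedding.integrable_map_iff (μ := volume) (g := g)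
  have h2 : Measure.map (dyadic s m).toHomeomorph volume
    = ENNReal.ofReal (dyadicDet s m)⁻¹ • (volume : Measure (Rd d)) := map_dyadic_volume s m
  rw [h2] at h
  exact h.1 (hg.smul_measure ENNReal.ofReal_ne_top)

end

/-- The weighted `L¹`-norm of a Schwartz function. -/
noncomputable def weightedL1 (ψ : 𝓢(Rd d, ℂ)) (a : ℝ) : ℝ := ∫ v, ‖ψ v‖ * (1 + snorm s v) ^ a

theorem continuous_weight {c : ℝ} (hc : 0 < c) (a : ℝ) (x : Rd d) :
    Continuous fun v => (c + snorm s (v - x)) ^ a := by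
  refine Continuous.rpow_const ?_ fun v => Or.inl ?_
  · have := (continuous_snorm s).comp (continuous_id.sub continuous_const : Continuous fun v : Rd d => v - x)
    exact continuous_const.add this
  · have := snorm_nonneg s (v - x)
    positivity

theorem integrable_norm_mul_weight (ψ : 𝓢(Rd d, ℂ)) (a : ℝ) :
    Integrable fun v => ‖ψ v‖ * (1 + snorm s v) ^ a := by
  set n := ⌈a⌉₊
  have h1 : Integrable fun v : Rd d => ((d + 1 : ℝ) ^ n * 2 ^ n) * (‖ψ v‖ + ‖v‖ ^ n * ‖ψ v‖) :=
    (ψ.integrable.norm.add (ψ.integrable_pow_mul volume n)).const_mul _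
  refine h1.mono' ?_ (Eventually.of_forall fun v => ?_)
  · refine Continuous.aestronglyMeasurable ?_
    have := continuous_weight s one_pos a (0 : Rd d)
    simp only [sub_zero] at this
    exact ψ.continuous.norm.mul this
  · have h0 := snorm_nonneg s v
    have h2 : (1 + snorm s v) ^ a ≤ (1 + snorm s v) ^ n := by
      rw [← Real.rpow_natCast]
      exact Real.rpow_le_rpow_of_exponent_le (by linarith) (Nat.le_ceil a)
    have h3 : 1 + snorm s v ≤ (d + 1) * (1 + ‖v‖) := by
      have := snorm_le_norm s v
      nlinarith [norm_nonneg v]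
    have h4 : (1 + ‖v‖) ^ n ≤ 2 ^ n * (1 + ‖v‖ ^ n) := by
      calc (1 + ‖v‖) ^ n ≤ 2 ^ (n - 1) * (1 ^ n + ‖v‖ ^ n) := add_pow_le zero_le_one (norm_nonneg v) n
        _ ≤ 2 ^ n * (1 + ‖v‖ ^ n) := by
          rw [one_pow]
          gcongr
          · norm_num
          · omega
    rw [Real.norm_of_nonneg (by positivity)]
    calc ‖ψ v‖ * (1 + snorm s v) ^ a ≤ ‖ψ v‖ * (((d + 1) * (1 + ‖v‖)) ^ n) := by
          gcongr
          exact h2.trans (pow_le_pow_left₀ (by linarith) h3 n)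
      _ = (d + 1 : ℝ) ^ n * (1 + ‖v‖) ^ n * ‖ψ v‖ := by rw [mul_pow]; ring
      _ ≤ (d + 1 : ℝ) ^ n * (2 ^ n * (1 + ‖v‖ ^ n)) * ‖ψ v‖ := by gcongr
      _ = _ := by ring

theorem weightedL1_nonneg (ψ : 𝓢(Rd d, ℂ)) (a : ℝ) : 0 ≤ weightedL1 s ψ a :=
  integral_nonneg fun v => mul_nonneg (norm_nonneg _)
    (Real.rpow_nonneg (by linarith [snorm_nonneg s v]) _)

/-- The `L¹`-normalized rescaling `v ↦ |det 2^(m𝔰)| ψ(2^(m𝔰) v)`. -/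
noncomputable def rescale (m : ℤ) (ψ : 𝓢(Rd d, ℂ)) : 𝓢(Rd d, ℂ) :=
  (dyadicDet s m : ℂ) • SchwartzMap.compCLMOfContinuousLinearEquiv ℂ (dyadic s m) ψ

theorem rescale_apply (m : ℤ) (ψ : 𝓢(Rd d, ℂ)) (v : Rd d) :
    rescale s m ψ v = (dyadicDet s m : ℂ) * ψ (dyadic s m v) := by
  simp [rescale]

theorem norm_rescale_apply (m : ℤ) (ψ : 𝓢(Rd d, ℂ)) (v : Rd d) :
    ‖rescale s m ψ v‖ = dyadicDet s m * ‖ψ (dyadic s m v)‖ := by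
  rw [rescale_apply, norm_mul, Complex.norm_real, Real.norm_of_nonneg (dyadicDet_pos s m).le]

theorem integrable_rescale_weight (m : ℤ) (ψ : 𝓢(Rd d, ℂ)) (a : ℝ) :
    Integrable fun v => ‖rescale s m ψ v‖ * (1 + 2 ^ m * snorm s v) ^ a := by
  have := (integrable_comp_dyadic s m (integrable_norm_mul_weight s ψ a)).const_mul (dyadicDet s m)
  refine this.congr (Eventually.of_forall fun v => ?_)
  simp only [norm_rescale_apply, snorm_dyadic]
  ring

theorem integral_rescale_weight (m : ℤ) (ψ : 𝓢(Rd d, ℂ)) (a : ℝ) :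
    ∫ v, ‖rescale s m ψ v‖ * (1 + 2 ^ m * snorm s v) ^ a = weightedL1 s ψ a := by
  have h := integral_comp_dyadic s m fun v => ‖ψ v‖ * (1 + snorm s v) ^ a
  have h2 : ∀ v, ‖rescale s m ψ v‖ * (1 + 2 ^ m * snorm s v) ^ a
      = dyadicDet s m * (‖ψ (dyadic s m v)‖ * (1 + snorm s (dyadic s m v)) ^ a) := fun v => by
    simp only [norm_rescale_apply, snorm_dyadic]
    ring
  simp only [h2]
  rw [integral_const_mul, h, smul_eq_mul, ← mul_assoc, mul_inv_cancel₀ (dyadicDet_pos s m).ne',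
    one_mul]
  rfl

theorem integral_rescale (m : ℤ) (ψ : 𝓢(Rd d, ℂ)) : ∫ v, rescale s m ψ v = ∫ v, ψ v := by
  simp only [rescale_apply]
  rw [integral_const_mul, integral_comp_dyadic s m fun v => ψ v, Complex.real_smul, ← mul_assoc]
  have := (dyadicDet_pos s m).ne'
  push_cast
  rw [mul_inv_cancel₀ (by exact_mod_cast this), one_mul]

/-- Moving the centre of the weight from v to y costs a factor depending only on the rescaled
distance 2^m ‖y-v‖, which a kernel living at scale 2^{-m} integrates to a constant independent of m.
-/
theorem weight_le {m : ℤ} {a : ℝ} (ha : 0 ≤ a) (x y v : Rd d) :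
    ((2 : ℝ) ^ (-m) + snorm s (v - x)) ^ a
      ≤ ((2 : ℝ) ^ (-m) + snorm s (y - x)) ^ a * (1 + 2 ^ m * snorm s (y - v)) ^ a := by
  have h1 := snorm_nonneg s (y - x)
  have h2 := snorm_nonneg s (y - v)
  have h3 := snorm_nonneg s (v - x)
  have hm : (0 : ℝ) < 2 ^ (-m) := by positivity
  rw [← Real.mul_rpow (by positivity) (by positivity)]
  refine Real.rpow_le_rpow (by positivity) ?_ ha
  have h4 := snorm_sub_le s v y x
  rw [snorm_sub_comm s v y] at h4
  have h5 : (2 : ℝ) ^ (-m) * 2 ^ m = 1 := by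
    rw [zpow_neg, inv_mul_cancel₀]; positivity
  have h6 : (0 : ℝ) ≤ 2 ^ m * snorm s (y - v) := by positivity
  calc (2 : ℝ) ^ (-m) + snorm s (v - x) ≤ 2 ^ (-m) + (snorm s (y - v) + snorm s (y - x)) := by gcongr
    _ = 2 ^ (-m) + ((2 ^ (-m) * 2 ^ m) * snorm s (y - v) + snorm s (y - x)) := by rw [h5, one_mul]
    _ ≤ _ := by nlinarith

theorem snorm_rpow_le_weight {m : ℤ} {a : ℝ} (ha : 0 ≤ a) (x : Rd d) :
    snorm s x ^ a ≤ ((2 : ℝ) ^ (-m) + snorm s x) ^ a := by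
  refine Real.rpow_le_rpow (snorm_nonneg s x) ?_ ha
  have : (0 : ℝ) < 2 ^ (-m) := by positivity
  linarith

section smear

variable {X : Type*} [NormedAddCommGroup X] [NormedSpace ℂ X]

/-- The convolution of a Schwartz function and a vector valued function. -/
noncomputable def smear (ψ : 𝓢(Rd d, ℂ)) (E : Rd d → X) (y : Rd d) : X := ∫ v, ψ (y - v) • E v

/-- A kernel at scale 2^{-m} preserves weighted bounds that are regularised at the same scale. The
bound on E is only asked almost everywhere because Besov norms are essential suprema. -/
theorem norm_smear_rescale_le (m : ℤ) (ψ : 𝓢(Rd d, ℂ)) {E : Rd d → X} {K a : ℝ} (ha : 0 ≤ a)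
    (x y : Rd d) (hE : ∀ᵐ v, ‖E v‖ ≤ K * ((2 : ℝ) ^ (-m) + snorm s (v - x)) ^ a) (hK : 0 ≤ K) :
    ‖smear (rescale s m ψ) E y‖
      ≤ K * weightedL1 s ψ a * ((2 : ℝ) ^ (-m) + snorm s (y - x)) ^ a := by
  set w := ((2 : ℝ) ^ (-m) + snorm s (y - x)) ^ a
  have h1 := ((integrable_rescale_weight s m ψ a).comp_sub_left y).const_mul (K * w)
  have h2 : ∀ᵐ v, ‖rescale s m ψ (y - v) • E v‖
      ≤ K * w * (‖rescale s m ψ (y - v)‖ * (1 + 2 ^ m * snorm s (y - v)) ^ a) := by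
    filter_upwards [hE] with v hv
    rw [norm_smul]
    calc ‖rescale s m ψ (y - v)‖ * ‖E v‖
        ≤ ‖rescale s m ψ (y - v)‖ * (K * (w * (1 + 2 ^ m * snorm s (y - v)) ^ a)) := by
          gcongr
          refine hv.trans ?_
          gcongr
          exact weight_le s ha x y v
      _ = _ := by ring
  refine (norm_integral_le_of_norm_le h1 h2).trans (le_of_eq ?_)
  rw [integral_const_mul, integral_sub_left_eq_self
    (fun v => ‖rescale s m ψ v‖ * (1 + 2 ^ m * snorm s v) ^ a), integral_rescale_weight]
  ring

/-- The kernel `ψ₁(y - u) ψ₂(y - v)` integrated against a function of `(u, v)`. -/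
noncomputable def smear₂ (ψ₁ ψ₂ : 𝓢(Rd d, ℂ)) (H : Rd d × Rd d → X) (y : Rd d) : X :=
  ∫ z : Rd d × Rd d, (ψ₁ (y - z.1) * ψ₂ (y - z.2)) • H z

/-- Both distances are recentred at y. The variable u enters both of them, hence the exponent a + b
on its kernel and only a on the other. -/
theorem norm_kernel₂_rescale_le (m : ℤ) (ψ₁ ψ₂ : 𝓢(Rd d, ℂ)) {a b : ℝ} (ha : 0 ≤ a) (hb : 0 ≤ b)
    (x y : Rd d) (z : Rd d × Rd d) :
    ‖rescale s m ψ₁ (y - z.1)‖ * ‖rescale s m ψ₂ (y - z.2)‖ *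
        (snorm s (z.2 - z.1) ^ a * snorm s (z.1 - x) ^ b)
      ≤ ((2 : ℝ) ^ (-m)) ^ a * ((2 : ℝ) ^ (-m) + snorm s (y - x)) ^ b *
        ((‖rescale s m ψ₁ (y - z.1)‖ * (1 + 2 ^ m * snorm s (y - z.1)) ^ (a + b)) *
        (‖rescale s m ψ₂ (y - z.2)‖ * (1 + 2 ^ m * snorm s (y - z.2)) ^ a)) := by
  obtain ⟨u, v⟩ := z
  simp only
  set w := ((2 : ℝ) ^ (-m) + snorm s (y - x)) ^ b
  set c := ((2 : ℝ) ^ (-m)) ^ a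
  have hu := snorm_nonneg s (y - u)
  have hv := snorm_nonneg s (y - v)
  have hu' : (0 : ℝ) < 1 + 2 ^ m * snorm s (y - u) := by positivity
  have e1 : snorm s (v - u) ^ a ≤ c * (1 + 2 ^ m * snorm s (y - u)) ^ a *
      (1 + 2 ^ m * snorm s (y - v)) ^ a := by
    calc snorm s (v - u) ^ a ≤ ((2 : ℝ) ^ (-m) + snorm s (v - u)) ^ a :=
          snorm_rpow_le_weight s ha _
      _ ≤ ((2 : ℝ) ^ (-m) + snorm s (y - u)) ^ a * (1 + 2 ^ m * snorm s (y - v)) ^ a :=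
          weight_le s ha u y v
      _ = _ := by
          have hf : (2 : ℝ) ^ (-m) + snorm s (y - u)
              = (2 : ℝ) ^ (-m) * (1 + 2 ^ m * snorm s (y - u)) := by
            rw [mul_add, mul_one, ← mul_assoc, zpow_neg, inv_mul_cancel₀ (by positivity), one_mul]
          rw [hf, Real.mul_rpow (by positivity) hu'.le]
  have e2 : snorm s (u - x) ^ b ≤ w * (1 + 2 ^ m * snorm s (y - u)) ^ b :=
    (snorm_rpow_le_weight s hb _).trans (weight_le s hb x y u)
  have e3 : 0 ≤ snorm s (u - x) ^ b := Real.rpow_nonneg (snorm_nonneg _ _) _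
  calc _ ≤ ‖rescale s m ψ₁ (y - u)‖ * ‖rescale s m ψ₂ (y - v)‖ *
        ((c * (1 + 2 ^ m * snorm s (y - u)) ^ a * (1 + 2 ^ m * snorm s (y - v)) ^ a) *
          (w * (1 + 2 ^ m * snorm s (y - u)) ^ b)) := by gcongr
    _ = _ := by rw [Real.rpow_add hu']; ring

/-- Several pairs of exponents are allowed because Γ produces one term for each homogeneity between
α and γ. -/
theorem norm_smear₂_rescale_le {ι : Type*} (S : Finset ι) (m : ℤ) (ψ₁ ψ₂ : 𝓢(Rd d, ℂ))
    {H : Rd d × Rd d → X} {K : ℝ} {a b : ι → ℝ} (ha : ∀ i ∈ S, 0 ≤ a i) (hb : ∀ i ∈ S, 0 ≤ b i)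
    (x y : Rd d)
    (hH : ∀ u v, ‖H (u, v)‖ ≤ K * ∑ i ∈ S, snorm s (v - u) ^ a i * snorm s (u - x) ^ b i)
    (hK : 0 ≤ K) :
    ‖smear₂ (rescale s m ψ₁) (rescale s m ψ₂) H y‖
      ≤ K * ∑ i ∈ S, weightedL1 s ψ₁ (a i + b i) * weightedL1 s ψ₂ (a i) *
        (((2 : ℝ) ^ (-m)) ^ a i * ((2 : ℝ) ^ (-m) + snorm s (y - x)) ^ b i) := by
  set w := fun i => ((2 : ℝ) ^ (-m) + snorm s (y - x)) ^ b i
  set c := fun i => ((2 : ℝ) ^ (-m)) ^ a i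
  set B := fun i (z : Rd d × Rd d) =>
    (‖rescale s m ψ₁ (y - z.1)‖ * (1 + 2 ^ m * snorm s (y - z.1)) ^ (a i + b i)) *
        (‖rescale s m ψ₂ (y - z.2)‖ * (1 + 2 ^ m * snorm s (y - z.2)) ^ a i)
  have hB : ∀ i, Integrable (B i) := fun i =>
    ((integrable_rescale_weight s m ψ₁ (a i + b i)).comp_sub_left y).mul_prod
      ((integrable_rescale_weight s m ψ₂ (a i)).comp_sub_left y)
  have hI : ∀ i, ∫ z, B i z = weightedL1 s ψ₁ (a i + b i) * weightedL1 s ψ₂ (a i) := fun i => by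
    have h3 := integral_prod_mul (μ := (volume : Measure (Rd d))) (ν := (volume : Measure (Rd d)))
      (fun u => ‖rescale s m ψ₁ (y - u)‖ * (1 + 2 ^ m * snorm s (y - u)) ^ (a i + b i))
      (fun v => ‖rescale s m ψ₂ (y - v)‖ * (1 + 2 ^ m * snorm s (y - v)) ^ a i)
    rw [integral_sub_left_eq_self
      (fun v => ‖rescale s m ψ₁ v‖ * (1 + 2 ^ m * snorm s v) ^ (a i + b i)),
      integral_sub_left_eq_self (fun v => ‖rescale s m ψ₂ v‖ * (1 + 2 ^ m * snorm s v) ^ a i),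
      integral_rescale_weight, integral_rescale_weight] at h3
    exact h3
  have h1 : Integrable fun z => ∑ i ∈ S, K * (c i * w i) * B i z :=
    integrable_finsetSum _ fun i _ => (hB i).const_mul _
  have h2 : ∀ z : Rd d × Rd d, ‖(rescale s m ψ₁ (y - z.1) * rescale s m ψ₂ (y - z.2)) • H z‖
      ≤ ∑ i ∈ S, K * (c i * w i) * B i z := by
    intro z
    rw [norm_smul, norm_mul]
    calc _ ≤ ‖rescale s m ψ₁ (y - z.1)‖ * ‖rescale s m ψ₂ (y - z.2)‖ *
          (K * ∑ i ∈ S, snorm s (z.2 - z.1) ^ a i * snorm s (z.1 - x) ^ b i) := by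
          gcongr
          exact hH z.1 z.2
      _ = ∑ i ∈ S, K * (‖rescale s m ψ₁ (y - z.1)‖ * ‖rescale s m ψ₂ (y - z.2)‖ *
          (snorm s (z.2 - z.1) ^ a i * snorm s (z.1 - x) ^ b i)) := by
          rw [Finset.mul_sum, Finset.mul_sum]
          exact Finset.sum_congr rfl fun i _ => by ring
      _ ≤ _ := by
          refine Finset.sum_le_sum fun i hi => ?_
          rw [mul_assoc K]
          exact mul_le_mul_of_nonneg_left
            (norm_kernel₂_rescale_le s m ψ₁ ψ₂ (ha i hi) (hb i hi) x y z) hK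
  refine (norm_integral_le_of_norm_le h1 (Eventually.of_forall h2)).trans (le_of_eq ?_)
  rw [integral_finsetSum _ fun i _ => (hB i).const_mul _, Finset.mul_sum]
  refine Finset.sum_congr rfl fun i _ => ?_
  rw [integral_const_mul, hI]
  ring

end smear

end Scaling

/-! ### Fourier multipliers and convolution identities. -/

section FourierSupport

variable {d : ℕ} {s : Fin d → ℕ+}

/-- Kernel identities are checked on the Fourier side, where derivatives, dilations and convolutions
all become pointwise formulas. -/
theorem schwartz_ext_fourier {f g : 𝓢(Rd d, ℂ)}
    (h : ∀ ξ, (𝓕 f : 𝓢(Rd d, ℂ)) ξ = (𝓕 g : 𝓢(Rd d, ℂ)) ξ) : f = g := by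
  have h1 : (𝓕 f : 𝓢(Rd d, ℂ)) = 𝓕 g := SchwartzMap.ext h
  have h2 := congrArg (fun x : 𝓢(Rd d, ℂ) => (𝓕⁻ x : 𝓢(Rd d, ℂ))) h1
  simpa using h2

theorem fourier_lineDeriv_apply (f : 𝓢(Rd d, ℂ)) (m ξ : Rd d) :
    (𝓕 (∂_{m} f : 𝓢(Rd d, ℂ)) : 𝓢(Rd d, ℂ)) ξ
      = (2 * Real.pi * Complex.I) * (inner ℝ ξ m : ℝ) * (𝓕 f : 𝓢(Rd d, ℂ)) ξ := by
  have hm : (fun x : Rd d => (inner ℝ x m : ℝ)).HasTemperateGrowth :=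
    ((innerSL ℝ).flip m).hasTemperateGrowth
  rw [SchwartzMap.fourier_lineDerivOp_eq]
  simp [SchwartzMap.smulLeftCLM_apply_apply hm, mul_assoc]

/-- The Fourier multiplier of `∂ᵏ`. -/
noncomputable def derivMultiplier (k : Fin d → ℕ) (ξ : Rd d) : ℂ :=
  ∏ i, (2 * Real.pi * Complex.I * (ξ i : ℂ)) ^ k i

theorem fourier_multiDeriv (k : Fin d → ℕ) (f : 𝓢(Rd d, ℂ)) (ξ : Rd d) :
    (𝓕 (multiDeriv k f) : 𝓢(Rd d, ℂ)) ξ = derivMultiplier k ξ * (𝓕 f : 𝓢(Rd d, ℂ)) ξ := by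
  have hiter : ∀ (i : Fin d) (n : ℕ) (g : 𝓢(Rd d, ℂ)),
      (𝓕 ((fun h : 𝓢(Rd d, ℂ) => (∂_{EuclideanSpace.single i (1 : ℝ)} h : 𝓢(Rd d, ℂ)))^[n] g) :
        𝓢(Rd d, ℂ)) ξ = (2 * Real.pi * Complex.I * (ξ i : ℂ)) ^ n * (𝓕 g : 𝓢(Rd d, ℂ)) ξ := by
    intro i n g
    induction n with
    | zero => simp
    | succ n ih =>
      rw [Function.iterate_succ_apply', fourier_lineDeriv_apply, ih]
      simp [EuclideanSpace.inner_single_right]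
      ring
  unfold multiDeriv derivMultiplier
  rw [← List.prod_ofFn, List.ofFn_eq_map]
  induction List.finRange d with
  | nil => simp
  | cons i l ih =>
    rw [List.foldr_cons, hiter, ih, List.map_cons, List.prod_cons, ← mul_assoc]

theorem multiDeriv_zero (f : 𝓢(Rd d, ℂ)) : multiDeriv 0 f = f :=
  schwartz_ext_fourier fun ξ => by simp [fourier_multiDeriv, derivMultiplier]

theorem multiDeriv_add_single (k : Fin d → ℕ) (i : Fin d) (f : 𝓢(Rd d, ℂ)) :
    multiDeriv (k + Pi.single i 1) f = ∂_{EuclideanSpace.single i (1 : ℝ)} (multiDeriv k f) := by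
  refine schwartz_ext_fourier fun ξ => ?_
  rw [fourier_lineDeriv_apply, fourier_multiDeriv, fourier_multiDeriv]
  have : derivMultiplier (k + Pi.single i 1) ξ
      = derivMultiplier k ξ * (2 * Real.pi * Complex.I * (ξ i : ℂ)) := by
    unfold derivMultiplier
    simp only [Pi.add_apply, pow_add, Finset.prod_mul_distrib]
    congr 1
    rw [Finset.prod_eq_single i]
    · simp
    · intro j _ hj
      simp [Pi.single_eq_of_ne hj]
    · simp
  rw [this]
  simp [EuclideanSpace.inner_single_right]
  ring

theorem multiDeriv_add (k : Fin d → ℕ) (f g : 𝓢(Rd d, ℂ)) :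
    multiDeriv k (f + g) = multiDeriv k f + multiDeriv k g := by
  refine schwartz_ext_fourier fun ξ => ?_
  simp [fourier_multiDeriv, FourierTransform.fourier_add, mul_add]

theorem inner_dyadic_left (m : ℤ) (x y : Rd d) :
    (inner ℝ (dyadic s m x) y : ℝ) = inner ℝ x (dyadic s m y) := by
  simp only [PiLp.inner_apply, dyadic_apply, scale]
  refine Finset.sum_congr rfl fun i _ => ?_
  simp only [RCLike.inner_apply, conj_trivial]
  ring

theorem dyadic_dyadic (m n : ℤ) (x : Rd d) : dyadic s m (dyadic s n x) = dyadic s (m + n) x := by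
  ext i
  simp only [dyadic_apply, scale]
  rw [zpow_add₀ (two_ne_zero), mul_pow, mul_assoc]

theorem dyadic_zero (x : Rd d) : dyadic s 0 x = x := by
  ext i
  simp [dyadic_apply, scale]

theorem fourier_rescale (m : ℤ) (ψ : 𝓢(Rd d, ℂ)) (ξ : Rd d) :
    (𝓕 (rescale s m ψ) : 𝓢(Rd d, ℂ)) ξ = (𝓕 ψ : 𝓢(Rd d, ℂ)) (dyadic s (-m) ξ) := by
  rw [SchwartzMap.fourier_coe, SchwartzMap.fourier_coe, Real.fourier_eq, Real.fourier_eq]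
  have h := integral_comp_dyadic s m
    fun v => Real.fourierChar (-(inner ℝ v (dyadic s (-m) ξ))) • ψ v
  have h2 : ∀ v, Real.fourierChar (-(inner ℝ v ξ)) • rescale s m ψ v = (dyadicDet s m : ℂ) •
      (Real.fourierChar (-(inner ℝ (dyadic s m v) (dyadic s (-m) ξ))) • ψ (dyadic s m v)) := by
    intro v
    rw [← inner_dyadic_left, dyadic_dyadic, neg_add_cancel, dyadic_zero, rescale_apply, smul_comm,
      smul_eq_mul]
  simp only [h2]
  rw [integral_smul, h, ← Complex.coe_smul, smul_smul]
  have := (dyadicDet_pos s m).ne'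
  push_cast
  rw [mul_inv_cancel₀ (by exact_mod_cast this), one_smul]

theorem derivMultiplier_dyadic (k : Fin d → ℕ) (m : ℤ) (ξ : Rd d) :
    derivMultiplier k (dyadic s m ξ) = (((2 : ℝ) ^ m) ^ deg s k : ℝ) * derivMultiplier k ξ := by
  unfold derivMultiplier deg
  rw [← Finset.prod_pow_eq_pow_sum]
  push_cast
  rw [← Finset.prod_mul_distrib]
  refine Finset.prod_congr rfl fun i _ => ?_
  simp only [dyadic_apply, scale]
  push_cast
  rw [mul_comm (k i), pow_mul, ← mul_pow]
  ring

theorem multiDeriv_rescale (k : Fin d → ℕ) (m : ℤ) (ψ : 𝓢(Rd d, ℂ)) :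
    multiDeriv k (rescale s m ψ)
      = (((2 : ℝ) ^ m) ^ deg s k : ℂ) • rescale s m (multiDeriv k ψ) := by
  refine schwartz_ext_fourier fun ξ => ?_
  rw [FourierTransform.fourier_smul, smul_apply, fourier_multiDeriv, fourier_rescale,
    fourier_rescale, fourier_multiDeriv, smul_eq_mul, ← mul_assoc]
  congr 1
  have h := derivMultiplier_dyadic (s := s) k m (dyadic s (-m) ξ)
  rw [dyadic_dyadic, add_neg_cancel, dyadic_zero] at h
  rw [h]
  push_cast
  rfl

/-! ### Convolution identities -/

theorem integral_mul_of_fourier_mul {a b c : 𝓢(Rd d, ℂ)}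
    (h : ∀ ξ, (𝓕 a : 𝓢(Rd d, ℂ)) ξ * (𝓕 b : 𝓢(Rd d, ℂ)) ξ = (𝓕 c : 𝓢(Rd d, ℂ)) ξ) (w v : Rd d) :
    ∫ y, a (w - y) * b (y - v) = c (w - v) := by
  have h1 : SchwartzMap.convolution (ContinuousLinearMap.mul ℂ ℂ) a b = c :=
    schwartz_ext_fourier fun ξ => by
      rw [SchwartzMap.fourier_convolution, SchwartzMap.pairing_apply_apply]
      exact h ξ
  rw [← h1, SchwartzMap.convolution_apply, MeasureTheory.convolution_def,
    ← integral_sub_left_eq_self _ _ w]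
  refine integral_congr_ae (Eventually.of_forall fun y => ?_)
  simp only [ContinuousLinearMap.mul_apply']
  rw [sub_sub_cancel, sub_right_comm]

theorem fourier_fourier_apply (a : 𝓢(Rd d, ℂ)) (x : Rd d) :
    (𝓕 (𝓕 a : 𝓢(Rd d, ℂ)) : 𝓢(Rd d, ℂ)) x = a (-x) := by
  have h : (𝓕⁻ (𝓕 a : 𝓢(Rd d, ℂ)) : 𝓢(Rd d, ℂ)) (-x) = a (-x) := by simp
  rw [SchwartzMap.fourierInv_apply_eq] at h
  simpa using h

theorem fourier_mul_eq_zero (a b : 𝓢(Rd d, ℂ)) (ξ : Rd d)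
    (h : ∀ θ, (𝓕 a : 𝓢(Rd d, ℂ)) θ * (𝓕 b : 𝓢(Rd d, ℂ)) (ξ - θ) = 0) :
    (𝓕 (SchwartzMap.pairing (ContinuousLinearMap.mul ℂ ℂ) a b) : 𝓢(Rd d, ℂ)) ξ = 0 := by
  -- The transform of a product is deduced from that of a convolution: after one more Fourier
  -- transform both sides become a(-x) b(-x).
  have h1 : (𝓕 (SchwartzMap.pairing (ContinuousLinearMap.mul ℂ ℂ) a b) : 𝓢(Rd d, ℂ))
      = SchwartzMap.convolution (ContinuousLinearMap.mul ℂ ℂ) (𝓕 a) (𝓕 b) := by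
    refine schwartz_ext_fourier fun x => ?_
    rw [SchwartzMap.fourier_convolution, SchwartzMap.pairing_apply_apply, fourier_fourier_apply,
      fourier_fourier_apply, fourier_fourier_apply, SchwartzMap.pairing_apply_apply]
  rw [h1, SchwartzMap.convolution_apply, MeasureTheory.convolution_def]
  simp only [ContinuousLinearMap.mul_apply', h, integral_zero]

theorem fourier_compSubConst (a : 𝓢(Rd d, ℂ)) (u ξ : Rd d) :
    (𝓕 (SchwartzMap.compSubConstCLM ℂ u a) : 𝓢(Rd d, ℂ)) ξ
      = (Real.fourierChar (-(inner ℝ u ξ : ℝ)) : ℂ) * (𝓕 a : 𝓢(Rd d, ℂ)) ξ := by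
  rw [SchwartzMap.fourier_coe, SchwartzMap.fourier_coe, Real.fourier_eq, Real.fourier_eq,
    ← integral_add_right_eq_self _ u, ← integral_const_mul]
  refine integral_congr_ae (Eventually.of_forall fun y => ?_)
  simp only [SchwartzMap.compSubConstCLM_apply, add_sub_cancel_right, inner_add_left, neg_add,
    AddChar.map_add_eq_mul, Circle.smul_def, Circle.coe_mul, smul_eq_mul]
  ring

/-- The product b(· - u) c(· - v) has spectrum in the sum of the two spectra, as translations only
contribute phases. If this sum misses the spectrum of a, the convolution with a vanishes. -/
theorem integral_mul_mul_eq_zero (a b c : 𝓢(Rd d, ℂ))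
    (h : ∀ ξ θ, (𝓕 a : 𝓢(Rd d, ℂ)) ξ * ((𝓕 b : 𝓢(Rd d, ℂ)) θ * (𝓕 c : 𝓢(Rd d, ℂ)) (ξ - θ)) = 0)
    (w u v : Rd d) : ∫ y, a (w - y) * (b (y - u) * c (y - v)) = 0 := by
  set G := SchwartzMap.pairing (ContinuousLinearMap.mul ℂ ℂ) (SchwartzMap.compSubConstCLM ℂ u b)
    (SchwartzMap.compSubConstCLM ℂ v c)
  have h1 := integral_mul_of_fourier_mul (a := a) (b := G) (c := 0) (fun ξ => by
    rw [FourierTransform.fourier_zero, zero_apply]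
    by_cases hξ : (𝓕 a : 𝓢(Rd d, ℂ)) ξ = 0
    · simp [hξ]
    · rw [fourier_mul_eq_zero, mul_zero]
      intro θ
      have := (mul_eq_zero.1 (h ξ θ)).resolve_left hξ
      rw [fourier_compSubConst, fourier_compSubConst]
      linear_combination (Real.fourierChar (-(inner ℝ u θ : ℝ)) : ℂ) *
        (Real.fourierChar (-(inner ℝ v (ξ - θ) : ℝ)) : ℂ) * this) w 0
  simpa [G] using h1

end FourierSupport

/-! ### Frequency supports of the dyadic partition of unity. -/

namespace DyadicCutoff

variable {d : ℕ} {s : Fin d → ℕ+} (φ : DyadicCutoff s)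

theorem dilate_apply (j : ℤ) (ξ : Rd d) : φ.dilate j ξ = (φ.toFun (dyadic s (-j) ξ) : ℂ) := by
  simp [dilate, base_apply]

theorem mem_box_iff (j : ℤ) (x : Rd d) :
    x ∈ box s j ↔ ∀ i, |x i| ≤ ((2 : ℝ) ^ (j + 1)) ^ (s i : ℕ) := by
  constructor
  · rintro ⟨y, hy, rfl⟩ i
    have := abs_le.2 (hy i)
    simp only [scale]
    rw [abs_mul, abs_of_pos (by positivity)]
    exact mul_le_of_le_one_right (by positivity) this
  · intro h
    refine ⟨dyadic s (-(j + 1)) x, fun i => abs_le.1 ?_, ?_⟩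
    · simp only [dyadic_apply, scale]
      rw [abs_mul, abs_of_pos (by positivity), zpow_neg, inv_pow,
        inv_mul_le_iff₀ (by positivity), mul_one]
      exact h i
    · rw [← dyadic_apply, dyadic_dyadic, add_neg_cancel, dyadic_zero]

theorem abs_dyadic_le_iff (m j : ℤ) (x : Rd d) (i : Fin d) :
    |dyadic s m x i| ≤ ((2 : ℝ) ^ (j + m)) ^ (s i : ℕ) ↔ |x i| ≤ ((2 : ℝ) ^ j) ^ (s i : ℕ) := by
  simp only [dyadic_apply, scale]
  rw [abs_mul, abs_of_pos (by positivity), zpow_add₀ two_ne_zero, mul_pow, mul_comm (((2 : ℝ) ^ j) ^ _)]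
  exact mul_le_mul_iff_right₀ (by positivity)

theorem toFun_eq_one {x : Rd d} (hx : ∀ i, |x i| ≤ 1) : φ.toFun x = 1 := by
  obtain ⟨U, _, hU, h1⟩ := φ.eq_one
  exact h1 x (hU ((mem_box_iff _ _).2 (by simpa using hx)))

theorem dilate_eq_one {j : ℤ} {ξ : Rd d} (h : ∀ i, |ξ i| ≤ ((2 : ℝ) ^ j) ^ (s i : ℕ)) :
    φ.dilate j ξ = 1 := by
  rw [dilate_apply, φ.toFun_eq_one, Complex.ofReal_one]
  intro i
  have := (abs_dyadic_le_iff (-j) j ξ i).2 (h i)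
  simpa using this

theorem abs_le_of_dilate_ne_zero {j : ℤ} {ξ : Rd d} (h : φ.dilate j ξ ≠ 0) (i : Fin d) :
    |ξ i| ≤ ((2 : ℝ) ^ (j + 1)) ^ (s i : ℕ) := by
  rw [dilate_apply, Ne, Complex.ofReal_eq_zero] at h
  have h1 := φ.tsupport_subset (subset_tsupport _ h)
  have h2 := (mem_box_iff _ _).1 h1 i
  rw [← abs_dyadic_le_iff (-j) (j + 1)]
  convert h2 using 3
  ring

theorem zpow_pow_mono {m n : ℤ} (h : m ≤ n) (k : ℕ) : ((2 : ℝ) ^ m) ^ k ≤ ((2 : ℝ) ^ n) ^ k :=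
  pow_le_pow_left₀ (by positivity) (zpow_le_zpow_right₀ one_le_two h) k

theorem dilate_zero : φ.dilate 0 = φ.base := by
  ext ξ
  simp [dilate, dyadic_zero]

theorem abs_le_of_part_ne_zero {j : ℤ} {ξ : Rd d} (h : φ.part j ξ ≠ 0) (i : Fin d) :
    |ξ i| ≤ ((2 : ℝ) ^ (j + 2)) ^ (s i : ℕ) := by
  unfold part at h
  split_ifs at h with hj
  · rw [← dilate_zero] at h
    refine (φ.abs_le_of_dilate_ne_zero h i).trans (zpow_pow_mono (by omega) _)
  · by_contra hc
    have h1 : φ.dilate (j + 1) ξ = 0 := by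
      by_contra h1
      exact hc ((φ.abs_le_of_dilate_ne_zero h1 i).trans (zpow_pow_mono (by omega) _))
    have h2 : φ.dilate j ξ = 0 := by
      by_contra h1
      exact hc ((φ.abs_le_of_dilate_ne_zero h1 i).trans (zpow_pow_mono (by omega) _))
    rw [sub_apply, h1, h2, sub_zero] at h
    exact h rfl

theorem part_eq_zero {j : ℤ} (hj : j ≠ -1) {ξ : Rd d}
    (h : ∀ i, |ξ i| ≤ ((2 : ℝ) ^ j) ^ (s i : ℕ)) : φ.part j ξ = 0 := by
  rw [part, if_neg hj, sub_apply, φ.dilate_eq_one h, φ.dilate_eq_one, sub_self]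
  exact fun i => (h i).trans (zpow_pow_mono (by omega) _)

theorem sum_part (n : ℕ) : ∑ i ∈ Finset.Ico (-1 : ℤ) n, φ.part i = φ.dilate n := by
  induction n with
  | zero =>
    rw [show Finset.Ico (-1 : ℤ) ((0 : ℕ) : ℤ) = {-1} from rfl, Finset.sum_singleton, part, if_pos rfl]
    exact (dilate_zero φ).symm
  | succ n ih =>
    have : Finset.Ico (-1 : ℤ) ((n + 1 : ℕ) : ℤ) = insert (n : ℤ) (Finset.Ico (-1 : ℤ) n) := by
      ext x; simp only [Finset.mem_Ico, Finset.mem_insert]; omega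
    rw [this, Finset.sum_insert (by simp), ih, part, if_neg (by omega)]
    push_cast
    abel

theorem fourier_psi (j : ℤ) : (𝓕 (φ.psi j) : 𝓢(Rd d, ℂ)) = φ.part j := by
  simp [psi]

theorem psiLT_eq {m : ℤ} (hm : 0 ≤ m) : φ.psiLT m = 𝓕⁻ (φ.dilate m) := by
  lift m to ℕ using hm
  rw [← sum_part]
  simp only [psiLT, psi]
  exact (map_sum (FourierTransform.fourierInvCLM ℂ 𝓢(Rd d, ℂ)) _ _).symm

theorem fourier_psiLT {m : ℤ} (hm : 0 ≤ m) : (𝓕 (φ.psiLT m) : 𝓢(Rd d, ℂ)) = φ.dilate m := by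
  rw [psiLT_eq φ hm]
  simp

/-- The inverse Fourier transform of `φ₋₁(2^(-m𝔰) ·)`. -/
noncomputable def low (m : ℤ) : 𝓢(Rd d, ℂ) := 𝓕⁻ (φ.dilate m)

theorem fourier_low (m : ℤ) : (𝓕 (φ.low m) : 𝓢(Rd d, ℂ)) = φ.dilate m := by
  simp [low]

/-- The reference scale i is free, and the profile depends only on m - i. This lets Ψ^{<i-1} be
treated at the same scale as Ψ^i, with a fixed profile. -/
theorem psiLT_eq_rescale {m : ℤ} (i : ℤ) (hm : 0 ≤ m) :
    φ.psiLT m = rescale s i (φ.low (m - i)) := by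
  refine schwartz_ext_fourier fun ξ => ?_
  rw [fourier_rescale, fourier_psiLT φ hm, fourier_low, dilate_apply, dilate_apply, dyadic_dyadic]
  congr 4
  ring

theorem psi_eq_rescale {j : ℤ} (hj : 0 ≤ j) : φ.psi j = rescale s j (φ.psi 0) := by
  refine schwartz_ext_fourier fun ξ => ?_
  rw [fourier_rescale, fourier_psi, fourier_psi, part, part, if_neg (by omega), if_neg (by omega),
    sub_apply, sub_apply]
  simp only [dilate_apply, dyadic_dyadic]
  congr 5
  · ring
  · ring

theorem psiLT_add_one {m : ℤ} (hm : -1 ≤ m) : φ.psiLT (m + 1) = φ.psiLT m + φ.psi m := by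
  have : Finset.Ico (-1 : ℤ) (m + 1) = insert m (Finset.Ico (-1 : ℤ) m) := by
    ext x; simp only [Finset.mem_Ico, Finset.mem_insert]; omega
  rw [psiLT, this, Finset.sum_insert (by simp), add_comm]
  rfl

theorem integral_eq_fourier (ψ : 𝓢(Rd d, ℂ)) : ∫ v, ψ v = (𝓕 ψ : 𝓢(Rd d, ℂ)) 0 := by
  rw [SchwartzMap.fourier_coe, Real.fourier_eq]
  simp

theorem integral_psi {j : ℤ} (hj : 0 ≤ j) : ∫ v, φ.psi j v = 0 := by
  rw [integral_eq_fourier, fourier_psi, part_eq_zero φ (by omega)]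
  intro i
  simp only [PiLp.zero_apply, abs_zero]
  positivity

theorem integral_psiLT {m : ℤ} (hm : 0 ≤ m) : ∫ v, φ.psiLT m v = 1 := by
  rw [integral_eq_fourier, fourier_psiLT φ hm, dilate_eq_one φ]
  intro i
  simp only [PiLp.zero_apply, abs_zero]
  positivity

theorem integral_psi_mul_psiLT {l m : ℤ} (hl : -1 ≤ l) (hm : l + 2 ≤ m) (w v : Rd d) :
    ∫ y, φ.psi l (w - y) * φ.psiLT m (y - v) = φ.psi l (w - v) := by
  refine integral_mul_of_fourier_mul (fun ξ => ?_) w v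
  rw [fourier_psi, fourier_psiLT φ (by omega)]
  by_cases h : φ.part l ξ = 0
  · simp [h]
  · rw [dilate_eq_one φ, mul_one]
    exact fun i => (φ.abs_le_of_part_ne_zero h i).trans (zpow_pow_mono (by omega) _)

/-- A reproducing formula: the multiplier of Ψ^{<l+2} equals 1 on the support of φ_l, so it can
carry the derivative. It later turns almost-everywhere bounds on a block into pointwise bounds on
its derivatives. -/
theorem integral_multiDeriv_psiLT_mul_psi (k : Fin d → ℕ) {l : ℤ} (hl : -1 ≤ l) (w v : Rd d) :
    ∫ y, multiDeriv k (φ.psiLT (l + 2)) (w - y) * φ.psi l (y - v)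
      = multiDeriv k (φ.psi l) (w - v) := by
  refine integral_mul_of_fourier_mul (fun ξ => ?_) w v
  rw [fourier_multiDeriv, fourier_multiDeriv, fourier_psi, fourier_psiLT φ (by omega)]
  by_cases h : φ.part l ξ = 0
  · simp [h]
  · rw [dilate_eq_one φ, mul_one]
    exact fun i => φ.abs_le_of_part_ne_zero h i

theorem integral_psi_mul_psi {l i : ℤ} (hl : i + 3 ≤ l) (hi : -1 ≤ i) (w v : Rd d) :
    ∫ y, φ.psi l (w - y) * φ.psi i (y - v) = 0 := by
  have := integral_mul_of_fourier_mul (a := φ.psi l) (b := φ.psi i) (c := 0) (fun ξ => ?_) w v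
  · simpa using this
  · rw [fourier_psi, fourier_psi, FourierTransform.fourier_zero, zero_apply]
    by_cases h : φ.part i ξ = 0
    · simp [h]
    · rw [part_eq_zero φ (by omega), zero_mul]
      exact fun k => (φ.abs_le_of_part_ne_zero h k).trans (zpow_pow_mono (by omega) _)

/-- The i-th paraproduct term has frequencies of size at most 2 · 2^{(i+2)𝔰ₖ} ≤ 2^{(i+3)𝔰ₖ} in
direction k, and φ_l vanishes there once l ≥ i + 3. -/
theorem integral_psi_mul_psiLT_mul_psi_eq_zero_of_le {l i : ℤ} (hl : i + 3 ≤ l) (hi : 0 < i)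
    (w u v : Rd d) : ∫ y, φ.psi l (w - y) * (φ.psiLT (i - 1) (y - u) * φ.psi i (y - v)) = 0 := by
  refine integral_mul_mul_eq_zero _ _ _ (fun ξ θ => ?_) w u v
  rw [fourier_psi, fourier_psi, fourier_psiLT φ (by omega)]
  by_contra h
  simp only [mul_eq_zero, not_or] at h
  obtain ⟨h1, h2, h3⟩ := h
  refine h1 (part_eq_zero φ (by omega) fun k => ?_)
  have e1 := φ.abs_le_of_dilate_ne_zero h2 k
  have e2 := φ.abs_le_of_part_ne_zero h3 k
  have hs : 1 ≤ (s k : ℕ) := (s k).pos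
  have e3 : |ξ k| ≤ |θ k| + |(ξ - θ) k| := by
    have := abs_add_le (θ k) ((ξ - θ) k)
    simpa using this
  have e4 : ((2 : ℝ) ^ (i + 3)) ^ (s k : ℕ) ≥ 2 * ((2 : ℝ) ^ (i + 2)) ^ (s k : ℕ) := by
    rw [show i + 3 = 1 + (i + 2) by ring, zpow_add₀ two_ne_zero, mul_pow]
    gcongr
    simpa using pow_le_pow_right₀ (one_le_two (α := ℝ)) hs
  have e5 := zpow_pow_mono (show i - 1 + 1 ≤ i + 2 by omega) (s k : ℕ)
  have e6 := zpow_pow_mono hl (s k : ℕ)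
  linarith

/-- A paraproduct term has no low frequencies either. After rescaling by 2^{-i𝔰}, the factor
Ψ^{<i-1} lives in the unit box while φ_i vanishes on a neighbourhood U of that box, so the two
frequencies cannot add up to something very small. How small depends on U, hence a constant
depending on φ. -/
theorem exists_integral_psi_mul_psiLT_mul_psi_eq_zero :
    ∃ c : ℕ, 3 ≤ c ∧ ∀ l i : ℤ, -1 ≤ l → 0 < i → l + c ≤ i → ∀ w u v : Rd d,
      ∫ y, φ.psi l (w - y) * (φ.psiLT (i - 1) (y - u) * φ.psi i (y - v)) = 0 := by
  obtain ⟨U, hU, hbox, h1⟩ := φ.eq_one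
  have hK : IsCompact (box s (-1)) := by
    have h1 : IsCompact {x : Rd d | ∀ i, x i ∈ Set.Icc (-1 : ℝ) 1} := by
      have h3 := (isCompact_univ_pi fun _ : Fin d => isCompact_Icc (a := (-1 : ℝ)) (b := 1)).image
        (PiLp.continuous_toLp 2 (fun _ : Fin d => ℝ))
      convert h3 using 1
      ext x
      constructor
      · intro hx
        exact ⟨x.ofLp, fun i _ => hx i, rfl⟩
      · rintro ⟨y, hy, rfl⟩
        exact fun i => hy i trivial
    exact h1.image (dyadic s (-1 + 1)).continuous
  -- The room δ between the box and the complement of U comes from compactness. The power 2^{-n} is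
  -- then taken so small that a vector with d coordinates of this size has norm below δ.
  obtain ⟨δ, hδ, hthick⟩ := hK.exists_thickening_subset_open hU hbox
  obtain ⟨n, hn⟩ := exists_pow_lt_of_lt_one (show 0 < δ / (d + 1) by positivity)
    (show (1 / 2 : ℝ) < 1 by norm_num)
  -- Two of the extra scales pay for φ_l being supported in 2^{(l+2)𝔰}[-1,1]^d; the third secures
  -- the lower bound 3.
  refine ⟨n + 3, by omega, fun l i hl hi hli w u v => ?_⟩
  push_cast at hli
  refine integral_mul_mul_eq_zero _ _ _ (fun ξ θ => ?_) w u v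
  rw [fourier_psi, fourier_psi, fourier_psiLT φ (by omega)]
  by_contra h
  simp only [mul_eq_zero, not_or] at h
  obtain ⟨h1', h2, h3⟩ := h
  set η := dyadic s (-i) (ξ - θ) with hη
  have e1 : ∀ k, |(dyadic s (-i) θ) k| ≤ 1 := fun k => by
    have := (abs_dyadic_le_iff (-i) i θ k).2
      ((φ.abs_le_of_dilate_ne_zero h2 k).trans (zpow_pow_mono (by omega) _))
    simpa using this
  have e2 : ∀ k, |(dyadic s (-i) ξ) k| ≤ (1 / 2 : ℝ) ^ n := fun k => by
    have := (abs_dyadic_le_iff (-i) (l + 2) ξ k).2 (φ.abs_le_of_part_ne_zero h1' k)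
    refine this.trans ((zpow_pow_mono (show l + 2 + -i ≤ -(n : ℤ) by omega) _).trans ?_)
    rw [zpow_neg, zpow_natCast, one_div, inv_pow 2 n]
    exact pow_le_of_le_one (by positivity)
      (inv_le_one_of_one_le₀ (one_le_pow₀ (one_le_two (α := ℝ)))) (s k).ne_zero
  have e3 : η ∈ U := by
    refine hthick (Metric.mem_thickening_iff.2 ⟨-dyadic s (-i) θ, ?_, ?_⟩)
    · rw [mem_box_iff]
      intro k
      simpa using e1 k
    · have : η - -dyadic s (-i) θ = dyadic s (-i) ξ := by
        rw [hη, map_sub]; abel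
      rw [dist_eq_norm, this]
      have h5 : ‖dyadic s (-i) ξ‖ ≤ ∑ k : Fin d, |(dyadic s (-i) ξ) k| := by
        have := norm_sum_le Finset.univ
          fun k => EuclideanSpace.single k ((dyadic s (-i) ξ) k)
        have hsum : ∑ k, EuclideanSpace.single k ((dyadic s (-i) ξ) k) = dyadic s (-i) ξ := by
          ext j
          simp [Finset.sum_apply]
        rw [hsum] at this
        simpa using this
      calc ‖dyadic s (-i) ξ‖ ≤ ∑ k : Fin d, (1 / 2 : ℝ) ^ n :=
            h5.trans (Finset.sum_le_sum fun k _ => e2 k)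
        _ = d * (1 / 2 : ℝ) ^ n := by simp
        _ ≤ (d + 1) * (1 / 2 : ℝ) ^ n := by gcongr; linarith
        _ < (d + 1) * (δ / (d + 1)) := by gcongr
        _ = δ := by field_simp
  -- Both cutoffs whose difference is φ_i equal 1 at ξ - θ: the inner one because η lies in U, the
  -- outer one because halving the scale brings η into the unit box.
  refine h3 ?_
  rw [part, if_neg (by omega), sub_apply, dilate_apply, dilate_apply, ← hη, h1 η e3,
    show -(i + 1) = -1 + -i by ring, ← dyadic_dyadic, ← hη, toFun_eq_one, sub_self]
  intro k
  have e4 : |η k| ≤ ((2 : ℝ) ^ (1 : ℤ)) ^ (s k : ℕ) := by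
    have : η k = (dyadic s (-i) ξ) k - (dyadic s (-i) θ) k := by rw [hη, map_sub]; rfl
    have h6 := abs_sub ((dyadic s (-i) ξ) k) ((dyadic s (-i) θ) k)
    have h7 := e2 k
    have h8 : (1 / 2 : ℝ) ^ n ≤ 1 := pow_le_one₀ (by norm_num) (by norm_num)
    have h9 : (2 : ℝ) ≤ 2 ^ (s k : ℕ) := by
      simpa using pow_le_pow_right₀ (one_le_two (α := ℝ)) (show 1 ≤ (s k : ℕ) from (s k).pos)
    rw [this, zpow_one]
    linarith [e1 k]
  have := (abs_dyadic_le_iff (-1) 1 η k).2 e4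
  simpa using this

end DyadicCutoff

/-! ### Polynomial growth, integrability and exchange of integrals. -/

namespace Scaling

variable {d : ℕ} (s : Fin d → ℕ+)

theorem one_add_snorm_pos (x : Rd d) : 0 < 1 + snorm s x := by
  have := snorm_nonneg s x
  positivity

theorem one_add_snorm_rpow_nonneg (x : Rd d) (a : ℝ) : 0 ≤ (1 + snorm s x) ^ a :=
  Real.rpow_nonneg (one_add_snorm_pos s x).le a

theorem one_le_one_add_snorm_rpow (x : Rd d) {a : ℝ} (ha : 0 ≤ a) : 1 ≤ (1 + snorm s x) ^ a :=
  Real.one_le_rpow (by linarith [snorm_nonneg s x]) ha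

theorem one_add_snorm_rpow_le {a : ℝ} (ha : 0 ≤ a) (x y v : Rd d) :
    (1 + snorm s (v - x)) ^ a ≤ (1 + snorm s (y - x)) ^ a * (1 + snorm s (y - v)) ^ a := by
  simpa using weight_le s (m := 0) ha x y v

theorem rescale_zero (ψ : 𝓢(Rd d, ℂ)) : rescale s 0 ψ = ψ := by
  refine schwartz_ext_fourier fun ξ => ?_
  rw [fourier_rescale, neg_zero, dyadic_zero]

theorem continuous_one_add_snorm_rpow (a : ℝ) : Continuous fun v : Rd d => (1 + snorm s v) ^ a := by
  simpa using continuous_weight s one_pos a (0 : Rd d)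

/-- By translation invariance the inner integral of the dominating function does not depend on the
outer variable, so Tonelli's criterion reduces to integrability of f. -/
theorem integrable_prod_of_const {Z : Type*} [MeasurableSpace Z] [TopologicalSpace Z]
    [SecondCountableTopology Z] [BorelSpace Z]
    {μ : Measure Z} [SFinite μ] {f : Rd d → ℝ} {g : Rd d × Z → ℝ} {I : ℝ} (hf : Integrable f)
    (hfc : Continuous f) (hgc : Continuous g) (hg0 : ∀ p, 0 ≤ g p)
    (hg : ∀ y, Integrable (fun z => g (y, z)) μ) (hI : ∀ y, ∫ z, g (y, z) ∂μ = I) :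
    Integrable (fun p : Rd d × Z => f p.1 * g p) ((volume : Measure (Rd d)).prod μ) := by
  have hc : Continuous fun p : Rd d × Z => f p.1 * g p := (hfc.comp continuous_fst).mul hgc
  refine (integrable_prod_iff hc.aestronglyMeasurable).2
    ⟨Eventually.of_forall fun y => (hg y).const_mul (f y), ?_⟩
  have : ∀ y, ∫ z, ‖f y * g (y, z)‖ ∂μ = ‖f y‖ * I := fun y => by
    simp only [norm_mul, Real.norm_of_nonneg (hg0 _)]
    rw [integral_const_mul, hI]
  simp only [this]
  exact hf.norm.mul_const _

section smear

variable {X : Type*} [NormedAddCommGroup X] [NormedSpace ℂ X]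

theorem norm_smul_le_weight {E : Rd d → X} {K a : ℝ} (ha : 0 ≤ a) (hK : 0 ≤ K) {x : Rd d}
    (hE : ∀ v, ‖E v‖ ≤ K * (1 + snorm s (v - x)) ^ a) (ψ : 𝓢(Rd d, ℂ)) (y v : Rd d) :
    ‖ψ (y - v) • E v‖
      ≤ K * (1 + snorm s (y - x)) ^ a * (‖ψ (y - v)‖ * (1 + snorm s (y - v)) ^ a) := by
  rw [norm_smul]
  calc ‖ψ (y - v)‖ * ‖E v‖
      ≤ ‖ψ (y - v)‖ * (K * ((1 + snorm s (y - x)) ^ a * (1 + snorm s (y - v)) ^ a)) := by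
        gcongr
        refine (hE v).trans ?_
        gcongr
        exact one_add_snorm_rpow_le s ha x y v
    _ = _ := by ring

theorem integrable_smear {E : Rd d → X} {K a : ℝ} (ha : 0 ≤ a) (hK : 0 ≤ K) {x : Rd d}
    (hE : ∀ v, ‖E v‖ ≤ K * (1 + snorm s (v - x)) ^ a) (hm : AEStronglyMeasurable E)
    (ψ : 𝓢(Rd d, ℂ)) (y : Rd d) : Integrable fun v => ψ (y - v) • E v := by
  refine (((integrable_norm_mul_weight s ψ a).comp_sub_left y).const_mul
    (K * (1 + snorm s (y - x)) ^ a)).mono' ?_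
    (Eventually.of_forall (norm_smul_le_weight s ha hK hE ψ y))
  refine AEStronglyMeasurable.smul ?_ hm
  exact (ψ.continuous.comp (continuous_const.sub continuous_id)).aestronglyMeasurable

theorem norm_smear_le {E : Rd d → X} {K a : ℝ} (ha : 0 ≤ a) (hK : 0 ≤ K) {x : Rd d}
    (hE : ∀ v, ‖E v‖ ≤ K * (1 + snorm s (v - x)) ^ a) (ψ : 𝓢(Rd d, ℂ)) (y : Rd d) :
    ‖smear ψ E y‖ ≤ K * weightedL1 s ψ a * (1 + snorm s (y - x)) ^ a := by
  have := norm_smear_rescale_le s 0 ψ ha x y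
    (Eventually.of_forall fun v => by simpa using hE v) hK
  simpa [rescale_zero] using this

theorem aestronglyMeasurable_smear {E : Rd d → X} (hm : AEStronglyMeasurable E)
    (ψ : 𝓢(Rd d, ℂ)) : AEStronglyMeasurable (smear ψ E) := by
  have : AEStronglyMeasurable (fun p : Rd d × Rd d => ψ (p.1 - p.2) • E p.2)
      ((volume : Measure (Rd d)).prod volume) :=
    (ψ.continuous.comp (continuous_fst.sub continuous_snd)).aestronglyMeasurable.smul hm.comp_snd
  exact this.integral_prod_right'

theorem smear_smear {E : Rd d → X} [CompleteSpace X] {K a : ℝ} (ha : 0 ≤ a) (hK : 0 ≤ K) {x : Rd d}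
    (hE : ∀ v, ‖E v‖ ≤ K * (1 + snorm s (v - x)) ^ a) (hm : AEStronglyMeasurable E)
    {f g h : 𝓢(Rd d, ℂ)} (hfg : ∀ w v, ∫ y, f (w - y) * g (y - v) = h (w - v)) (w : Rd d) :
    smear f (smear g E) w = smear h E w := by
  have hint : Integrable (Function.uncurry fun y v => f (w - y) • g (y - v) • E v)
      ((volume : Measure (Rd d)).prod volume) := by
    have h1 : Integrable fun y => ‖f (w - y)‖ * (1 + snorm s (y - x)) ^ a := by
      have := ((integrable_norm_mul_weight s f a).comp_sub_left w).const_mul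
        ((1 + snorm s (w - x)) ^ a)
      refine this.mono' ?_ (Eventually.of_forall fun y => ?_)
      · exact ((f.continuous.comp (continuous_const.sub continuous_id)).norm.mul
          (continuous_weight s one_pos a x)).aestronglyMeasurable
      · rw [Real.norm_of_nonneg (mul_nonneg (norm_nonneg _) (one_add_snorm_rpow_nonneg s _ _))]
        have := mul_le_mul_of_nonneg_left (one_add_snorm_rpow_le s ha x w y) (norm_nonneg (f (w - y)))
        linarith
    have h2 := integrable_prod_of_const (μ := (volume : Measure (Rd d)))
      (g := fun p : Rd d × Rd d => K * (‖g (p.1 - p.2)‖ * (1 + snorm s (p.1 - p.2)) ^ a))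
      (I := K * weightedL1 s g a) h1
      ((f.continuous.comp (continuous_const.sub continuous_id)).norm.mul
          (continuous_weight s one_pos a x))
      (continuous_const.mul ((g.continuous.comp (continuous_fst.sub continuous_snd)).norm.mul
        ((continuous_one_add_snorm_rpow s a).comp (continuous_fst.sub continuous_snd))))
      (fun p => mul_nonneg hK (mul_nonneg (norm_nonneg _) (one_add_snorm_rpow_nonneg s _ _)))
      (fun y => ((integrable_norm_mul_weight s g a).comp_sub_left y).const_mul K)
      (fun y => by
        rw [integral_const_mul, integral_sub_left_eq_self
          (fun v => ‖g v‖ * (1 + snorm s v) ^ a)]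
        rfl)
    refine h2.mono' ?_ (Eventually.of_forall fun p => ?_)
    · exact (f.continuous.comp (continuous_const.sub continuous_fst)).aestronglyMeasurable.smul
        ((g.continuous.comp (continuous_fst.sub continuous_snd)).aestronglyMeasurable.smul
          hm.comp_snd)
    · simp only [Function.uncurry]
      rw [norm_smul]
      have := mul_le_mul_of_nonneg_left (norm_smul_le_weight s ha hK hE g p.1 p.2)
        (norm_nonneg (f (w - p.1)))
      refine this.trans (le_of_eq ?_)
      ring
  calc smear f (smear g E) w = ∫ y, ∫ v, f (w - y) • g (y - v) • E v := by
        simp only [smear, integral_smul]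
    _ = ∫ v, ∫ y, f (w - y) • g (y - v) • E v := integral_integral_swap hint
    _ = ∫ v, h (w - v) • E v := by
        refine integral_congr_ae (Eventually.of_forall fun v => ?_)
        simp only [smul_smul]
        rw [integral_smul_const, hfg]

theorem norm_kernel₂_le {H : Rd d × Rd d → X} {K a b : ℝ} (ha : 0 ≤ a) (hb : 0 ≤ b) (hK : 0 ≤ K)
    {x : Rd d} (hH : ∀ u v, ‖H (u, v)‖ ≤ K * (1 + snorm s (v - u)) ^ a * (1 + snorm s (u - x)) ^ b)
    (ψ₁ ψ₂ : 𝓢(Rd d, ℂ)) (y : Rd d) (z : Rd d × Rd d) :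
    ‖(ψ₁ (y - z.1) * ψ₂ (y - z.2)) • H z‖ ≤ K * (1 + snorm s (y - x)) ^ b *
      ((‖ψ₁ (y - z.1)‖ * (1 + snorm s (y - z.1)) ^ (a + b)) *
        (‖ψ₂ (y - z.2)‖ * (1 + snorm s (y - z.2)) ^ a)) := by
  obtain ⟨u, v⟩ := z
  simp only
  have e0 := one_add_snorm_rpow_nonneg s (u - x) b
  rw [norm_smul, norm_mul]
  calc ‖ψ₁ (y - u)‖ * ‖ψ₂ (y - v)‖ * ‖H (u, v)‖
      ≤ ‖ψ₁ (y - u)‖ * ‖ψ₂ (y - v)‖ *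
        (K * ((1 + snorm s (y - u)) ^ a * (1 + snorm s (y - v)) ^ a) *
          ((1 + snorm s (y - x)) ^ b * (1 + snorm s (y - u)) ^ b)) := by
        have e3 := one_add_snorm_rpow_nonneg s (y - u) a
        have e4 := one_add_snorm_rpow_nonneg s (y - v) a
        gcongr
        refine (hH u v).trans ?_
        gcongr
        · exact one_add_snorm_rpow_le s ha u y v
        · exact one_add_snorm_rpow_le s hb x y u
    _ = _ := by rw [Real.rpow_add (one_add_snorm_pos s _)]; ring

theorem integrable_kernel₂ {H : Rd d × Rd d → X} {K a b : ℝ} (ha : 0 ≤ a) (hb : 0 ≤ b) (hK : 0 ≤ K)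
    {x : Rd d} (hH : ∀ u v, ‖H (u, v)‖ ≤ K * (1 + snorm s (v - u)) ^ a * (1 + snorm s (u - x)) ^ b)
    (hm : AEStronglyMeasurable H) (ψ₁ ψ₂ : 𝓢(Rd d, ℂ)) (y : Rd d) :
    Integrable fun z : Rd d × Rd d => (ψ₁ (y - z.1) * ψ₂ (y - z.2)) • H z := by
  have i1 := (integrable_norm_mul_weight s ψ₁ (a + b)).comp_sub_left y
  have i2 := (integrable_norm_mul_weight s ψ₂ a).comp_sub_left y
  refine ((i1.mul_prod i2).const_mul (K * (1 + snorm s (y - x)) ^ b)).mono' ?_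
    (Eventually.of_forall (norm_kernel₂_le s ha hb hK hH ψ₁ ψ₂ y))
  exact ((ψ₁.continuous.comp (continuous_const.sub continuous_fst)).mul
    (ψ₂.continuous.comp (continuous_const.sub continuous_snd))).aestronglyMeasurable.smul hm

theorem norm_smear₂_le {H : Rd d × Rd d → X} {K a b : ℝ} (ha : 0 ≤ a) (hb : 0 ≤ b) (hK : 0 ≤ K)
    {x : Rd d} (hH : ∀ u v, ‖H (u, v)‖ ≤ K * (1 + snorm s (v - u)) ^ a * (1 + snorm s (u - x)) ^ b)
    (ψ₁ ψ₂ : 𝓢(Rd d, ℂ)) (y : Rd d) :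
    ‖smear₂ ψ₁ ψ₂ H y‖ ≤ K * (1 + snorm s (y - x)) ^ b *
      (weightedL1 s ψ₁ (a + b) * weightedL1 s ψ₂ a) := by
  have i1 := (integrable_norm_mul_weight s ψ₁ (a + b)).comp_sub_left y
  have i2 := (integrable_norm_mul_weight s ψ₂ a).comp_sub_left y
  refine (norm_integral_le_of_norm_le ((i1.mul_prod i2).const_mul (K * (1 + snorm s (y - x)) ^ b))
    (Eventually.of_forall (norm_kernel₂_le s ha hb hK hH ψ₁ ψ₂ y))).trans (le_of_eq ?_)
  have h3 := integral_prod_mul (μ := (volume : Measure (Rd d))) (ν := (volume : Measure (Rd d)))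
    (fun u => ‖ψ₁ (y - u)‖ * (1 + snorm s (y - u)) ^ (a + b))
    (fun v => ‖ψ₂ (y - v)‖ * (1 + snorm s (y - v)) ^ a)
  rw [integral_sub_left_eq_self (fun v => ‖ψ₁ v‖ * (1 + snorm s v) ^ (a + b)),
    integral_sub_left_eq_self (fun v => ‖ψ₂ v‖ * (1 + snorm s v) ^ a)] at h3
  rw [integral_const_mul]
  exact congrArg (K * (1 + snorm s (y - x)) ^ b * ·) h3

theorem aestronglyMeasurable_smear₂ {H : Rd d × Rd d → X} (hm : AEStronglyMeasurable H)
    (ψ₁ ψ₂ : 𝓢(Rd d, ℂ)) : AEStronglyMeasurable (smear₂ ψ₁ ψ₂ H) := by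
  have : AEStronglyMeasurable
      (fun p : Rd d × Rd d × Rd d => (ψ₁ (p.1 - p.2.1) * ψ₂ (p.1 - p.2.2)) • H p.2)
      ((volume : Measure (Rd d)).prod volume) := by
    refine AEStronglyMeasurable.smul (Continuous.aestronglyMeasurable ?_) hm.comp_snd
    refine (ψ₁.continuous.comp ?_).mul (ψ₂.continuous.comp ?_)
    all_goals fun_prop
  exact this.integral_prod_right'

theorem smear_smear₂_eq_zero [CompleteSpace X] {H : Rd d × Rd d → X} {K a b : ℝ} (ha : 0 ≤ a)
    (hb : 0 ≤ b) (hK : 0 ≤ K) {x : Rd d}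
    (hH : ∀ u v, ‖H (u, v)‖ ≤ K * (1 + snorm s (v - u)) ^ a * (1 + snorm s (u - x)) ^ b)
    (hm : AEStronglyMeasurable H) {f g h : 𝓢(Rd d, ℂ)}
    (hfgh : ∀ w u v, ∫ y, f (w - y) * (g (y - u) * h (y - v)) = 0) (w : Rd d) :
    smear f (smear₂ g h H) w = 0 := by
  have hint : Integrable (Function.uncurry fun y (z : Rd d × Rd d) =>
      f (w - y) • (g (y - z.1) * h (y - z.2)) • H z) ((volume : Measure (Rd d)).prod volume) := by
    have h1 : Integrable fun y => ‖f (w - y)‖ * (1 + snorm s (y - x)) ^ b := by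
      have := ((integrable_norm_mul_weight s f b).comp_sub_left w).const_mul
        ((1 + snorm s (w - x)) ^ b)
      refine this.mono' ?_ (Eventually.of_forall fun y => ?_)
      · exact ((f.continuous.comp (continuous_const.sub continuous_id)).norm.mul
          (continuous_weight s one_pos b x)).aestronglyMeasurable
      · rw [Real.norm_of_nonneg (mul_nonneg (norm_nonneg _) (one_add_snorm_rpow_nonneg s _ _))]
        have := mul_le_mul_of_nonneg_left (one_add_snorm_rpow_le s hb x w y) (norm_nonneg (f (w - y)))
        linarith
    have h2 := integrable_prod_of_const (μ := (volume : Measure (Rd d × Rd d)))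
      (g := fun p : Rd d × Rd d × Rd d =>
        K * ((‖g (p.1 - p.2.1)‖ * (1 + snorm s (p.1 - p.2.1)) ^ (a + b)) *
          (‖h (p.1 - p.2.2)‖ * (1 + snorm s (p.1 - p.2.2)) ^ a)))
      (I := K * (weightedL1 s g (a + b) * weightedL1 s h a)) h1
      ((f.continuous.comp (continuous_const.sub continuous_id)).norm.mul
          (continuous_weight s one_pos b x))
      (by
        have c1 := continuous_one_add_snorm_rpow s (a + b)
        have c2 := continuous_one_add_snorm_rpow s a
        have c3 := g.continuous
        have c4 := h.continuous
        have p1 : Continuous fun p : Rd d × Rd d × Rd d => p.1 - p.2.1 := by fun_prop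
        have p2 : Continuous fun p : Rd d × Rd d × Rd d => p.1 - p.2.2 := by fun_prop
        exact continuous_const.mul (((c3.comp p1).norm.mul (c1.comp p1)).mul
          ((c4.comp p2).norm.mul (c2.comp p2))))
      (fun p => mul_nonneg hK (mul_nonneg
        (mul_nonneg (norm_nonneg _) (one_add_snorm_rpow_nonneg s _ _))
        (mul_nonneg (norm_nonneg _) (one_add_snorm_rpow_nonneg s _ _))))
      (fun y => (((integrable_norm_mul_weight s g (a + b)).comp_sub_left y).mul_prod
        ((integrable_norm_mul_weight s h a).comp_sub_left y)).const_mul K)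
      (fun y => by
        have h3 := integral_prod_mul (μ := (volume : Measure (Rd d)))
          (ν := (volume : Measure (Rd d)))
          (fun u => ‖g (y - u)‖ * (1 + snorm s (y - u)) ^ (a + b))
          (fun v => ‖h (y - v)‖ * (1 + snorm s (y - v)) ^ a)
        rw [integral_sub_left_eq_self (fun v => ‖g v‖ * (1 + snorm s v) ^ (a + b)),
          integral_sub_left_eq_self (fun v => ‖h v‖ * (1 + snorm s v) ^ a)] at h3
        rw [integral_const_mul]
        exact congrArg (K * ·) h3)
    refine h2.mono' ?_ (Eventually.of_forall fun p => ?_)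
    · refine (f.continuous.comp
        (continuous_const.sub continuous_fst)).aestronglyMeasurable.smul
        (((g.continuous.comp ?_).mul (h.continuous.comp ?_)).aestronglyMeasurable.smul hm.comp_snd)
      all_goals fun_prop
    · simp only [Function.uncurry]
      rw [norm_smul]
      have := mul_le_mul_of_nonneg_left (norm_kernel₂_le s ha hb hK hH g h p.1 p.2)
        (norm_nonneg (f (w - p.1)))
      refine this.trans (le_of_eq ?_)
      ring
  calc smear f (smear₂ g h H) w
      = ∫ y, ∫ z : Rd d × Rd d, f (w - y) • (g (y - z.1) * h (y - z.2)) • H z := by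
        simp only [smear, smear₂, integral_smul]
    _ = ∫ z : Rd d × Rd d, ∫ y, f (w - y) • (g (y - z.1) * h (y - z.2)) • H z :=
        integral_integral_swap hint
    _ = 0 := by
        refine (integral_congr_ae (Eventually.of_forall fun z => ?_)).trans (integral_zero _ _)
        simp only [smul_smul]
        rw [integral_smul_const, hfgh, zero_smul]

/-- The kernel is a product, so the variable that E does not see contributes only the total mass of
its factor: 1 for Ψ^{<i-1}, and 0 for Ψ^i in the companion `smear₂_fst`. -/
theorem smear₂_snd (f g : 𝓢(Rd d, ℂ)) (E : Rd d → X) (y : Rd d) :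
    smear₂ f g (fun z => E z.2) y = (∫ v, f v) • smear g E y := by
  have h := integral_prod_smul (μ := (volume : Measure (Rd d))) (ν := (volume : Measure (Rd d)))
    (fun u => f (y - u)) (fun v => g (y - v) • E v)
  rw [integral_sub_left_eq_self (fun v => f v)] at h
  simp only [smul_smul] at h
  exact h

theorem smear₂_fst (f g : 𝓢(Rd d, ℂ)) (E : Rd d → X) (y : Rd d) :
    smear₂ f g (fun z => E z.1) y = (∫ v, g v) • smear f E y := by
  have h := integral_prod_smul (μ := (volume : Measure (Rd d))) (ν := (volume : Measure (Rd d)))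
    (fun v => g (y - v)) (fun u => f (y - u) • E u)
  rw [integral_sub_left_eq_self (fun v => g v)] at h
  rw [smear, ← h, ← integral_prod_swap]
  refine integral_congr_ae (Eventually.of_forall fun z => ?_)
  simp only [smul_smul, Prod.fst_swap, Prod.snd_swap]
  rw [mul_comm]

/-- Measurable functions of at most polynomial growth. -/
def PolyGrowth (E : Rd d → X) : Prop :=
  AEStronglyMeasurable E ∧ ∃ K a : ℝ, 0 ≤ K ∧ 0 ≤ a ∧ ∀ v, ‖E v‖ ≤ K * (1 + snorm s v) ^ a

/-- Measurable functions of two variables of at most polynomial growth. -/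
def PolyGrowth₂ (H : Rd d × Rd d → X) : Prop :=
  AEStronglyMeasurable H ∧ ∃ K a : ℝ, 0 ≤ K ∧ 0 ≤ a ∧
    ∀ u v, ‖H (u, v)‖ ≤ K * ((1 + snorm s u) ^ a * (1 + snorm s v) ^ a)

theorem one_add_snorm_rpow_mono (x : Rd d) {a b : ℝ} (h : a ≤ b) :
    (1 + snorm s x) ^ a ≤ (1 + snorm s x) ^ b :=
  Real.rpow_le_rpow_of_exponent_le (by linarith [snorm_nonneg s x]) h

theorem one_add_snorm_sub_rpow_le {a : ℝ} (ha : 0 ≤ a) (x y : Rd d) :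
    (1 + snorm s (x - y)) ^ a ≤ (1 + snorm s x) ^ a * (1 + snorm s y) ^ a := by
  have := one_add_snorm_rpow_le s ha y 0 x
  simp only [zero_sub, snorm_neg] at this
  linarith

variable {s}

namespace PolyGrowth

variable {E E' : Rd d → X}

theorem of_bound (hm : AEStronglyMeasurable E) {K a : ℝ} (hK : 0 ≤ K) (ha : 0 ≤ a) (x : Rd d)
    (h : ∀ v, ‖E v‖ ≤ K * (1 + snorm s (v - x)) ^ a) : PolyGrowth s E := by
  refine ⟨hm, K * (1 + snorm s x) ^ a, a, mul_nonneg hK (one_add_snorm_rpow_nonneg s _ _), ha,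
    fun v => (h v).trans ?_⟩
  rw [mul_assoc]
  gcongr
  have := one_add_snorm_sub_rpow_le s ha v x
  linarith

theorem of_bounded (hm : AEStronglyMeasurable E) {K : ℝ} (h : ∀ v, ‖E v‖ ≤ K) : PolyGrowth s E :=
  of_bound hm ((norm_nonneg _).trans (h 0)) le_rfl 0 (by simpa using h)

theorem sub (h : PolyGrowth s E) (h' : PolyGrowth s E') : PolyGrowth s fun v => E v - E' v := by
  obtain ⟨hm, K, a, hK, ha, hE⟩ := h
  obtain ⟨hm', K', a', hK', ha', hE'⟩ := h'
  refine ⟨hm.sub hm', K + K', max a a', by positivity, le_max_of_le_left ha, fun v => ?_⟩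
  refine (norm_sub_le _ _).trans ?_
  rw [add_mul]
  refine add_le_add ((hE v).trans ?_) ((hE' v).trans ?_)
  · exact mul_le_mul_of_nonneg_left (one_add_snorm_rpow_mono s v (le_max_left _ _)) hK
  · exact mul_le_mul_of_nonneg_left (one_add_snorm_rpow_mono s v (le_max_right _ _)) hK'

theorem integrable (h : PolyGrowth s E) (ψ : 𝓢(Rd d, ℂ)) (y : Rd d) :
    Integrable fun v => ψ (y - v) • E v := by
  obtain ⟨hm, K, a, hK, ha, hE⟩ := h
  exact integrable_smear s ha hK (x := 0) (by simpa using hE) hm ψ y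

theorem smear (h : PolyGrowth s E) (ψ : 𝓢(Rd d, ℂ)) : PolyGrowth s (smear ψ E) := by
  obtain ⟨hm, K, a, hK, ha, hE⟩ := h
  refine of_bound (aestronglyMeasurable_smear hm ψ)
    (mul_nonneg hK (weightedL1_nonneg s ψ a)) ha 0 ?_
  exact norm_smear_le s ha hK (by simpa using hE) ψ

theorem smear_sub (h : PolyGrowth s E) (h' : PolyGrowth s E') (ψ : 𝓢(Rd d, ℂ)) (y : Rd d) :
    Scaling.smear ψ (fun v => E v - E' v) y = Scaling.smear ψ E y - Scaling.smear ψ E' y := by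
  simp only [Scaling.smear, smul_sub]
  exact integral_sub (h.integrable ψ y) (h'.integrable ψ y)

theorem smear_add_left (h : PolyGrowth s E) (ψ ψ' : 𝓢(Rd d, ℂ)) (y : Rd d) :
    Scaling.smear (ψ + ψ') E y = Scaling.smear ψ E y + Scaling.smear ψ' E y := by
  simp only [Scaling.smear, add_apply, add_smul]
  exact integral_add (h.integrable ψ y) (h.integrable ψ' y)

theorem smear_smear [CompleteSpace X] (h : PolyGrowth s E) {f g k : 𝓢(Rd d, ℂ)}
    (hfg : ∀ w v, ∫ y, f (w - y) * g (y - v) = k (w - v)) (w : Rd d) :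
    Scaling.smear f (Scaling.smear g E) w = Scaling.smear k E w := by
  obtain ⟨hm, K, a, hK, ha, hE⟩ := h
  exact Scaling.smear_smear s ha hK (x := 0) (by simpa using hE) hm hfg w

end PolyGrowth

namespace PolyGrowth₂

variable {H H' : Rd d × Rd d → X}

theorem of_bound (hm : AEStronglyMeasurable H) {K a : ℝ} (hK : 0 ≤ K) (ha : 0 ≤ a)
    (h : ∀ u v, ‖H (u, v)‖ ≤ K * (1 + snorm s (v - u)) ^ a) : PolyGrowth₂ s H := by
  refine ⟨hm, K, a, hK, ha, fun u v => (h u v).trans ?_⟩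
  gcongr
  have := one_add_snorm_sub_rpow_le s ha v u
  linarith

theorem fst {E : Rd d → X} (h : PolyGrowth s E) : PolyGrowth₂ s fun z => E z.1 := by
  obtain ⟨hm, K, a, hK, ha, hE⟩ := h
  refine ⟨hm.comp_fst, K, a, hK, ha, fun u v => (hE u).trans ?_⟩
  gcongr
  exact le_mul_of_one_le_right (one_add_snorm_rpow_nonneg s _ _)
    (one_le_one_add_snorm_rpow s v ha)

theorem snd {E : Rd d → X} (h : PolyGrowth s E) : PolyGrowth₂ s fun z => E z.2 := by
  obtain ⟨hm, K, a, hK, ha, hE⟩ := h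
  refine ⟨hm.comp_snd, K, a, hK, ha, fun u v => (hE v).trans ?_⟩
  gcongr
  exact le_mul_of_one_le_left (one_add_snorm_rpow_nonneg s _ _)
    (one_le_one_add_snorm_rpow s u ha)

theorem sub (h : PolyGrowth₂ s H) (h' : PolyGrowth₂ s H') : PolyGrowth₂ s fun z => H z - H' z := by
  obtain ⟨hm, K, a, hK, ha, hH⟩ := h
  obtain ⟨hm', K', a', hK', ha', hH'⟩ := h'
  refine ⟨hm.sub hm', K + K', max a a', by positivity, le_max_of_le_left ha, fun u v => ?_⟩
  have e1 := one_add_snorm_rpow_nonneg s u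
  have e2 := one_add_snorm_rpow_nonneg s v
  refine (norm_sub_le _ _).trans ?_
  rw [add_mul]
  refine add_le_add ((hH u v).trans ?_) ((hH' u v).trans ?_)
  · exact mul_le_mul_of_nonneg_left (mul_le_mul (one_add_snorm_rpow_mono s u (le_max_left _ _))
      (one_add_snorm_rpow_mono s v (le_max_left _ _)) (e2 _) (e1 _)) hK
  · exact mul_le_mul_of_nonneg_left (mul_le_mul (one_add_snorm_rpow_mono s u (le_max_right _ _))
      (one_add_snorm_rpow_mono s v (le_max_right _ _)) (e2 _) (e1 _)) hK'

/-- The triangle inequality trades the weight in v for weights in v - u and in u, the form required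
by the kernel estimates; hence the doubled exponent in u. -/
theorem exists_bound (h : PolyGrowth₂ s H) : ∃ K a b : ℝ, 0 ≤ K ∧ 0 ≤ a ∧ 0 ≤ b ∧
    ∀ u v, ‖H (u, v)‖ ≤ K * (1 + snorm s (v - u)) ^ a * (1 + snorm s (u - 0)) ^ b := by
  obtain ⟨hm, K, a, hK, ha, hH⟩ := h
  refine ⟨K, a, a + a, hK, ha, by positivity, fun u v => (hH u v).trans ?_⟩
  have h1 := one_add_snorm_rpow_le s ha 0 u v
  rw [snorm_sub_comm s u v, sub_zero, sub_zero] at h1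
  rw [sub_zero, Real.rpow_add (one_add_snorm_pos s u), mul_assoc]
  have e1 := one_add_snorm_rpow_nonneg s u a
  refine mul_le_mul_of_nonneg_left ((mul_le_mul_of_nonneg_left h1 e1).trans (le_of_eq ?_)) hK
  ring

theorem integrable (h : PolyGrowth₂ s H) (ψ₁ ψ₂ : 𝓢(Rd d, ℂ)) (y : Rd d) :
    Integrable fun z : Rd d × Rd d => (ψ₁ (y - z.1) * ψ₂ (y - z.2)) • H z := by
  obtain ⟨K, a, b, hK, ha, hb, hH⟩ := h.exists_bound
  exact integrable_kernel₂ s ha hb hK hH h.1 ψ₁ ψ₂ y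

theorem smear₂ (h : PolyGrowth₂ s H) (ψ₁ ψ₂ : 𝓢(Rd d, ℂ)) :
    PolyGrowth s (smear₂ ψ₁ ψ₂ H) := by
  obtain ⟨K, a, b, hK, ha, hb, hH⟩ := h.exists_bound
  refine PolyGrowth.of_bound (aestronglyMeasurable_smear₂ h.1 ψ₁ ψ₂)
    (K := K * (weightedL1 s ψ₁ (a + b) * weightedL1 s ψ₂ a)) (mul_nonneg hK
    (mul_nonneg (weightedL1_nonneg s _ _) (weightedL1_nonneg s _ _))) hb 0 fun y => ?_
  refine (norm_smear₂_le s ha hb hK hH ψ₁ ψ₂ y).trans (le_of_eq ?_)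
  ring

theorem smear₂_sub (h : PolyGrowth₂ s H) (h' : PolyGrowth₂ s H') (ψ₁ ψ₂ : 𝓢(Rd d, ℂ)) (y : Rd d) :
    Scaling.smear₂ ψ₁ ψ₂ (fun z => H z - H' z) y
      = Scaling.smear₂ ψ₁ ψ₂ H y - Scaling.smear₂ ψ₁ ψ₂ H' y := by
  simp only [Scaling.smear₂, smul_sub]
  exact integral_sub (h.integrable ψ₁ ψ₂ y) (h'.integrable ψ₁ ψ₂ y)

theorem smear_smear₂_eq_zero [CompleteSpace X] (h : PolyGrowth₂ s H) {f g k : 𝓢(Rd d, ℂ)}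
    (hfgk : ∀ w u v, ∫ y, f (w - y) * (g (y - u) * k (y - v)) = 0) (w : Rd d) :
    Scaling.smear f (Scaling.smear₂ g k H) w = 0 := by
  obtain ⟨K, a, b, hK, ha, hb, hH⟩ := h.exists_bound
  exact Scaling.smear_smear₂_eq_zero s ha hb hK hH h.1 hfgk w

end PolyGrowth₂

end smear

end Scaling

/-! ### Homogeneities, and the size and continuity of Γ. -/

namespace RegularityStructure

variable (R : RegularityStructure.{u})

theorem finite_below (γ : ℝ) : {α : R.A | (α : ℝ) < γ}.Finite := by
  obtain ⟨b, hb⟩ := R.bddBelow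
  have h := R.locallyFinite b γ
  refine Set.Finite.of_finite_image (f := Subtype.val) (h.subset ?_) Subtype.val_injective.injOn
  rintro _ ⟨α, hα, rfl⟩
  exact ⟨α.2, hb α.2, le_of_lt hα⟩

/-- The finite set of homogeneities below `γ`. -/
noncomputable def below (γ : ℝ) : Finset R.A := (R.finite_below γ).toFinset

@[simp]
theorem mem_below {γ : ℝ} {α : R.A} : α ∈ R.below γ ↔ (α : ℝ) < γ := by
  simp [below]

variable {R}

theorem sum_lof_below {γ : ℝ} {Φ : R.Space} (h : ∀ α : R.A, γ ≤ (α : ℝ) → Φ α = 0) :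
    ∑ α ∈ R.below γ, DirectSum.lof ℂ R.A R.T α (Φ α) = Φ := by
  refine DFinsupp.ext fun β => ?_
  have h1 : (∑ α ∈ R.below γ, DirectSum.lof ℂ R.A R.T α (Φ α)) β
      = ∑ α ∈ R.below γ, (DirectSum.lof ℂ R.A R.T α (Φ α)) β :=
    map_sum (DirectSum.component ℂ R.A R.T β) _ _
  rw [h1]
  by_cases hβ : (β : ℝ) < γ
  · rw [Finset.sum_eq_single β]
    · exact DirectSum.lof_apply ℂ β (Φ β)
    · intro α _ hα
      exact DirectSum.of_eq_of_ne _ _ _ (Ne.symm hα)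
    · intro h2
      exact absurd (R.mem_below.2 hβ) h2
  · rw [h β (not_lt.1 hβ), Finset.sum_eq_zero]
    intro α hα
    refine DirectSum.of_eq_of_ne _ _ _ ?_
    rintro rfl
    exact hβ (R.mem_below.1 hα)

end RegularityStructure

namespace Model

variable {R : RegularityStructure.{u}} {d : ℕ} {s : Fin d → ℕ+} (M : Model R s)

/-- The matrix coefficient of `Γ_{yx}` from `𝓣_α` to `𝓣_β`. -/
noncomputable def coeff (y x : Rd d) (α β : R.A) : R.T α →ₗ[ℂ] R.T β :=
  DirectSum.component ℂ R.A R.T β ∘ₗ (M.Γ y x).toLinearMap ∘ₗ DirectSum.lof ℂ R.A R.T α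

theorem coeff_apply (y x : Rd d) (α β : R.A) (τ : R.T α) :
    M.coeff y x α β τ = (M.Γ y x (DirectSum.lof ℂ R.A R.T α τ)) β := rfl

theorem coeff_of_not_lt (y x : Rd d) {α β : R.A} (h : ¬ β < α) (τ : R.T α) :
    M.coeff y x α β τ = (DirectSum.lof ℂ R.A R.T α τ) β :=
  sub_eq_zero.1 (R.triangular _ (M.Γ_mem y x) α τ β h)

theorem coeff_self (y x : Rd d) (α : R.A) (τ : R.T α) : M.coeff y x α α τ = τ := by
  rw [coeff_of_not_lt M y x (lt_irrefl α)]
  exact DirectSum.lof_apply ℂ α τ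

theorem coeff_of_lt (y x : Rd d) {α β : R.A} (h : α < β) (τ : R.T α) : M.coeff y x α β τ = 0 := by
  rw [coeff_of_not_lt M y x (not_lt.2 h.le)]
  exact DirectSum.of_eq_of_ne _ _ _ h.ne'

theorem coeff_refl (x : Rd d) {α β : R.A} (h : β ≠ α) (τ : R.T α) : M.coeff x x α β τ = 0 := by
  rw [coeff_apply, M.Γ_self]
  exact DirectSum.of_eq_of_ne _ _ _ h

theorem Γ_apply_eq_sum_below {γ : ℝ} {Φ : R.Space} (h : ∀ α : R.A, γ ≤ (α : ℝ) → Φ α = 0)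
    (y x : Rd d) (β : R.A) :
    (M.Γ y x Φ) β = ∑ α ∈ R.below γ, M.coeff y x α β (Φ α) := by
  conv_lhs => rw [← RegularityStructure.sum_lof_below h]
  rw [map_sum]
  exact map_sum (DirectSum.component ℂ R.A R.T β) _ _

theorem Γ_apply_eq_zero {γ : ℝ} {Φ : R.Space} (h : ∀ α : R.A, γ ≤ (α : ℝ) → Φ α = 0)
    (y x : Rd d) {β : R.A} (hβ : γ ≤ (β : ℝ)) : (M.Γ y x Φ) β = 0 := by
  rw [M.Γ_apply_eq_sum_below h]
  refine Finset.sum_eq_zero fun α hα => M.coeff_of_lt y x ?_ _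
  exact Subtype.coe_lt_coe.1 (lt_of_lt_of_le (R.mem_below.1 hα) hβ)

/-- The homogeneities strictly between `β` and `γ`. -/
noncomputable def _root_.RegularityStructure.between (R : RegularityStructure.{u}) (β : R.A)
    (γ : ℝ) : Finset R.A := (R.below γ).filter (β < ·)

@[simp]
theorem _root_.RegularityStructure.mem_between {β α : R.A} {γ : ℝ} :
    α ∈ R.between β γ ↔ (α : ℝ) < γ ∧ β < α := by
  simp [RegularityStructure.between]

/-- Triangularity of the structure group: the diagonal coefficients are identities, and
homogeneities below β contribute nothing to the β-component. -/
theorem Γ_apply_eq_add_sum {γ : ℝ} {Φ : R.Space} (h : ∀ α : R.A, γ ≤ (α : ℝ) → Φ α = 0)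
    (y x : Rd d) {β : R.A} (hβ : (β : ℝ) < γ) :
    (M.Γ y x Φ) β = Φ β + ∑ α ∈ R.between β γ, M.coeff y x α β (Φ α) := by
  rw [M.Γ_apply_eq_sum_below h, ← Finset.sum_filter_add_sum_filter_not (R.below γ) (β < ·), add_comm]
  congr 1
  rw [Finset.sum_eq_single β]
  · exact M.coeff_self y x β _
  · intro α hα hne
    refine M.coeff_of_lt y x ?_ _
    exact lt_of_le_of_ne (not_lt.1 (Finset.mem_filter.1 hα).2) hne
  · intro h2
    refine absurd ?_ h2
    simp [hβ]

/-- The model provides one constant for each pair of homogeneities, and only finitely many pairs lie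
below γ. -/
theorem normΓ_lt_top (γ : ℝ) : M.normΓ γ < ⊤ := by
  have h : ∀ α β : R.A, ∃ C : ℝ, 0 ≤ C ∧ (β < α → ∀ (x y : Rd d) (τ : R.T α),
      ‖(M.Γ y x (DirectSum.lof ℂ R.A R.T α τ)) β‖ ≤ C * ‖τ‖ * snorm s (x - y) ^ ((α : ℝ) - β)) := by
    intro α β
    by_cases hβ : β < α
    · obtain ⟨C, hC⟩ := M.Γ_bound α β hβ
      refine ⟨|C|, abs_nonneg C, fun _ x y τ => (hC x y τ).trans ?_⟩
      have := Real.rpow_nonneg (snorm_nonneg s (x - y)) ((α : ℝ) - β)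
      gcongr
      exact le_abs_self C
    · exact ⟨0, le_rfl, fun h => absurd h hβ⟩
  choose C hC0 hC using h
  refine lt_of_le_of_lt ?_
    (ENNReal.ofReal_lt_top (r := ∑ α ∈ R.below γ, ∑ β ∈ R.below γ, C α β))
  refine iSup_le fun x => iSup_le fun y => iSup_le fun hxy => iSup_le fun α => iSup_le fun β =>
    iSup_le fun hβ => iSup_le fun hα => iSup_le fun τ => iSup_le fun hτ => ?_
  have h0 : 0 < snorm s (x - y) := snorm_pos s (sub_ne_zero.2 hxy)
  rw [← ofReal_norm, ← ENNReal.ofReal_mul (norm_nonneg _)]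
  refine ENNReal.ofReal_le_ofReal ?_
  have h1 : C α β ≤ ∑ α ∈ R.below γ, ∑ β ∈ R.below γ, C α β := by
    have hα' : α ∈ R.below γ := R.mem_below.2 hα
    have hβ' : β ∈ R.below γ := R.mem_below.2 (lt_trans hβ hα)
    refine (Finset.single_le_sum (f := fun β => C α β) (fun β _ => hC0 α β) hβ').trans ?_
    exact Finset.single_le_sum (f := fun α => ∑ β ∈ R.below γ, C α β)
      (fun α _ => Finset.sum_nonneg fun β _ => hC0 α β) hα'
  refine le_trans ?_ h1
  have h2 := hC α β hβ x y τ
  have h3 : snorm s (x - y) ^ ((α : ℝ) - β) * snorm s (x - y) ^ ((β : ℝ) - α) = 1 := by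
    rw [← Real.rpow_add h0]; simp
  have h4 : 0 ≤ snorm s (x - y) ^ ((β : ℝ) - α) := Real.rpow_nonneg h0.le _
  calc _ ≤ C α β * ‖τ‖ * snorm s (x - y) ^ ((α : ℝ) - β) * snorm s (x - y) ^ ((β : ℝ) - α) := by
        gcongr
    _ = C α β * ‖τ‖ := by rw [mul_assoc, h3, mul_one]
    _ ≤ C α β := mul_le_of_le_one_right (hC0 α β) hτ

/-- `‖Γ‖_γ` as a real number. -/
noncomputable def realNormΓ (γ : ℝ) : ℝ := (M.normΓ γ).toReal

theorem realNormΓ_nonneg (γ : ℝ) : 0 ≤ M.realNormΓ γ := ENNReal.toReal_nonneg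

theorem norm_coeff_le {γ : ℝ} {α β : R.A} (hβ : β < α) (hα : (α : ℝ) < γ) (y x : Rd d)
    (τ : R.T α) :
    ‖M.coeff y x α β τ‖ ≤ M.realNormΓ γ * ‖τ‖ * snorm s (y - x) ^ ((α : ℝ) - β) := by
  have hr : 0 ≤ snorm s (y - x) ^ ((α : ℝ) - β) := Real.rpow_nonneg (snorm_nonneg s _) _
  rcases eq_or_ne x y with rfl | hxy
  · rw [M.coeff_refl x hβ.ne, norm_zero]
    have := M.realNormΓ_nonneg γ
    positivity
  have h0 : 0 < snorm s (x - y) := snorm_pos s (sub_ne_zero.2 hxy)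
  have key : ∀ σ : R.T α, ‖σ‖ ≤ 1 →
      ‖M.coeff y x α β σ‖ ≤ M.realNormΓ γ * snorm s (y - x) ^ ((α : ℝ) - β) := by
    intro σ hσ
    have h1 : ‖M.coeff y x α β σ‖ₑ * ENNReal.ofReal (snorm s (x - y) ^ ((β : ℝ) - α))
        ≤ M.normΓ γ := by
      unfold normΓ
      exact le_iSup_of_le x (le_iSup_of_le y (le_iSup_of_le hxy (le_iSup_of_le α
        (le_iSup_of_le β (le_iSup_of_le hβ (le_iSup_of_le hα (le_iSup_of_le σ
          (le_iSup_of_le hσ le_rfl))))))))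
    rw [← ofReal_norm, ← ENNReal.ofReal_mul (norm_nonneg _)] at h1
    have h2 : ‖M.coeff y x α β σ‖ * snorm s (x - y) ^ ((β : ℝ) - α) ≤ M.realNormΓ γ :=
      (ENNReal.ofReal_le_iff_le_toReal (M.normΓ_lt_top γ).ne).1 h1
    have h3 : snorm s (x - y) ^ ((β : ℝ) - α) * snorm s (x - y) ^ ((α : ℝ) - β) = 1 := by
      rw [← Real.rpow_add h0]; simp
    rw [snorm_sub_comm s y x]
    rw [snorm_sub_comm s y x] at hr
    calc ‖M.coeff y x α β σ‖ = ‖M.coeff y x α β σ‖ * snorm s (x - y) ^ ((β : ℝ) - α) *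
          snorm s (x - y) ^ ((α : ℝ) - β) := by rw [mul_assoc, h3, mul_one]
      _ ≤ _ := by gcongr
  rcases eq_or_ne τ 0 with rfl | hτ
  · simp
  have hτ' : 0 < ‖τ‖ := norm_pos_iff.2 hτ
  have h4 := key (((‖τ‖⁻¹ : ℝ) : ℂ) • τ) (by
    rw [norm_smul, Complex.norm_real, norm_inv, norm_norm, inv_mul_cancel₀ hτ'.ne'])
  rw [map_smul, norm_smul, Complex.norm_real, norm_inv, norm_norm, inv_mul_le_iff₀ hτ'] at h4
  linarith

/-! ### Continuity -/

theorem continuous_coeff (y x : Rd d) (α β : R.A) : Continuous (M.coeff y x α β) := by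
  rcases lt_trichotomy β α with h | rfl | h
  · refine AddMonoidHomClass.continuous_of_bound (M.coeff y x α β)
      (M.realNormΓ (α + 1) * snorm s (y - x) ^ ((α : ℝ) - β)) fun τ => ?_
    have := M.norm_coeff_le h (lt_add_one (α : ℝ)) y x τ
    linarith
  · have : (M.coeff y x β β : R.T β → R.T β) = id := funext fun τ => M.coeff_self y x β τ
    rw [this]
    exact continuous_id
  · have : (M.coeff y x α β : R.T α → R.T β) = fun _ => 0 := funext fun τ => M.coeff_of_lt y x h τ
    rw [this]
    exact continuous_const

theorem tendsto_Γ_fixed {ι : Type*} {l : Filter ι} {γ : ℝ} {Φ : ι → R.Space} {Φ₀ : R.Space}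
    (hb : ∀ i, ∀ α : R.A, γ ≤ (α : ℝ) → Φ i α = 0) (hb₀ : ∀ α : R.A, γ ≤ (α : ℝ) → Φ₀ α = 0)
    (h : ∀ α, Tendsto (fun i => Φ i α) l (𝓝 (Φ₀ α))) (y x : Rd d) (β : R.A) :
    Tendsto (fun i => (M.Γ y x (Φ i)) β) l (𝓝 ((M.Γ y x Φ₀) β)) := by
  simp only [M.Γ_apply_eq_sum_below (hb _), M.Γ_apply_eq_sum_below hb₀]
  exact tendsto_finsetSum _ fun α _ => ((M.continuous_coeff y x α β).tendsto _).comp (h α)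

theorem tendsto_Γ_near {ι : Type*} {l : Filter ι} {γ : ℝ} {Φ : ι → R.Space} {Φ₀ : R.Space}
    (hb : ∀ i, ∀ α : R.A, γ ≤ (α : ℝ) → Φ i α = 0) (hb₀ : ∀ α : R.A, γ ≤ (α : ℝ) → Φ₀ α = 0)
    (h : ∀ α, Tendsto (fun i => Φ i α) l (𝓝 (Φ₀ α))) {a b : ι → Rd d}
    (hab : Tendsto (fun i => a i - b i) l (𝓝 0)) (β : R.A) :
    Tendsto (fun i => (M.Γ (a i) (b i) (Φ i)) β) l (𝓝 (Φ₀ β)) := by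
  rcases lt_or_ge (β : ℝ) γ with hβ | hβ
  · simp only [M.Γ_apply_eq_add_sum (hb _) _ _ hβ]
    have hsum : Tendsto (fun i => ∑ α ∈ R.between β γ, M.coeff (a i) (b i) α β (Φ i α)) l
        (𝓝 (∑ α ∈ R.between β γ, 0)) := by
      refine tendsto_finsetSum _ fun α hα => ?_
      obtain ⟨hα, hβα⟩ := RegularityStructure.mem_between.1 hα
      have hs : Tendsto (fun i => snorm s (a i - b i)) l (𝓝 0) := by
        have := ((continuous_snorm s).tendsto 0).comp hab
        rwa [snorm_zero] at this
      have hpos : (0 : ℝ) < (α : ℝ) - β := sub_pos.2 hβα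
      have h1 : Tendsto (fun i => M.realNormΓ γ * ‖Φ i α‖ * snorm s (a i - b i) ^ ((α : ℝ) - β)) l
          (𝓝 0) := by
        have h2 := ((h α).norm.const_mul (M.realNormΓ γ)).mul
          (hs.rpow_const (p := (α : ℝ) - β) (Or.inr hpos.le))
        rwa [Real.zero_rpow hpos.ne', mul_zero] at h2
      exact squeeze_zero_norm (fun i => M.norm_coeff_le hβα hα _ _ _) h1
    simpa using (h β).add hsum
  · simp only [M.Γ_apply_eq_zero (hb _) _ _ hβ, hb₀ β hβ]
    exact tendsto_const_nhds

/-- With a₀, b₀ the values at y₀, factor Γ_{ab} = Γ_{a a₀} Γ_{a₀ b₀} Γ_{b₀ b}. The outer factors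
tend to the identity by the bounds on Γ, and the middle one is a fixed map with continuous
coefficients. -/
theorem continuous_Γ_apply {Y : Type*} [TopologicalSpace Y] {γ : ℝ} {Φ : Y → R.Space}
    (hb : ∀ y, ∀ α : R.A, γ ≤ (α : ℝ) → Φ y α = 0) (h : ∀ α, Continuous fun y => Φ y α)
    {a b : Y → Rd d} (ha : Continuous a) (hb' : Continuous b) (β : R.A) :
    Continuous fun y => (M.Γ (a y) (b y) (Φ y)) β := by
  refine continuous_iff_continuousAt.2 fun y₀ => ?_
  have ta : Tendsto (fun y => a y - a y₀) (𝓝 y₀) (𝓝 0) := by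
    simpa using (ha.tendsto y₀).sub_const (a y₀)
  have tb : Tendsto (fun y => b y₀ - b y) (𝓝 y₀) (𝓝 0) := by
    simpa using (hb'.tendsto y₀).const_sub (b y₀)
  have h1 := fun α => M.tendsto_Γ_near hb (hb y₀) (fun α => (h α).tendsto y₀) tb α
  have b1 : ∀ y, ∀ α : R.A, γ ≤ (α : ℝ) → (M.Γ (b y₀) (b y) (Φ y)) α = 0 :=
    fun y α hα => M.Γ_apply_eq_zero (hb y) _ _ hα
  have h2 := fun α => M.tendsto_Γ_fixed b1 (hb y₀) h1 (a y₀) (b y₀) α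
  have b2 : ∀ y, ∀ α : R.A, γ ≤ (α : ℝ) → (M.Γ (a y₀) (b y₀) (M.Γ (b y₀) (b y) (Φ y))) α = 0 :=
    fun y α hα => M.Γ_apply_eq_zero (b1 y) _ _ hα
  have b3 : ∀ α : R.A, γ ≤ (α : ℝ) → (M.Γ (a y₀) (b y₀) (Φ y₀)) α = 0 :=
    fun α hα => M.Γ_apply_eq_zero (hb y₀) _ _ hα
  have h3 := M.tendsto_Γ_near b2 b3 h2 ta β
  simp only [M.Γ_comp] at h3
  exact h3

end Model

/-- `F` takes values below `γ`, and its components are continuous and bounded by `N`. -/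
structure RegularityStructure.IsCb (R : RegularityStructure.{u}) {d : ℕ} (γ N : ℝ)
    (F : Rd d → R.Space) : Prop where
  below : ValuesBelow γ F
  cont : ∀ α : R.A, Continuous fun x => F x α
  bound : ∀ (α : R.A) (x : Rd d), ‖F x α‖ ≤ N

namespace RegularityStructure.IsCb

variable {R : RegularityStructure.{u}} {d : ℕ} {γ N : ℝ} {F : Rd d → R.Space}

theorem nonneg (h : R.IsCb γ N F) : 0 ≤ N := (norm_nonneg _).trans (h.bound ⟨0, R.zero_mem⟩ 0)

theorem polyGrowth (h : R.IsCb γ N F) (s : Fin d → ℕ+) (α : R.A) : PolyGrowth s fun x => F x α :=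
  PolyGrowth.of_bounded (h.cont α).aestronglyMeasurable (h.bound α)

end RegularityStructure.IsCb

/-! ### Scale-by-scale estimates for the paraproduct. -/

namespace DyadicCutoff

variable {d : ℕ} {s : Fin d → ℕ+} (φ : DyadicCutoff s)
variable {X : Type*} [NormedAddCommGroup X] [NormedSpace ℂ X]

/-- The constant in the basic estimate for paraproduct kernels. -/
noncomputable def paraConst (a b : ℝ) : ℝ :=
  weightedL1 s (φ.low (-1)) (a + b) * weightedL1 s (φ.psi 0) a

theorem paraConst_nonneg (a b : ℝ) : 0 ≤ φ.paraConst a b :=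
  mul_nonneg (weightedL1_nonneg s _ _) (weightedL1_nonneg s _ _)

theorem norm_smear₂_psi_le {ι : Type*} (S : Finset ι) {i : ℤ} (hi : 0 < i)
    {H : Rd d × Rd d → X} {K : ℝ} {a b : ι → ℝ} (ha : ∀ i ∈ S, 0 ≤ a i) (hb : ∀ i ∈ S, 0 ≤ b i)
    (x y : Rd d)
    (hH : ∀ u v, ‖H (u, v)‖ ≤ K * ∑ i ∈ S, snorm s (v - u) ^ a i * snorm s (u - x) ^ b i)
    (hK : 0 ≤ K) :
    ‖smear₂ (φ.psiLT (i - 1)) (φ.psi i) H y‖ ≤ K * ∑ j ∈ S, φ.paraConst (a j) (b j) *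
      (((2 : ℝ) ^ (-i)) ^ a j * ((2 : ℝ) ^ (-i) + snorm s (y - x)) ^ b j) := by
  rw [φ.psiLT_eq_rescale i (show 0 ≤ i - 1 by omega), φ.psi_eq_rescale hi.le,
    show i - 1 - i = -1 by ring]
  exact norm_smear₂_rescale_le s S i _ _ ha hb x y hH hK

/-- The cancellation ∫ Ψ^i = 0 in the variable v. -/
theorem smear₂_psi_sub_fst {i : ℤ} (hi : 0 < i) {H : Rd d × Rd d → X} {E : Rd d → X}
    (hH : PolyGrowth₂ s H) (hE : PolyGrowth s E) (y : Rd d) :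
    smear₂ (φ.psiLT (i - 1)) (φ.psi i) (fun z => H z - E z.1) y
      = smear₂ (φ.psiLT (i - 1)) (φ.psi i) H y := by
  rw [hH.smear₂_sub (PolyGrowth₂.fst hE), smear₂_fst, φ.integral_psi hi.le, zero_smul, sub_zero]

/-- The normalisation ∫ Ψ^{<i-1} = 1 in the variable u, valid because i - 1 ≥ 0. -/
theorem smear₂_snd_sub_psi {i : ℤ} (hi : 0 < i) {H : Rd d × Rd d → X} {E : Rd d → X}
    (hH : PolyGrowth₂ s H) (hE : PolyGrowth s E) (y : Rd d) :
    smear₂ (φ.psiLT (i - 1)) (φ.psi i) (fun z => E z.2 - H z) y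
      = smear (φ.psi i) E y - smear₂ (φ.psiLT (i - 1)) (φ.psi i) H y := by
  rw [(PolyGrowth₂.snd hE).smear₂_sub hH, smear₂_snd, φ.integral_psiLT (by omega), one_smul]

end DyadicCutoff

namespace Model

variable {R : RegularityStructure.{u}} {d : ℕ} {s : Fin d → ℕ+} (M : Model R s)
variable {γ N : ℝ}

theorem norm_Γ_apply_le {Φ : R.Space} (h : ∀ α : R.A, γ ≤ (α : ℝ) → Φ α = 0) (hN : 0 ≤ N)
    (hΦ : ∀ β, ‖Φ β‖ ≤ N) {α : R.A} (hα : (α : ℝ) < γ) (v u : Rd d) :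
    ‖(M.Γ v u Φ) α‖ ≤ N * (1 + M.realNormΓ γ * (R.between α γ).card) *
      (1 + snorm s (v - u)) ^ (γ - α) := by
  have hG := M.realNormΓ_nonneg γ
  set r := (1 + snorm s (v - u)) ^ (γ - α)
  have hr : 1 ≤ r := one_le_one_add_snorm_rpow s _ (by linarith)
  rw [M.Γ_apply_eq_add_sum h v u hα]
  refine (norm_add_le _ _).trans ?_
  have h1 : ‖∑ β ∈ R.between α γ, M.coeff v u β α (Φ β)‖
      ≤ ∑ β ∈ R.between α γ, M.realNormΓ γ * N * r := by
    refine norm_sum_le_of_le _ fun β hβ => ?_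
    obtain ⟨hβγ, hαβ⟩ := RegularityStructure.mem_between.1 hβ
    have hαβ' : (α : ℝ) < β := hαβ
    refine (M.norm_coeff_le hαβ hβγ v u (Φ β)).trans ?_
    have h2 : snorm s (v - u) ^ ((β : ℝ) - α) ≤ r :=
      (Real.rpow_le_rpow (snorm_nonneg s _) (by linarith) (by linarith)).trans
        (one_add_snorm_rpow_mono s _ (by linarith))
    have h3 := hΦ β
    have h4 := Real.rpow_nonneg (snorm_nonneg s (v - u)) ((β : ℝ) - α)
    gcongr
  rw [Finset.sum_const, nsmul_eq_mul] at h1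
  calc _ ≤ N * r + (R.between α γ).card * (M.realNormΓ γ * N * r) := by
        gcongr
        exact (hΦ α).trans (le_mul_of_one_le_right hN hr)
    _ = _ := by ring

/-- The function `(u, v) ↦ Γ^α_{vu} F_u`. -/
noncomputable def kernel (F : Rd d → R.Space) (α : R.A) (z : Rd d × Rd d) : R.T α :=
  (M.Γ z.2 z.1 (F z.1)) α

variable {F : Rd d → R.Space}

theorem polyGrowth₂_kernel (hF : R.IsCb γ N F) {α : R.A} (hα : (α : ℝ) < γ) :
    PolyGrowth₂ s (M.kernel F α) := by
  have hc : Continuous (M.kernel F α) :=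
    M.continuous_Γ_apply (Φ := fun z : Rd d × Rd d => F z.1) (fun z => hF.below z.1)
      (fun α => (hF.cont α).comp continuous_fst) continuous_snd continuous_fst α
  have hG := M.realNormΓ_nonneg γ
  have hN := hF.nonneg
  refine PolyGrowth₂.of_bound hc.aestronglyMeasurable
    (K := N * (1 + M.realNormΓ γ * (R.between α γ).card)) (a := γ - α)
    (by positivity) (by linarith) fun u v => ?_
  exact M.norm_Γ_apply_le (hF.below u) hN (fun β => hF.bound β u) hα v u

/-- The function `v ↦ Γ^α_{vx} τ`. -/
noncomputable def orbit (x : Rd d) (Φ : R.Space) (α : R.A) (v : Rd d) : R.T α := (M.Γ v x Φ) α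

theorem continuous_orbit {Φ : R.Space} (h : ∀ α : R.A, γ ≤ (α : ℝ) → Φ α = 0) (x : Rd d)
    (α : R.A) : Continuous (M.orbit x Φ α) :=
  M.continuous_Γ_apply (fun _ => h) (fun _ => continuous_const) continuous_id continuous_const α

theorem polyGrowth_orbit (hF : R.IsCb γ N F) {α : R.A} (hα : (α : ℝ) < γ) (x : Rd d) :
    PolyGrowth s (M.orbit x (F x) α) := by
  have hG := M.realNormΓ_nonneg γ
  have hN := hF.nonneg
  refine PolyGrowth.of_bound (M.continuous_orbit (hF.below x) x α).aestronglyMeasurable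
    (K := N * (1 + M.realNormΓ γ * (R.between α γ).card)) (a := γ - α)
    (by positivity) (by linarith) x fun v => ?_
  exact M.norm_Γ_apply_le (hF.below x) hN (fun β => hF.bound β x) hα v x

variable (φ : DyadicCutoff s)

/-- The `i`-th term of the paraproduct. -/
noncomputable def paraTerm (F : Rd d → R.Space) (α : R.A) (i : ℤ) : Rd d → R.T α :=
  smear₂ (φ.psiLT (i - 1)) (φ.psi i) (M.kernel F α)

theorem polyGrowth_paraTerm (hF : R.IsCb γ N F) {α : R.A} (hα : (α : ℝ) < γ) (i : ℤ) :
    PolyGrowth s (M.paraTerm φ F α i) :=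
  (M.polyGrowth₂_kernel hF hα).smear₂ _ _

/-- Subtracting F^α_u removes the diagonal part of Γ^α_{vu} F_u, and each remaining coefficient
carries a positive power of ‖v-u‖. Hence the paraproduct series converges uniformly for every
bounded continuous F, without further regularity. -/
theorem norm_paraTerm_le (hF : R.IsCb γ N F) {α : R.A} (hα : (α : ℝ) < γ) {i : ℤ} (hi : 0 < i)
    (y : Rd d) :
    ‖M.paraTerm φ F α i y‖ ≤ M.realNormΓ γ * N *
      ∑ β ∈ R.between α γ, φ.paraConst (β - α) 0 * ((2 : ℝ) ^ (-i)) ^ ((β : ℝ) - α) := by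
  have hG := M.realNormΓ_nonneg γ
  have hN := hF.nonneg
  unfold paraTerm
  rw [← φ.smear₂_psi_sub_fst hi (M.polyGrowth₂_kernel hF hα) (hF.polyGrowth s α)]
  refine (φ.norm_smear₂_psi_le (R.between α γ) hi (K := M.realNormΓ γ * N)
    (a := fun β => (β : ℝ) - α) (b := fun _ => 0) ?_ (fun _ _ => le_rfl) y y ?_
    (by positivity)).trans (le_of_eq ?_)
  · intro β hβ
    exact sub_nonneg.2 (le_of_lt (RegularityStructure.mem_between.1 hβ).2)
  · intro u v
    simp only [kernel, Real.rpow_zero, mul_one]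
    rw [M.Γ_apply_eq_add_sum (hF.below u) v u hα, add_sub_cancel_left, Finset.mul_sum]
    refine norm_sum_le_of_le _ fun β hβ => ?_
    obtain ⟨hβγ, hαβ⟩ := RegularityStructure.mem_between.1 hβ
    refine (M.norm_coeff_le hαβ hβγ v u _).trans ?_
    have h3 := hF.bound β u
    have h4 := Real.rpow_nonneg (snorm_nonneg s (v - u)) ((β : ℝ) - α)
    gcongr
  · simp

theorem norm_smear_psi_sub_paraTerm_le (hF : R.IsCb γ N F) {α : R.A} (hα : (α : ℝ) < γ) {L : ℝ}
    (hL : 0 ≤ L) (hD : ∀ u v, ‖F v α - (M.Γ v u (F u)) α‖ ≤ L * snorm s (v - u) ^ (γ - α))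
    {i : ℤ} (hi : 0 < i) (y : Rd d) :
    ‖smear (φ.psi i) (fun v => F v α) y - M.paraTerm φ F α i y‖
      ≤ L * φ.paraConst (γ - α) 0 * ((2 : ℝ) ^ (-i)) ^ (γ - α) := by
  rw [paraTerm, ← φ.smear₂_snd_sub_psi hi (M.polyGrowth₂_kernel hF hα) (hF.polyGrowth s α)]
  refine (φ.norm_smear₂_psi_le {()} hi (K := L) (a := fun _ => γ - α) (b := fun _ => 0)
    (fun _ _ => by linarith) (fun _ _ => le_rfl) y y ?_ hL).trans (le_of_eq ?_)
  · intro u v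
    simpa [kernel] using hD u v
  · simp; ring

/-- The estimate behind the induction: only the components of F_u - Γ_{ux} F_x strictly above α
enter, because the α-component is a function of u alone and is annihilated by Ψ^i. -/
theorem norm_smear_psi_orbit_sub_paraTerm_le (hF : R.IsCb γ N F) {α : R.A} (hα : (α : ℝ) < γ)
    {L : ℝ} (hL : 0 ≤ L) {x : Rd d}
    (hD : ∀ β ∈ R.between α γ, ∀ u, ‖F u β - (M.Γ u x (F x)) β‖ ≤ L * snorm s (u - x) ^ (γ - β))
    {i : ℤ} (hi : 0 < i) (y : Rd d) :
    ‖smear (φ.psi i) (M.orbit x (F x) α) y - M.paraTerm φ F α i y‖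
      ≤ M.realNormΓ γ * L * ∑ β ∈ R.between α γ, φ.paraConst (β - α) (γ - β) *
        (((2 : ℝ) ^ (-i)) ^ ((β : ℝ) - α) * ((2 : ℝ) ^ (-i) + snorm s (y - x)) ^ (γ - β)) := by
  have hG := M.realNormΓ_nonneg γ
  have pF := hF.polyGrowth s α
  have pO := M.polyGrowth_orbit hF hα x
  have pK := M.polyGrowth₂_kernel hF hα
  rw [paraTerm, ← φ.smear₂_snd_sub_psi hi pK pO,
    ← φ.smear₂_psi_sub_fst hi ((PolyGrowth₂.snd pO).sub pK) (pO.sub pF)]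
  refine φ.norm_smear₂_psi_le (R.between α γ) hi (K := M.realNormΓ γ * L)
    (a := fun β => (β : ℝ) - α) (b := fun β => γ - β) ?_ ?_ x y ?_ (by positivity)
  · intro β hβ
    exact sub_nonneg.2 (le_of_lt (RegularityStructure.mem_between.1 hβ).2)
  · intro β hβ
    exact sub_nonneg.2 (le_of_lt (RegularityStructure.mem_between.1 hβ).1)
  · intro u v
    have hΦ : ∀ α : R.A, γ ≤ (α : ℝ) → (F u - M.Γ u x (F x)) α = 0 := fun β hβ => by
      rw [DirectSum.sub_apply, hF.below u β hβ, M.Γ_apply_eq_zero (hF.below x) _ _ hβ, sub_zero]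
    have h1 := M.Γ_apply_eq_add_sum hΦ v u hα
    rw [map_sub, M.Γ_comp, DirectSum.sub_apply, DirectSum.sub_apply] at h1
    -- By Γ_{vx} = Γ_{vu} Γ_{ux}, the difference of the first two terms is -Γ^α_{vu} applied to F_u
    -- - Γ_{ux} F_x; the last bracket cancels its diagonal part.
    have h2 : M.orbit x (F x) α v - M.kernel F α (u, v) - (M.orbit x (F x) α u - F u α)
        = -∑ β ∈ R.between α γ, M.coeff v u β α ((F u - M.Γ u x (F x)) β) := by
      rw [← sub_eq_zero, sub_neg_eq_add]
      have h3 := sub_eq_zero.2 h1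
      simp only [orbit, kernel]
      rw [← neg_eq_zero, ← h3]
      abel
    simp only
    rw [h2, norm_neg, Finset.mul_sum]
    refine norm_sum_le_of_le _ fun β hβ => ?_
    obtain ⟨hβγ, hαβ⟩ := RegularityStructure.mem_between.1 hβ
    refine (M.norm_coeff_le hαβ hβγ v u _).trans ?_
    have h3 := hD β hβ u
    have h4 := Real.rpow_nonneg (snorm_nonneg s (v - u)) ((β : ℝ) - α)
    rw [DirectSum.sub_apply]
    calc _ ≤ M.realNormΓ γ * (L * snorm s (u - x) ^ (γ - β)) *
          snorm s (v - u) ^ ((β : ℝ) - α) := by gcongr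
      _ = _ := by ring

end Model

/-! ### The paraproduct as a distribution and its localisation in frequency. -/

section Represents

variable {d : ℕ} {X : Type*} [NormedAddCommGroup X] [NormedSpace ℂ X]

theorem exists_represents [CompleteSpace X] {f : Rd d → X} (hm : AEStronglyMeasurable f) {C : ℝ}
    (hC : ∀ x, ‖f x‖ ≤ C) : ∃ u : 𝓢'(Rd d, X), Represents f u := by
  have hf : MemLp f ∞ := memLp_top_of_bound hm C (Eventually.of_forall hC)
  refine ⟨Lp.toTemperedDistribution hf.toLp, fun η => ⟨?_, ?_⟩⟩
  · exact η.integrable.smul_bdd C hm (Eventually.of_forall hC)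
  · rw [Lp.toTemperedDistribution_apply]
    refine integral_congr_ae ?_
    filter_upwards [hf.coeFn_toLp] with x hx
    rw [hx]

theorem Represents.unique {f : Rd d → X} {u v : 𝓢'(Rd d, X)} (hu : Represents f u)
    (hv : Represents f v) : u = v := by
  ext η
  rw [(hu η).2, (hv η).2]

theorem Represents.block_eq {s : Fin d → ℕ+} (φ : DyadicCutoff s) {f : Rd d → X} {u : 𝓢'(Rd d, X)}
    (hu : Represents f u) (l : ℤ) (w : Rd d) : φ.block l u w = smear (φ.psi l) f w := by
  rw [DyadicCutoff.block, (hu _).2, smear]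
  refine integral_congr_ae (Eventually.of_forall fun y => ?_)
  simp

end Represents

theorem two_zpow_neg_rpow (i : ℤ) (κ : ℝ) : ((2 : ℝ) ^ (-i)) ^ κ = ((2 : ℝ) ^ (-κ)) ^ i := by
  rw [← Real.rpow_intCast, ← Real.rpow_intCast, ← Real.rpow_mul zero_le_two,
    ← Real.rpow_mul zero_le_two]
  congr 1
  push_cast
  ring

namespace Model

variable {R : RegularityStructure.{u}} {d : ℕ} {s : Fin d → ℕ+} (M : Model R s)
variable {γ N : ℝ} {F : Rd d → R.Space} (φ : DyadicCutoff s)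

theorem exists_summable_paraTerm_bound (hF : R.IsCb γ N F) {α : R.A} (hα : (α : ℝ) < γ) :
    ∃ c : ℕ → ℝ, Summable c ∧ ∀ (n : ℕ) y, ‖M.paraTerm φ F α (n + 1) y‖ ≤ c n := by
  refine ⟨fun n => M.realNormΓ γ * N * ∑ β ∈ R.between α γ,
    φ.paraConst (β - α) 0 * ((2 : ℝ) ^ (-((n : ℤ) + 1))) ^ ((β : ℝ) - α), ?_,
    fun n y => M.norm_paraTerm_le φ hF hα (by omega) y⟩
  refine Summable.mul_left _ (summable_sum fun β hβ => Summable.mul_left _ ?_)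
  obtain ⟨_, hαβ⟩ := RegularityStructure.mem_between.1 hβ
  have hαβ' : (α : ℝ) < β := hαβ
  have hq : (2 : ℝ) ^ (-((β : ℝ) - α)) < 1 :=
    Real.rpow_lt_one_of_one_lt_of_neg one_lt_two (by linarith)
  have h0 : (0 : ℝ) ≤ (2 : ℝ) ^ (-((β : ℝ) - α)) := by positivity
  have := (summable_nat_add_iff 1).2 (summable_geometric_of_lt_one h0 hq)
  refine this.congr fun n => ?_
  rw [two_zpow_neg_rpow]
  exact_mod_cast rfl

/-- The terms are dominated in supremum norm by a summable sequence, so the pointwise sum is a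
bounded function, and dominated summation against a test function gives convergence in 𝓢'. -/
theorem exists_isParaproduct (hF : R.IsCb γ N F) {α : R.A} (hα : (α : ℝ) < γ) :
    ∃ P, M.IsParaproduct φ F α P := by
  obtain ⟨c, hc, hb⟩ := M.exists_summable_paraTerm_bound φ hF hα
  have hm : ∀ n : ℕ, AEStronglyMeasurable (M.paraTerm φ F α (n + 1)) :=
    fun n => (M.polyGrowth_paraTerm φ hF hα _).1
  have hsum : ∀ y, Summable fun n : ℕ => M.paraTerm φ F α (n + 1) y :=
    fun y => Summable.of_norm_bounded hc fun n => hb n y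
  have hm' : AEStronglyMeasurable fun y => ∑' n : ℕ, M.paraTerm φ F α (n + 1) y := by
    refine aestronglyMeasurable_of_tendsto_ae atTop
      (f := fun (m : ℕ) y => ∑ n ∈ Finset.range m, M.paraTerm φ F α (n + 1) y) (fun m => ?_)
      (Eventually.of_forall fun y => (hsum y).hasSum.tendsto_sum_nat)
    exact Finset.aestronglyMeasurable_fun_sum _ fun n _ => hm n
  obtain ⟨P, hP⟩ := exists_represents hm' (C := ∑' n, c n)
    fun y => tsum_of_norm_bounded hc.hasSum fun n => hb n y
  choose p hp using fun n => exists_represents (hm n) (hb n)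
  refine ⟨P, fun j _ x => (M.polyGrowth₂_kernel hF hα).integrable _ _ x, p, hp, ?_⟩
  rw [HasSum, PointwiseConvergenceCLM.tendsto_iff_forall_tendsto]
  intro η
  have h1 := hasSum_integral_of_summable_integral_norm
    (F := fun (n : ℕ) x => η x • M.paraTerm φ F α (n + 1) x) (fun n => (hp n η).1) (by
      refine Summable.of_nonneg_of_le (fun n => integral_nonneg fun x => norm_nonneg _)
        (fun n => ?_) (hc.mul_right (∫ x, ‖η x‖))
      rw [← integral_const_mul]
      refine integral_mono (hp n η).1.norm (η.integrable.norm.const_mul _) fun x => ?_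
      simp only [norm_smul]
      rw [mul_comm]
      exact mul_le_mul_of_nonneg_right (hb n x) (norm_nonneg _))
  have h2 : ∫ x, ∑' n : ℕ, η x • M.paraTerm φ F α (n + 1) x = P η := by
    rw [(hP η).2]
    refine integral_congr_ae (Eventually.of_forall fun x => ?_)
    exact (hsum x).tsum_const_smul _
  rw [h2] at h1
  have h3 : (fun n : ℕ => ∫ x, η x • M.paraTerm φ F α (n + 1) x) = fun n => p n η :=
    funext fun n => ((hp n η).2).symm
  rw [h3] at h1
  refine h1.congr fun S => ?_
  simp

variable {M φ}

theorem IsParaproduct.unique {α : R.A} {P Q : 𝓢'(Rd d, R.T α)} (hP : M.IsParaproduct φ F α P)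
    (hQ : M.IsParaproduct φ F α Q) : P = Q := by
  obtain ⟨_, p, hp, hpP⟩ := hP
  obtain ⟨_, q, hq, hqQ⟩ := hQ
  have : p = q := funext fun n => (hp n).unique (hq n)
  subst this
  exact hpP.unique hqQ

theorem IsSharp.unique {α : R.A} {g h : 𝓢'(Rd d, R.T α)} (hg : M.IsSharp φ F α g)
    (hh : M.IsSharp φ F α h) : g = h := by
  obtain ⟨f, P, hf, hP, rfl⟩ := hg
  obtain ⟨f', P', hf', hP', rfl⟩ := hh
  rw [hf.unique hf', hP.unique hP']

theorem IsSharp.sharpNorm_eq {α : R.A} {g : 𝓢'(Rd d, R.T α)} (hg : M.IsSharp φ F α g) :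
    M.sharpNorm φ γ F α = φ.besovNorm (γ - α) g := by
  refine le_antisymm (iInf₂_le g hg) (le_iInf₂ fun h hh => ?_)
  rw [hg.unique hh]

variable (φ) in
/-- Beyond this distance, paraproduct terms and Littlewood–Paley blocks are orthogonal. -/
noncomputable def _root_.DyadicCutoff.gap : ℕ :=
  φ.exists_integral_psi_mul_psiLT_mul_psi_eq_zero.choose

theorem _root_.DyadicCutoff.three_le_gap : 3 ≤ φ.gap :=
  φ.exists_integral_psi_mul_psiLT_mul_psi_eq_zero.choose_spec.1

theorem smear_psi_paraTerm_eq_zero (hF : R.IsCb γ N F) {α : R.A} (hα : (α : ℝ) < γ) {l i : ℤ}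
    (hl : -1 ≤ l) (hi : 0 < i) (h : i + 3 ≤ l ∨ l + φ.gap ≤ i) (w : Rd d) :
    smear (φ.psi l) (M.paraTerm φ F α i) w = 0 := by
  refine (M.polyGrowth₂_kernel hF hα).smear_smear₂_eq_zero ?_ w
  rcases h with h | h
  · exact φ.integral_psi_mul_psiLT_mul_psi_eq_zero_of_le h hi
  · exact φ.exists_integral_psi_mul_psiLT_mul_psi_eq_zero.choose_spec.2 l i hl hi h

/-- The two admissible starting points serve different ranges: a = 1 keeps every term and suits low
blocks, while a ≤ l - 2 drops only terms that are orthogonal to Ψ^l. -/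
theorem IsParaproduct.block_eq (hF : R.IsCb γ N F) {α : R.A} (hα : (α : ℝ) < γ)
    {P : 𝓢'(Rd d, R.T α)} (hP : M.IsParaproduct φ F α P) {l a : ℤ} (hl : -1 ≤ l) (ha : 1 ≤ a)
    (hal : a = 1 ∨ a + 2 ≤ l) (w : Rd d) :
    φ.block l P w = ∑ i ∈ Finset.Ico a (l + φ.gap), smear (φ.psi l) (M.paraTerm φ F α i) w := by
  obtain ⟨_, p, hp, hpP⟩ := hP
  have h1 : HasSum (fun n : ℕ => smear (φ.psi l) (M.paraTerm φ F α (n + 1)) w) (φ.block l P w) := by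
    have h2 := PointwiseConvergenceCLM.tendsto_iff_forall_tendsto.1 hpP (SchwartzMap.compSubConstCLM ℂ w
      (SchwartzMap.compCLMOfContinuousLinearEquiv ℂ (ContinuousLinearEquiv.neg ℝ) (φ.psi l)))
    refine h2.congr fun S => ?_
    rw [sum_apply]
    refine Finset.sum_congr rfl fun n _ => ?_
    exact (hp n).block_eq φ l w
  -- The series is indexed by n = i - 1, since the paraproduct starts at i = 1.
  set S : Finset ℕ := (Finset.Ico a (l + φ.gap)).image fun i => (i - 1).toNat
  have h2 := hasSum_sum_of_ne_finset_zero (L := SummationFilter.unconditional ℕ)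
    (f := fun n : ℕ => smear (φ.psi l) (M.paraTerm φ F α (n + 1)) w) (s := S) (fun n hn => by
      refine smear_psi_paraTerm_eq_zero hF hα hl (by omega) ?_ w
      by_contra! hc
      refine hn (Finset.mem_image.2 ⟨n + 1, Finset.mem_Ico.2 ⟨?_, hc.2⟩, by omega⟩)
      omega)
  rw [h1.unique h2, Finset.sum_image]
  · refine Finset.sum_congr rfl fun i hi => ?_
    have := (Finset.mem_Ico.1 hi).1
    rw [show (((i - 1).toNat : ℕ) : ℤ) + 1 = i by omega]
  · intro i hi j hj hij
    have h3 := (Finset.mem_Ico.1 hi).1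
    have h4 := (Finset.mem_Ico.1 hj).1
    simp only at hij
    omega

/-- Ψ^l reproduces itself through Ψ^{<l+gap}, and blocks with i ≤ l - 3 do not interact with it. The
window is deliberately the one for the paraproduct, so that the two sums can be subtracted term by
term. -/
theorem smear_psi_eq_sum {X : Type*} [NormedAddCommGroup X] [NormedSpace ℂ X] [CompleteSpace X]
    {E : Rd d → X} (hE : PolyGrowth s E) {l : ℤ} (hl : 3 ≤ l) (w : Rd d) :
    smear (φ.psi l) E w
      = ∑ i ∈ Finset.Ico (l - 2) (l + φ.gap), smear (φ.psi l) (smear (φ.psi i) E) w := by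
  have hgap := φ.three_le_gap
  rw [← hE.smear_smear (φ.integral_psi_mul_psiLT (m := l + φ.gap) (by omega) (by omega)) w]
  have h1 : ∀ y, smear (φ.psiLT (l + φ.gap)) E y
      = ∑ i ∈ Finset.Ico (-1) (l + φ.gap), smear (φ.psi i) E y := fun y => by
    simp only [smear, DyadicCutoff.psiLT]
    rw [← integral_finsetSum _ fun i _ => hE.integrable _ y]
    refine integral_congr_ae (Eventually.of_forall fun v => ?_)
    simp only
    rw [← Finset.sum_smul]
    congr 1
    simp
  have h2 : smear (φ.psi l) (smear (φ.psiLT (l + φ.gap)) E) w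
      = ∑ i ∈ Finset.Ico (-1) (l + φ.gap), smear (φ.psi l) (smear (φ.psi i) E) w := by
    unfold smear at h1 ⊢
    simp only [h1, Finset.smul_sum]
    exact integral_finsetSum _ fun i _ => (hE.smear (φ.psi i)).integrable _ w
  rw [h2]
  refine (Finset.sum_subset (Finset.Ico_subset_Ico_left (by omega)) fun i hi hni => ?_).symm
  have hi' := Finset.mem_Ico.1 hi
  have hni' : i + 3 ≤ l := by
    by_contra hc
    exact hni (Finset.mem_Ico.2 ⟨by omega, hi'.2⟩)
  have h3 := hE.smear_smear (k := (0 : 𝓢(Rd d, ℂ)))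
    (fun w v => by simpa using φ.integral_psi_mul_psi hni' hi'.1 w v) w
  rw [h3]
  simp [smear]

theorem IsParaproduct.smear_psi_sub_block (hF : R.IsCb γ N F) {α : R.A} (hα : (α : ℝ) < γ)
    {P : 𝓢'(Rd d, R.T α)} (hP : M.IsParaproduct φ F α P) {E : Rd d → R.T α} (hE : PolyGrowth s E)
    {l : ℤ} (hl : 3 ≤ l) (w : Rd d) :
    smear (φ.psi l) E w - φ.block l P w = ∑ i ∈ Finset.Ico (l - 2) (l + φ.gap),
      smear (φ.psi l) (fun y => smear (φ.psi i) E y - M.paraTerm φ F α i y) w := by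
  rw [hP.block_eq hF hα (a := l - 2) (by omega) (by omega) (by omega), smear_psi_eq_sum hE hl,
    ← Finset.sum_sub_distrib]
  refine Finset.sum_congr rfl fun i _ => ?_
  rw [(hE.smear (φ.psi i)).smear_sub (M.polyGrowth_paraTerm φ hF hα i)]

/-- If `E` agrees with the paraproduct up to small errors on each scale, then so do their
Littlewood–Paley blocks. -/
theorem IsParaproduct.norm_smear_psi_sub_block_le (hF : R.IsCb γ N F) {α : R.A} (hα : (α : ℝ) < γ)
    {P : 𝓢'(Rd d, R.T α)} (hP : M.IsParaproduct φ F α P) {E : Rd d → R.T α} (hE : PolyGrowth s E)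
    {K ε b : ℝ} (hK : 0 ≤ K) (hε : 0 ≤ ε) (hb : 0 ≤ b) {x : Rd d}
    (h : ∀ i : ℤ, 0 < i → ∀ y, ‖smear (φ.psi i) E y - M.paraTerm φ F α i y‖
      ≤ K * (((2 : ℝ) ^ (-i)) ^ ε * ((2 : ℝ) ^ (-i) + snorm s (y - x)) ^ b))
    {l : ℤ} (hl : 3 ≤ l) (w : Rd d) :
    ‖smear (φ.psi l) E w - φ.block l P w‖
      ≤ K * ((φ.gap + 2) * (4 : ℝ) ^ (ε + b) * weightedL1 s (φ.psi 0) b) *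
        (((2 : ℝ) ^ (-l)) ^ ε * ((2 : ℝ) ^ (-l) + snorm s (w - x)) ^ b) := by
  have hgap := φ.three_le_gap
  rw [hP.smear_psi_sub_block hF hα hE hl]
  have hl0 : (0 : ℝ) < 2 ^ (-l) := by positivity
  have key : ∀ i ∈ Finset.Ico (l - 2) (l + φ.gap),
      ‖smear (φ.psi l) (fun y => smear (φ.psi i) E y - M.paraTerm φ F α i y) w‖
        ≤ K * (4 : ℝ) ^ (ε + b) * ((2 : ℝ) ^ (-l)) ^ ε * weightedL1 s (φ.psi 0) b *
          ((2 : ℝ) ^ (-l) + snorm s (w - x)) ^ b := by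
    intro i hi
    have hi' := (Finset.mem_Ico.1 hi).1
    have hi0 : (0 : ℝ) < 2 ^ (-i) := by positivity
    -- The coarsest scale in the window is i = l - 2, which accounts for the powers of 4; the window
    -- has gap + 2 elements. The assumption l ≥ 3 keeps i positive throughout.
    have h4 : (2 : ℝ) ^ (-i) ≤ 4 * 2 ^ (-l) := by
      rw [show (4 : ℝ) = 2 ^ (2 : ℤ) by norm_num, ← zpow_add₀ two_ne_zero]
      exact zpow_le_zpow_right₀ one_le_two (by omega)
    rw [φ.psi_eq_rescale (show 0 ≤ l by omega)]
    refine norm_smear_rescale_le s l _ hb x w (Eventually.of_forall fun y => ?_) (by positivity)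
    refine (h i (by omega) y).trans ?_
    have hy := snorm_nonneg s (y - x)
    rw [mul_assoc, mul_assoc]
    refine mul_le_mul_of_nonneg_left ?_ hK
    calc ((2 : ℝ) ^ (-i)) ^ ε * ((2 : ℝ) ^ (-i) + snorm s (y - x)) ^ b
        ≤ (4 * (2 : ℝ) ^ (-l)) ^ ε * (4 * ((2 : ℝ) ^ (-l) + snorm s (y - x))) ^ b := by
          gcongr
          linarith
      _ = _ := by
          rw [Real.mul_rpow (by norm_num) hl0.le, Real.mul_rpow (by norm_num) (by positivity),
            Real.rpow_add (by norm_num)]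
          ring
  refine (norm_sum_le_of_le _ key).trans (le_of_eq ?_)
  rw [Finset.sum_const, nsmul_eq_mul, Int.card_Ico]
  have : (((l + φ.gap - (l - 2)).toNat : ℕ) : ℝ) = φ.gap + 2 := by
    rw [show l + (φ.gap : ℤ) - (l - 2) = ((φ.gap + 2 : ℕ) : ℤ) by push_cast; ring, Int.toNat_natCast]
    push_cast
    rfl
  rw [this]
  ring

end Model

/-! ### Anisotropic Taylor estimates and geometric sums. -/

namespace Scaling

variable {d : ℕ} {s : Fin d → ℕ+} {X : Type*} [NormedAddCommGroup X] [NormedSpace ℂ X]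

theorem smear_rescale (m : ℤ) (ψ : 𝓢(Rd d, ℂ)) (E : Rd d → X) (y : Rd d) :
    smear (rescale s m ψ) E y = ∫ v, ψ v • E (y - dyadic s (-m) v) := by
  have h := integral_comp_dyadic s m fun v => ψ v • E (y - dyadic s (-m) v)
  simp only [dyadic_dyadic, neg_add_cancel, dyadic_zero] at h
  rw [smear, ← integral_sub_left_eq_self _ _ y]
  simp only [sub_sub_cancel, rescale_apply, mul_smul]
  rw [integral_smul, h, ← Complex.coe_smul, smul_smul]
  have := (dyadicDet_pos s m).ne'
  push_cast
  rw [mul_inv_cancel₀ (by exact_mod_cast this), one_smul]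

theorem tendsto_dyadic_neg (v : Rd d) :
    Tendsto (fun n : ℕ => dyadic s (-(n : ℤ)) v) atTop (𝓝 0) := by
  have h : Tendsto (fun n : ℕ => fun i : Fin d => ((2 : ℝ) ^ (-(n : ℤ))) ^ (s i : ℕ) * v i) atTop
      (𝓝 fun _ => 0) := by
    refine tendsto_pi_nhds.2 fun i => ?_
    have h1 : Tendsto (fun n : ℕ => (2 : ℝ) ^ (-(n : ℤ))) atTop (𝓝 0) := by
      have := tendsto_pow_atTop_nhds_zero_of_lt_one (show (0 : ℝ) ≤ 2⁻¹ by norm_num)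
        (by norm_num)
      refine this.congr fun n => ?_
      rw [zpow_neg, zpow_natCast, inv_pow]
    have h2 := (h1.pow (s i : ℕ)).mul_const (v i)
    rwa [zero_pow (s i).ne_zero, zero_mul] at h2
  have h2 := ((PiLp.continuous_toLp 2 (fun _ : Fin d => ℝ)).tendsto _).comp h
  exact h2

theorem snorm_smul_le {t : ℝ} (ht : |t| ≤ 1) (z : Rd d) : snorm s (t • z) ≤ snorm s z := by
  refine Finset.sum_le_sum fun i _ => ?_
  refine Real.rpow_le_rpow (abs_nonneg _) ?_ (one_div_scaling_pos s i).le
  rw [PiLp.smul_apply, smul_eq_mul, abs_mul]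
  exact mul_le_of_le_one_left (abs_nonneg _) ht

/-- The fundamental theorem of calculus is applied to the kernel rather than to E, then integrated
against E by Fubini. -/
theorem PolyGrowth.smear_add_sub_eq_integral [CompleteSpace X] {E : Rd d → X} (hE : PolyGrowth s E)
    (ψ : 𝓢(Rd d, ℂ)) (x z : Rd d) :
    Scaling.smear ψ E (x + z) - Scaling.smear ψ E x
      = ∫ t in Set.Ioc (0 : ℝ) 1, Scaling.smear (∂_{z} ψ) E (x + t • z) := by
  set χ : 𝓢(Rd d, ℂ) := ∂_{z} ψ
  have hline : ∀ v, ψ (x + z - v) - ψ (x - v) = ∫ t in Set.Ioc (0 : ℝ) 1, χ (x + t • z - v) := by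
    intro v
    have hd : ∀ t ∈ Set.uIcc (0 : ℝ) 1,
        HasDerivAt (fun t : ℝ => ψ (x + t • z - v)) (χ (x + t • z - v)) t := by
      intro t _
      have h1 : HasDerivAt (fun t : ℝ => x + t • z - v) z t := by
        simpa using (((hasDerivAt_id t).smul_const z).const_add x).sub_const v
      have h2 := (ψ.hasFDerivAt (x + t • z - v)).comp_hasDerivAt t h1
      rwa [← SchwartzMap.lineDerivOp_apply_eq_fderiv] at h2
    have hc : Continuous fun t : ℝ => χ (x + t • z - v) := χ.continuous.comp (by fun_prop)
    have h3 := intervalIntegral.integral_eq_sub_of_hasDerivAt hd (hc.intervalIntegrable 0 1)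
    rw [intervalIntegral.integral_of_le zero_le_one] at h3
    simpa using h3.symm
  obtain ⟨hm, K, a, hK, ha, hb⟩ := id hE
  have hb' : ∀ v, ‖E v‖ ≤ K * (1 + snorm s (v - 0)) ^ a := by simpa using hb
  have hmeas : AEStronglyMeasurable (fun p : ℝ × Rd d => χ (x + p.1 • z - p.2) • E p.2)
      ((volume.restrict (Set.Ioc (0 : ℝ) 1)).prod (volume : Measure (Rd d))) := by
    refine AEStronglyMeasurable.smul (Continuous.aestronglyMeasurable ?_) hm.comp_snd
    exact χ.continuous.comp (by fun_prop)
  have hint : Integrable (Function.uncurry fun (t : ℝ) v => χ (x + t • z - v) • E v)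
      ((volume.restrict (Set.Ioc (0 : ℝ) 1)).prod (volume : Measure (Rd d))) := by
    refine (integrable_prod_iff hmeas).2
      ⟨Eventually.of_forall fun t => hE.integrable χ (x + t • z), ?_⟩
    refine Integrable.mono' (g := fun _ => K * ((1 + snorm s x) ^ a * (1 + snorm s z) ^ a) *
      weightedL1 s χ a) (integrable_const _) hmeas.norm.integral_prod_right' ?_
    refine ae_restrict_of_forall_mem measurableSet_Ioc fun t ht => ?_
    rw [Real.norm_of_nonneg (integral_nonneg fun v => norm_nonneg _)]
    have h1 := (integrable_norm_mul_weight s χ a).comp_sub_left (x + t • z)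
    have h2 := integral_mono (hE.integrable χ (x + t • z)).norm
      (h1.const_mul (K * (1 + snorm s (x + t • z - 0)) ^ a))
      (norm_smul_le_weight s ha hK hb' χ (x + t • z))
    rw [integral_const_mul, integral_sub_left_eq_self
      (fun v => ‖χ v‖ * (1 + snorm s v) ^ a)] at h2
    refine h2.trans (mul_le_mul_of_nonneg_right (mul_le_mul_of_nonneg_left ?_ hK)
      (weightedL1_nonneg s χ a))
    have h3 := one_add_snorm_sub_rpow_le s ha x (-(t • z))
    rw [sub_neg_eq_add, snorm_neg] at h3
    rw [sub_zero]
    refine h3.trans (mul_le_mul_of_nonneg_left ?_ (one_add_snorm_rpow_nonneg s x a))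
    refine Real.rpow_le_rpow (one_add_snorm_pos s _).le ?_ ha
    have := snorm_smul_le (s := s) (abs_le.2 ⟨by linarith [ht.1], ht.2⟩) z
    linarith
  calc Scaling.smear ψ E (x + z) - Scaling.smear ψ E x
      = ∫ v, (ψ (x + z - v) - ψ (x - v)) • E v := by
        simp only [sub_smul]
        exact (integral_sub (hE.integrable ψ (x + z)) (hE.integrable ψ x)).symm
    _ = ∫ v, ∫ t in Set.Ioc (0 : ℝ) 1, χ (x + t • z - v) • E v := by
        refine integral_congr_ae (Eventually.of_forall fun v => ?_)
        simp only
        rw [hline, integral_smul_const]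
    _ = _ := (integral_integral_swap hint).symm

theorem PolyGrowth.norm_smear_add_le [CompleteSpace X] {E : Rd d → X} (hE : PolyGrowth s E)
    (ψ : 𝓢(Rd d, ℂ)) (x z : Rd d) {B : ℝ}
    (h : ∀ t ∈ Set.Icc (0 : ℝ) 1, ‖Scaling.smear (∂_{z} ψ) E (x + t • z)‖ ≤ B) :
    ‖Scaling.smear ψ E (x + z)‖ ≤ ‖Scaling.smear ψ E x‖ + B := by
  have h1 := hE.smear_add_sub_eq_integral ψ x z
  have h2 : ‖∫ t in Set.Ioc (0 : ℝ) 1, Scaling.smear (∂_{z} ψ) E (x + t • z)‖ ≤ B := by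
    have := norm_setIntegral_le_of_norm_le_const (μ := (volume : Measure ℝ))
      (s := Set.Ioc (0 : ℝ) 1) (by simp) fun t ht => h t ⟨ht.1.le, ht.2⟩
    simpa using this
  rw [← h1] at h2
  have h3 := norm_add_le (Scaling.smear ψ E (x + z) - Scaling.smear ψ E x) (Scaling.smear ψ E x)
  rw [sub_add_cancel] at h3
  linarith

theorem deg_add_single (k : Fin d → ℕ) (i : Fin d) : deg s (k + Pi.single i 1) = deg s k + s i := by
  unfold deg
  simp only [Pi.add_apply, add_mul, Finset.sum_add_distrib]
  congr 1
  rw [Finset.sum_eq_single i]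
  · simp
  · intro j _ hj
    simp [Pi.single_eq_of_ne hj]
  · simp

theorem PolyGrowth.smear_lineDeriv {E : Rd d → X} (hE : PolyGrowth s E) (k : Fin d → ℕ)
    (ψ : 𝓢(Rd d, ℂ)) (z y : Rd d) :
    Scaling.smear (∂_{z} (multiDeriv k ψ) : 𝓢(Rd d, ℂ)) E y
      = ∑ i, (z i : ℂ) • Scaling.smear (multiDeriv (k + Pi.single i 1) ψ) E y := by
  have hz : z = ∑ i, z i • EuclideanSpace.single i (1 : ℝ) := by
    ext j
    simp [Finset.sum_apply, Pi.single_apply]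
  have h1 : (∂_{z} (multiDeriv k ψ) : 𝓢(Rd d, ℂ))
      = ∑ i, (z i : ℂ) • multiDeriv (k + Pi.single i 1) ψ := by
    ext v
    conv_lhs => rw [hz]
    rw [SchwartzMap.lineDerivOp_apply_eq_fderiv, map_sum, sum_apply]
    refine Finset.sum_congr rfl fun i _ => ?_
    rw [map_smul, ← SchwartzMap.lineDerivOp_apply_eq_fderiv, multiDeriv_add_single, smul_apply,
      Complex.coe_smul]
  rw [h1]
  simp only [Scaling.smear, sum_apply, Finset.sum_smul, smul_apply, smul_assoc]
  have hi : ∀ i ∈ Finset.univ, Integrable fun v =>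
      (z i : ℂ) • multiDeriv (k + Pi.single i 1) ψ (y - v) • E v :=
    fun i _ => (hE.integrable _ y).smul (z i : ℂ)
  rw [integral_finsetSum _ hi]
  simp only [integral_smul]

/-- An anisotropic Taylor estimate. -/
theorem PolyGrowth.norm_smear_le_of_multiDeriv [CompleteSpace X] {E : Rd d → X}
    (hE : PolyGrowth s E) (ψ : 𝓢(Rd d, ℂ)) {x z : Rd d} {n : ℤ} (hz : snorm s z ≤ (2 : ℝ) ^ (-n))
    {m : ℕ} {B : ℝ} (hB : 0 ≤ B)
    (h1 : ∀ k : Fin d → ℕ, ∑ i, k i < m →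
      ‖Scaling.smear (multiDeriv k ψ) E x‖ ≤ B * ((2 : ℝ) ^ n) ^ deg s k)
    (h2 : ∀ k : Fin d → ℕ, ∑ i, k i = m → ∀ t ∈ Set.Icc (0 : ℝ) 1,
      ‖Scaling.smear (multiDeriv k ψ) E (x + t • z)‖ ≤ B * ((2 : ℝ) ^ n) ^ deg s k) :
    ‖Scaling.smear ψ E (x + z)‖ ≤ (1 + d) ^ m * B := by
  -- Induction on the number q of derivatives still missing to reach order m: a derivative on the
  -- segment is at most its value at x plus d directional terms of the next order, so each step
  -- costs a factor 1 + d.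
  have key : ∀ (q : ℕ) (k : Fin d → ℕ), ∑ i, k i + q = m → ∀ t ∈ Set.Icc (0 : ℝ) 1,
      ‖Scaling.smear (multiDeriv k ψ) E (x + t • z)‖
        ≤ (1 + d) ^ q * (B * ((2 : ℝ) ^ n) ^ deg s k) := by
    intro q
    induction q with
    | zero =>
      intro k hk t ht
      simpa using h2 k (by simpa using hk) t ht
    | succ q ih =>
      intro k hk t ht
      set c := B * ((2 : ℝ) ^ n) ^ deg s k
      have hc : 0 ≤ c := by positivity
      have hq : (1 : ℝ) ≤ (1 + d) ^ q := one_le_pow₀ (by linarith [(Nat.cast_nonneg d : (0 : ℝ) ≤ d)])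
      have h3 := hE.norm_smear_add_le (multiDeriv k ψ) x (t • z) (B := d * ((1 + d) ^ q * c))
        (fun τ hτ => by
          rw [hE.smear_lineDeriv]
          have h4 : ∀ i ∈ Finset.univ, ‖(((t • z) i : ℝ) : ℂ) •
              Scaling.smear (multiDeriv (k + Pi.single i 1) ψ) E (x + τ • t • z)‖
              ≤ (1 + d) ^ q * c := by
            intro i _
            have h5 := ih (k + Pi.single i 1) (by
              simp only [Pi.add_apply, Finset.sum_add_distrib, Finset.sum_pi_single',
                Finset.mem_univ, if_true]
              omega) (τ * t) ⟨mul_nonneg hτ.1 ht.1, mul_le_one₀ hτ.2 ht.1 ht.2⟩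
            rw [smul_smul, norm_smul, Complex.norm_real, Real.norm_eq_abs, PiLp.smul_apply,
              smul_eq_mul, abs_mul, abs_of_nonneg ht.1]
            -- The i-th coordinate of z has size 2^{-n𝔰ᵢ}, exactly what the additional derivative in
            -- direction i costs.
            have h6 : t * |z i| ≤ ((2 : ℝ) ^ (-n)) ^ (s i : ℕ) :=
              (mul_le_of_le_one_left (abs_nonneg _) ht.2).trans ((abs_apply_le_snorm_pow s z i).trans
                (pow_le_pow_left₀ (snorm_nonneg s z) hz _))
            calc _ ≤ ((2 : ℝ) ^ (-n)) ^ (s i : ℕ) *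
                  ((1 + d) ^ q * (B * ((2 : ℝ) ^ n) ^ deg s (k + Pi.single i 1))) := by
                  gcongr
              _ = (((2 : ℝ) ^ (-n)) ^ (s i : ℕ) * ((2 : ℝ) ^ n) ^ (s i : ℕ)) *
                  ((1 + d) ^ q * c) := by
                  rw [deg_add_single, pow_add]; ring
              _ = (1 + d) ^ q * c := by
                  rw [← mul_pow, zpow_neg, inv_mul_cancel₀ (by positivity), one_pow, one_mul]
          refine (norm_sum_le_of_le _ h4).trans (le_of_eq ?_)
          simp)
      refine h3.trans ?_
      have h7 := h1 k (by omega)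
      calc _ ≤ c + d * ((1 + d) ^ q * c) := by gcongr
        _ ≤ (1 + d) ^ q * c + d * ((1 + d) ^ q * c) := by
            gcongr
            exact le_mul_of_one_le_left hc hq
        _ = _ := by ring
  have := key m 0 (by simp) 1 (by simp)
  rw [multiDeriv_zero, one_smul] at this
  simpa [deg] using this

/-- With increments A(q-1)q^j the induction closes exactly, as A q^j + A(q-1)q^j = A q^{j+1}. -/
theorem norm_le_mul_pow_of_norm_sub_le {a : ℕ → X} {q A : ℝ} (hq : 1 < q) (hA : 0 ≤ A) {n₀ n : ℕ}
    (hn : n₀ ≤ n) (h0 : ‖a n₀‖ ≤ A)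
    (h : ∀ j, n₀ ≤ j → j < n → ‖a (j + 1) - a j‖ ≤ A * (q - 1) * q ^ j) : ‖a n‖ ≤ A * q ^ n := by
  induction n, hn using Nat.le_induction with
  | base => exact h0.trans (le_mul_of_one_le_right hA (one_le_pow₀ hq.le))
  | succ j hj ih =>
    have h1 := ih fun i hi hij => h i hi (by omega)
    have h2 := h j hj (by omega)
    have h3 := norm_add_le (a (j + 1) - a j) (a j)
    rw [sub_add_cancel] at h3
    refine h3.trans ((add_le_add h2 h1).trans (le_of_eq ?_))
    ring

theorem norm_sub_le_of_norm_sub_le_geometric {a : ℕ → X} {q Q : ℝ} (hq : q < 1) {n : ℕ} {L : X}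
    (hL : Tendsto a atTop (𝓝 L)) (h : ∀ j, n ≤ j → ‖a (j + 1) - a j‖ ≤ Q * q ^ j) :
    ‖a n - L‖ ≤ Q * q ^ n / (1 - q) := by
  have h1 := dist_le_of_le_geometric_of_tendsto₀ (f := fun i => a (n + i)) q (Q * q ^ n) hq
    (fun i => by
      rw [dist_comm, dist_eq_norm]
      have := h (n + i) (by omega)
      rw [pow_add, ← mul_assoc] at this
      exact this)
    (a := L) (hL.comp (tendsto_add_atTop_nat n |>.congr fun i => by rw [add_comm]))
  simpa [dist_eq_norm] using h1

end Scaling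

/-! ### Approximation by low-frequency cutoffs. -/

namespace DyadicCutoff

variable {d : ℕ} {s : Fin d → ℕ+} (φ : DyadicCutoff s)
variable {X : Type*} [NormedAddCommGroup X] [NormedSpace ℂ X] [CompleteSpace X]

/-- An approximate identity: after rescaling, the kernel is fixed and its argument shrinks to y, so
dominated convergence applies. -/
theorem tendsto_smear_psiLT {E : Rd d → X} (hE : PolyGrowth s E) (hc : Continuous E) (y : Rd d) :
    Tendsto (fun n : ℕ => smear (φ.psiLT n) E y) atTop (𝓝 (E y)) := by
  obtain ⟨hm, K, a, hK, ha, hb⟩ := id hE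
  set ψ := φ.low 0
  have h1 : ∀ n : ℕ, smear (φ.psiLT n) E y = ∫ v, ψ v • E (y - dyadic s (-(n : ℤ)) v) := fun n => by
    rw [φ.psiLT_eq_rescale n (by omega), sub_self, smear_rescale]
  have h2 : ∫ v, ψ v • E y = E y := by
    have h3 := φ.integral_psiLT le_rfl
    rw [φ.psiLT_eq_rescale 0 le_rfl, integral_rescale, sub_self] at h3
    rw [integral_smul_const, h3, one_smul]
  simp only [h1]
  rw [← h2]
  refine tendsto_integral_of_dominated_convergence
    (fun v => K * (1 + snorm s y) ^ a * (‖ψ v‖ * (1 + snorm s v) ^ a)) (fun n => ?_)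
    ((integrable_norm_mul_weight s ψ a).const_mul _) (fun n => Eventually.of_forall fun v => ?_)
    (Eventually.of_forall fun v => ?_)
  · exact (ψ.continuous.smul (hc.comp (continuous_const.sub
      (dyadic s (-(n : ℤ))).continuous))).aestronglyMeasurable
  · rw [norm_smul]
    have h4 : ‖E (y - dyadic s (-(n : ℤ)) v)‖ ≤ K * ((1 + snorm s y) ^ a * (1 + snorm s v) ^ a) := by
      refine (hb _).trans (mul_le_mul_of_nonneg_left ?_ hK)
      refine (one_add_snorm_sub_rpow_le s ha _ _).trans
        (mul_le_mul_of_nonneg_left ?_ (one_add_snorm_rpow_nonneg s y a))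
      refine Real.rpow_le_rpow (one_add_snorm_pos s _).le ?_ ha
      rw [snorm_dyadic]
      have h5 : (2 : ℝ) ^ (-(n : ℤ)) ≤ 1 := zpow_le_one_of_nonpos₀ one_le_two (by omega)
      have h6 := mul_le_of_le_one_left (snorm_nonneg s v) h5
      linarith
    have := mul_le_mul_of_nonneg_left h4 (norm_nonneg (ψ v))
    linarith
  · refine Tendsto.const_smul ?_ _
    have := (tendsto_dyadic_neg (s := s) v).const_sub y
    rw [sub_zero] at this
    exact (hc.tendsto y).comp this

theorem smear_multiDeriv_psiLT_succ {E : Rd d → X} (hE : PolyGrowth s E) (k : Fin d → ℕ) (n : ℕ)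
    (y : Rd d) : smear (multiDeriv k (φ.psiLT ((n + 1 : ℕ) : ℤ))) E y
      - smear (multiDeriv k (φ.psiLT n)) E y = smear (multiDeriv k (φ.psi n)) E y := by
  push_cast
  rw [φ.psiLT_add_one (by omega), multiDeriv_add, hE.smear_add_left, add_sub_cancel_left]

end DyadicCutoff

/-! ### Vanishing to a given order from block bounds and vanishing derivatives. -/

namespace Scaling

theorem two_zpow_pow_mul_rpow (n D : ℕ) (ρ : ℝ) :
    ((2 : ℝ) ^ (n : ℤ)) ^ D * ((2 : ℝ) ^ (-(n : ℤ))) ^ ρ = ((2 : ℝ) ^ ((D : ℝ) - ρ)) ^ n := by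
  rw [two_zpow_neg_rpow, zpow_natCast, zpow_natCast, ← pow_mul, mul_comm n D, pow_mul, ← mul_pow,
    Real.rpow_sub two_pos, Real.rpow_natCast, Real.rpow_neg two_pos.le, div_eq_mul_inv]

theorem sum_le_deg {d : ℕ} (s : Fin d → ℕ+) (k : Fin d → ℕ) : ∑ i, k i ≤ deg s k :=
  Finset.sum_le_sum fun i _ => Nat.le_mul_of_pos_right _ (s i).pos

/-- A function with polynomial growth around `x` whose regularised derivatives at `x` tend to zero,
and whose Littlewood–Paley blocks decay, vanishes at `x` to the corresponding order. -/
structure TaylorData {d : ℕ} {s : Fin d → ℕ+} (φ : DyadicCutoff s) (ρ ε b : ℝ)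
    (D : (Fin d → ℕ) → ℝ) {X : Type*} [NormedAddCommGroup X] [NormedSpace ℂ X] (K : ℝ)
    (h : Rd d → X) (x : Rd d) : Prop where
  cont : Continuous h
  nonneg : 0 ≤ K
  growth : ∀ v, ‖h v‖ ≤ K * (1 + snorm s (v - x)) ^ ρ
  block : ∀ (k : Fin d → ℕ) (l : ℕ), 3 ≤ l → ∀ y, ‖smear (multiDeriv k (φ.psi l)) h y‖
    ≤ D k * K * (((2 : ℝ) ^ (l : ℤ)) ^ deg s k *
      (((2 : ℝ) ^ (-(l : ℤ))) ^ ε * ((2 : ℝ) ^ (-(l : ℤ)) + snorm s (y - x)) ^ b))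
  tendsto : ∀ k : Fin d → ℕ, (deg s k : ℝ) < ρ →
    Tendsto (fun n : ℕ => smear (multiDeriv k (φ.psiLT n)) h x) atTop (𝓝 0)

namespace TaylorData

variable {d : ℕ} {s : Fin d → ℕ+} {φ : DyadicCutoff s} {ρ ε b : ℝ} {D : (Fin d → ℕ) → ℝ}
variable {X : Type*} [NormedAddCommGroup X] [NormedSpace ℂ X] {K : ℝ} {h : Rd d → X} {x : Rd d}

theorem polyGrowth (H : TaylorData φ ρ ε b D K h x) (hρ : 0 ≤ ρ) : PolyGrowth s h :=
  PolyGrowth.of_bound H.cont.aestronglyMeasurable H.nonneg hρ x H.growth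

/-- For blocks finer than the distance scale 2^{-n}, the weight saturates at 2 · 2^{-n}, and only
the factor 2^{-lε} still decays in l. -/
theorem block_near (H : TaylorData φ ρ ε b D K h x) (hb : 0 ≤ b) (hD : ∀ k, 0 ≤ D k)
    (k : Fin d → ℕ) {l n : ℕ} (hl : 3 ≤ l) {y : Rd d} (hy : snorm s (y - x) ≤ (2 : ℝ) ^ (-(n : ℤ)))
    (hln : (2 : ℝ) ^ (-(l : ℤ)) ≤ (2 : ℝ) ^ (-(n : ℤ))) :
    ‖smear (multiDeriv k (φ.psi l)) h y‖ ≤ D k * K * (((2 : ℝ) ^ (l : ℤ)) ^ deg s k *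
      (((2 : ℝ) ^ (-(l : ℤ))) ^ ε * (2 ^ b * ((2 : ℝ) ^ (-(n : ℤ))) ^ b))) := by
  refine (H.block k l hl y).trans ?_
  have h1 := hD k
  have h2 := H.nonneg
  rw [← Real.mul_rpow two_pos.le (by positivity)]
  have h3 : 0 ≤ (2 : ℝ) ^ (-(l : ℤ)) + snorm s (y - x) :=
    add_nonneg (by positivity) (snorm_nonneg s _)
  gcongr
  linarith

theorem block_diag (H : TaylorData φ ρ ε b D K h x) (hb : 0 ≤ b) (hερ : ε + b = ρ)
    (hD : ∀ k, 0 ≤ D k) (k : Fin d → ℕ) {l : ℕ} (hl : 3 ≤ l) {y : Rd d}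
    (hy : snorm s (y - x) ≤ (2 : ℝ) ^ (-(l : ℤ))) :
    ‖smear (multiDeriv k (φ.psi l)) h y‖ ≤ K * (D k * 2 ^ b) * ((2 : ℝ) ^ ((deg s k : ℝ) - ρ)) ^ l := by
  refine (H.block_near hb hD k hl hy le_rfl).trans (le_of_eq ?_)
  rw [← two_zpow_pow_mul_rpow, ← hερ, Real.rpow_add (by positivity)]
  ring

/-- The constant bounding the regularised derivative of order `k`. -/
noncomputable def derivConst (φ : DyadicCutoff s) (ρ b : ℝ) (D : (Fin d → ℕ) → ℝ)
    (k : Fin d → ℕ) : ℝ :=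
  weightedL1 s (multiDeriv k (φ.psiLT (3 : ℕ))) ρ * 2 ^ ρ
    + D k * 2 ^ b / |(2 : ℝ) ^ ((deg s k : ℝ) - ρ) - 1|

theorem derivConst_nonneg (φ : DyadicCutoff s) (ρ b : ℝ) (hD : ∀ k, 0 ≤ D k) (k : Fin d → ℕ) :
    0 ≤ derivConst φ ρ b D k := by
  have h1 := hD k
  have h2 := weightedL1_nonneg s (multiDeriv k (φ.psiLT (3 : ℕ))) ρ
  unfold derivConst
  positivity

/-- The increments in n are blocks of size q^n with q = 2^{|k|-ρ}, where |k| denotes the scaled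
degree. For q > 1 they are summed upwards from n = 3; for q < 1 they are summed downwards from the
limit, known to be zero at x only. This is why y = x is imposed for low degrees. -/
theorem norm_deriv_le [CompleteSpace X] (H : TaylorData φ ρ ε b D K h x) (hρ : 0 ≤ ρ) (hb : 0 ≤ b)
    (hερ : ε + b = ρ) (hD : ∀ k, 0 ≤ D k) {k : Fin d → ℕ} {n : ℕ} (hn : 3 ≤ n) {y : Rd d}
    (hy : snorm s (y - x) ≤ (2 : ℝ) ^ (-(n : ℤ)))
    (hk : ρ < deg s k ∨ ((deg s k : ℝ) < ρ ∧ y = x)) :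
    ‖smear (multiDeriv k (φ.psiLT n)) h y‖
      ≤ K * derivConst φ ρ b D k * ((2 : ℝ) ^ ((deg s k : ℝ) - ρ)) ^ n := by
  have hE := H.polyGrowth hρ
  have hK := H.nonneg
  have hDk := hD k
  have hW := weightedL1_nonneg s (multiDeriv k (φ.psiLT (3 : ℕ))) ρ
  set q := (2 : ℝ) ^ ((deg s k : ℝ) - ρ)
  have hq0 : 0 < q := by positivity
  set A := derivConst φ ρ b D k
  have hA0 : 0 ≤ A := derivConst_nonneg φ ρ b hD k
  rcases hk with hk | ⟨hk, rfl⟩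
  · have hq : 1 < q := Real.one_lt_rpow one_lt_two (by linarith)
    -- The second summand of `derivConst` is chosen to dominate the geometric sum; its absolute
    -- value covers both q > 1 and q < 1.
    have hA : D k * 2 ^ b ≤ A * (q - 1) := by
      have h0 : 0 < q - 1 := by linarith
      rw [← div_le_iff₀ h0]
      have : A = _ + D k * 2 ^ b / |q - 1| := rfl
      rw [abs_of_pos h0] at this
      rw [this]
      exact le_add_of_nonneg_left (by positivity)
    have hA' : weightedL1 s (multiDeriv k (φ.psiLT (3 : ℕ))) ρ * 2 ^ ρ ≤ A :=
      le_add_of_nonneg_right (by positivity)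
    refine norm_le_mul_pow_of_norm_sub_le (a := fun n : ℕ => smear (multiDeriv k (φ.psiLT n)) h y)
      hq (by positivity) hn ?_ fun j hj hjn => ?_
    · refine (norm_smear_le s hρ hK H.growth _ y).trans ?_
      have h1 : (1 + snorm s (y - x)) ^ ρ ≤ 2 ^ ρ := by
        refine Real.rpow_le_rpow (one_add_snorm_pos s _).le ?_ hρ
        have : (2 : ℝ) ^ (-(n : ℤ)) ≤ 1 := zpow_le_one_of_nonpos₀ one_le_two (by omega)
        linarith
      calc _ ≤ K * weightedL1 s (multiDeriv k (φ.psiLT (3 : ℕ))) ρ * 2 ^ ρ := by gcongr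
        _ ≤ _ := by rw [mul_assoc]; gcongr
    · rw [φ.smear_multiDeriv_psiLT_succ hE]
      refine (H.block_diag hb hερ hD k hj (hy.trans ?_)).trans ?_
      · exact zpow_le_zpow_right₀ one_le_two (by omega)
      · rw [mul_assoc K A]
        gcongr
  · have hq : q < 1 := Real.rpow_lt_one_of_one_lt_of_neg one_lt_two (by linarith)
    have h1 := norm_sub_le_of_norm_sub_le_geometric (n := n) (Q := K * (D k * 2 ^ b))
      (a := fun n : ℕ => smear (multiDeriv k (φ.psiLT n)) h y) hq
      (H.tendsto k hk) fun j hj => by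
        rw [φ.smear_multiDeriv_psiLT_succ hE]
        refine H.block_diag hb hερ hD k (by omega) ?_
        rw [sub_self, snorm_zero]
        positivity
    rw [sub_zero] at h1
    refine h1.trans ?_
    have hA : D k * 2 ^ b / (1 - q) ≤ A := by
      have h0 : |q - 1| = 1 - q := by rw [abs_of_neg (by linarith)]; ring
      have : A = _ + D k * 2 ^ b / |q - 1| := rfl
      rw [h0] at this
      rw [this]
      exact le_add_of_nonneg_left (by positivity)
    calc _ = K * (D k * 2 ^ b / (1 - q)) * q ^ n := by ring
      _ ≤ _ := by gcongr

/-- The missing blocks at y have size 2^{-jε} 2^{-nb} for j ≥ n. They are summable because ε > 0,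
with sum of order 2^{-n(ε+b)} = 2^{-nρ}. -/
theorem norm_sub_smear_le [CompleteSpace X] (H : TaylorData φ ρ ε b D K h x) (hρ : 0 ≤ ρ)
    (hε : 0 < ε) (hb : 0 ≤ b)
    (hερ : ε + b = ρ) (hD : ∀ k, 0 ≤ D k) {n : ℕ} (hn : 3 ≤ n) {y : Rd d}
    (hy : snorm s (y - x) ≤ (2 : ℝ) ^ (-(n : ℤ))) :
    ‖smear (φ.psiLT n) h y - h y‖
      ≤ K * (D 0 * 2 ^ b / (1 - 2 ^ (-ε))) * ((2 : ℝ) ^ (-(n : ℤ))) ^ ρ := by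
  have hE := H.polyGrowth hρ
  have hq : (2 : ℝ) ^ (-ε) < 1 := Real.rpow_lt_one_of_one_lt_of_neg one_lt_two (by linarith)
  have h1 := norm_sub_le_of_norm_sub_le_geometric (n := n)
    (a := fun n : ℕ => smear (φ.psiLT n) h y)
    (Q := K * (D 0 * 2 ^ b) * ((2 : ℝ) ^ (-(n : ℤ))) ^ b) hq
    (φ.tendsto_smear_psiLT hE H.cont y) fun j hj => by
      have h2 := φ.smear_multiDeriv_psiLT_succ hE 0 j y
      have h3 := H.block_near hb hD 0 (l := j) (by omega) hy
        (zpow_le_zpow_right₀ one_le_two (by omega))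
      simp only [multiDeriv_zero] at h2 h3
      rw [h2]
      refine h3.trans (le_of_eq ?_)
      rw [two_zpow_neg_rpow j ε, zpow_natCast]
      simp [deg]
      ring
  refine h1.trans (le_of_eq ?_)
  rw [← zpow_natCast, ← two_zpow_neg_rpow, ← hερ, Real.rpow_add (by positivity)]
  ring

/-- The constant in the Taylor estimate. -/
noncomputable def const (φ : DyadicCutoff s) (ρ ε b : ℝ) (D : (Fin d → ℕ) → ℝ) : ℝ :=
  9 ^ ρ + 2 ^ ρ * (D 0 * 2 ^ b / (1 - 2 ^ (-ε)) + (1 + d) ^ (⌊ρ⌋₊ + 1) *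
    ∑ k ∈ Fintype.piFinset fun _ : Fin d => Finset.range (⌊ρ⌋₊ + 2), derivConst φ ρ b D k)

theorem const_nonneg (φ : DyadicCutoff s) (hε : 0 < ε) (hD : ∀ k, 0 ≤ D k) :
    0 ≤ const φ ρ ε b D := by
  have hD0 := hD 0
  have hq : 0 < 1 - (2 : ℝ) ^ (-ε) :=
    sub_pos.2 (Real.rpow_lt_one_of_one_lt_of_neg one_lt_two (by linarith))
  have h1 := Finset.sum_nonneg fun k
    (_ : k ∈ Fintype.piFinset fun _ : Fin d => Finset.range (⌊ρ⌋₊ + 2)) =>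
    derivConst_nonneg φ ρ b hD k
  unfold const
  positivity

/-- At the scale 2^{-n} of ‖y-x‖, h is split into Ψ^{<n} ∗ h, handled by Taylor's formula around x,
and the remaining high frequencies. Non-criticality of ρ makes every derivative fall into one of the
two cases of `norm_deriv_le`. -/
theorem norm_le [CompleteSpace X] (H : TaylorData φ ρ ε b D K h x)
    (hε : 0 < ε) (hb : 0 ≤ b) (hερ : ε + b = ρ) (hD : ∀ k, 0 ≤ D k)
    (hne : ∀ k : Fin d → ℕ, (deg s k : ℝ) ≠ ρ) (y : Rd d) :
    ‖h y‖ ≤ const φ ρ ε b D * K * snorm s (y - x) ^ ρ := by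
  have hρ : 0 < ρ := by linarith
  have hE := H.polyGrowth hρ.le
  have hK := H.nonneg
  have hD0 := hD 0
  have hq : 0 < 1 - (2 : ℝ) ^ (-ε) :=
    sub_pos.2 (Real.rpow_lt_one_of_one_lt_of_neg one_lt_two (by linarith))
  -- A multi-index of order m has scaled degree at least m > ρ, so at top order the supercritical
  -- bound is available along the whole segment.
  set m := ⌊ρ⌋₊ + 1
  set A := ∑ k ∈ Fintype.piFinset fun _ : Fin d => Finset.range (⌊ρ⌋₊ + 2), derivConst φ ρ b D k
    with hA
  have hA0 : 0 ≤ A := Finset.sum_nonneg fun k _ => derivConst_nonneg φ ρ b hD k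
  set c := D 0 * 2 ^ b / (1 - 2 ^ (-ε)) + (1 + d) ^ m * A
  have hc : 0 ≤ c := by positivity
  have hC : const φ ρ ε b D = 9 ^ ρ + 2 ^ ρ * c := rfl
  set r := snorm s (y - x) with hr
  have hr0 : 0 ≤ r := snorm_nonneg s _
  rw [hC]
  rcases hr0.eq_or_lt with h0 | h0
  · have hyx : y = x := by
      by_contra hne
      exact (snorm_pos s (sub_ne_zero.2 hne)).ne h0
    have h1 := H.tendsto 0 (by simpa [deg] using hρ)
    simp only [multiDeriv_zero] at h1
    rw [hyx, tendsto_nhds_unique (φ.tendsto_smear_psiLT hE H.cont x) h1, norm_zero]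
    positivity
  -- Away from x the growth bound suffices, since 1 + r ≤ 9r. The threshold 1/8 = 2^{-3} ensures
  -- that below it only scales n ≥ 3 occur, where the block bounds hold.
  by_cases h8 : 1 / 8 < r
  · refine (H.growth y).trans ?_
    have h1 : (1 + r) ^ ρ ≤ 9 ^ ρ * r ^ ρ := by
      rw [← Real.mul_rpow (by norm_num) hr0]
      exact Real.rpow_le_rpow (by linarith) (by linarith) hρ.le
    have h2 : 0 ≤ 2 ^ ρ * c * K * r ^ ρ := by positivity
    have h3 := mul_le_mul_of_nonneg_left h1 hK
    linarith
  obtain ⟨n, hn1, hn2⟩ := exists_nat_pow_near_of_lt_one h0 (by linarith)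
    (show (0 : ℝ) < 1 / 2 by norm_num) (by norm_num)
  have hpow : ∀ j : ℕ, (2 : ℝ) ^ (-(j : ℤ)) = (1 / 2) ^ j := fun j => by
    rw [zpow_neg, zpow_natCast, one_div, inv_pow]
  have hn : 3 ≤ n := by
    by_contra hlt
    have h1 : (1 / 2 : ℝ) ^ 3 ≤ (1 / 2) ^ (n + 1) :=
      pow_le_pow_of_le_one (by norm_num) (by norm_num) (by omega)
    norm_num at h1 h8
    linarith
  have hy : snorm s (y - x) ≤ (2 : ℝ) ^ (-(n : ℤ)) := by rw [hpow]; exact hn2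
  have hB : ∀ k : Fin d → ℕ, ∑ i, k i ≤ m → ∀ y', snorm s (y' - x) ≤ (2 : ℝ) ^ (-(n : ℤ)) →
      (ρ < deg s k ∨ ((deg s k : ℝ) < ρ ∧ y' = x)) →
      ‖smear (multiDeriv k (φ.psiLT n)) h y'‖
        ≤ K * A * ((2 : ℝ) ^ (-(n : ℤ))) ^ ρ * ((2 : ℝ) ^ (n : ℤ)) ^ deg s k := by
    intro k hk y' hy' hcase
    refine (H.norm_deriv_le hρ.le hb hερ hD hn hy' hcase).trans ?_
    have h1 : derivConst φ ρ b D k ≤ A := by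
      refine Finset.single_le_sum (fun k _ => derivConst_nonneg φ ρ b hD k) ?_
      rw [Fintype.mem_piFinset]
      intro i
      have := Finset.single_le_sum (f := k) (fun i _ => Nat.zero_le _) (Finset.mem_univ i)
      rw [Finset.mem_range]
      omega
    rw [← two_zpow_pow_mul_rpow]
    calc _ ≤ K * A * (((2 : ℝ) ^ (n : ℤ)) ^ deg s k * ((2 : ℝ) ^ (-(n : ℤ))) ^ ρ) := by gcongr
      _ = _ := by ring
  have hmain := hE.norm_smear_le_of_multiDeriv (φ.psiLT n) (x := x) (z := y - x) (n := n) (m := m)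
    (B := K * A * ((2 : ℝ) ^ (-(n : ℤ))) ^ ρ) hy (by positivity)
    (fun k hk => hB k hk.le x (by rw [sub_self, snorm_zero]; positivity) (by
      rcases lt_or_gt_of_ne (hne k) with h1 | h1
      · exact Or.inr ⟨h1, rfl⟩
      · exact Or.inl h1))
    (fun k hk t ht => hB k hk.le _ (by
      rw [add_sub_cancel_left]
      exact (snorm_smul_le (abs_le.2 ⟨by linarith [ht.1], ht.2⟩) _).trans hy) (by
      left
      have h1 := sum_le_deg s k
      have h2 : ρ < m := Nat.lt_floor_add_one ρ |>.trans_eq (by push_cast [m]; rfl)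
      rw [hk] at h1
      exact h2.trans_le (by exact_mod_cast h1)))
  rw [add_sub_cancel] at hmain
  have h1 := H.norm_sub_smear_le hρ.le hε hb hερ hD hn hy
  have h2 := norm_sub_norm_le (h y) (smear (φ.psiLT n) h y)
  rw [norm_sub_rev] at h2
  -- By the choice of n, 2^{-(n+1)} < r, so returning from 2^{-n} to r costs 2^ρ.
  have h3 : ((2 : ℝ) ^ (-(n : ℤ))) ^ ρ ≤ 2 ^ ρ * r ^ ρ := by
    rw [← Real.mul_rpow two_pos.le hr0, hpow]
    refine Real.rpow_le_rpow (by positivity) ?_ hρ.le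
    rw [pow_succ] at hn1
    linarith
  have h4 : ‖h y‖ ≤ K * c * ((2 : ℝ) ^ (-(n : ℤ))) ^ ρ := by
    have : K * c * ((2 : ℝ) ^ (-(n : ℤ))) ^ ρ
        = K * (D 0 * 2 ^ b / (1 - 2 ^ (-ε))) * ((2 : ℝ) ^ (-(n : ℤ))) ^ ρ
          + (1 + d) ^ m * (K * A * ((2 : ℝ) ^ (-(n : ℤ))) ^ ρ) := by ring
    linarith
  have h5 : 0 ≤ 9 ^ ρ * K * r ^ ρ := by positivity
  have h6 : K * c * ((2 : ℝ) ^ (-(n : ℤ))) ^ ρ ≤ K * c * (2 ^ ρ * r ^ ρ) := by gcongr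
  linarith

end TaylorData

end Scaling

/-! ### Bounds on smeared derivatives, and Besov norms through pointwise block bounds. -/

namespace Scaling

variable {d : ℕ} {s : Fin d → ℕ+} {X : Type*} [NormedAddCommGroup X] [NormedSpace ℂ X]

theorem smear_smul_left (c : ℂ) (ψ : 𝓢(Rd d, ℂ)) (E : Rd d → X) (y : Rd d) :
    smear (c • ψ) E y = c • smear ψ E y := by
  simp only [smear, smul_apply, smul_assoc, integral_smul]

theorem norm_smear_le_of_bounded (m : ℤ) (ψ : 𝓢(Rd d, ℂ)) {E : Rd d → X} {N : ℝ} (hN : 0 ≤ N)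
    (h : ∀ v, ‖E v‖ ≤ N) (y : Rd d) : ‖smear (rescale s m ψ) E y‖ ≤ N * weightedL1 s ψ 0 := by
  have := norm_smear_rescale_le s m ψ le_rfl y y (Eventually.of_forall fun v => by simpa using h v) hN
  simpa using this

theorem norm_smear_multiDeriv_rescale_le (k : Fin d → ℕ) (m : ℤ) (ψ : 𝓢(Rd d, ℂ)) {E : Rd d → X}
    {K a : ℝ} (ha : 0 ≤ a) (x y : Rd d)
    (hE : ∀ᵐ v, ‖E v‖ ≤ K * ((2 : ℝ) ^ (-m) + snorm s (v - x)) ^ a) (hK : 0 ≤ K) :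
    ‖smear (multiDeriv k (rescale s m ψ)) E y‖ ≤ ((2 : ℝ) ^ m) ^ deg s k *
      (K * weightedL1 s (multiDeriv k ψ) a * ((2 : ℝ) ^ (-m) + snorm s (y - x)) ^ a) := by
  rw [multiDeriv_rescale, smear_smul_left, norm_smul]
  refine mul_le_mul (le_of_eq ?_) (norm_smear_rescale_le s m _ ha x y hE hK) (norm_nonneg _)
    (by positivity)
  simp

end Scaling

namespace DyadicCutoff

variable {d : ℕ} {s : Fin d → ℕ+} (φ : DyadicCutoff s)
variable {X : Type*} [NormedAddCommGroup X] [NormedSpace ℂ X]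

theorem block_sub (j : ℤ) (f g : 𝓢'(Rd d, X)) (x : Rd d) :
    φ.block j (f - g) x = φ.block j f x - φ.block j g x := rfl

theorem besovNorm_zero (r : ℝ) : φ.besovNorm r (0 : 𝓢'(Rd d, X)) = 0 := by
  have h : ∀ j, φ.block j (0 : 𝓢'(Rd d, X)) = 0 := fun j => rfl
  simp [besovNorm, h]

theorem ofReal_zpow_mul (j : ℤ) (r B : ℝ) :
    ENNReal.ofReal ((2 : ℝ) ^ ((j : ℝ) * r)) * ENNReal.ofReal (B * ((2 : ℝ) ^ (-j)) ^ r)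
      = ENNReal.ofReal B := by
  rw [← ENNReal.ofReal_mul (by positivity)]
  congr 1
  rw [Real.rpow_mul two_pos.le, Real.rpow_intCast, mul_left_comm, ← Real.mul_rpow (by positivity)
    (by positivity), ← zpow_add₀ two_ne_zero, add_neg_cancel, zpow_zero, Real.one_rpow, mul_one]

theorem besovNorm_le {r B : ℝ} {f : 𝓢'(Rd d, X)}
    (h : ∀ j : ℤ, -1 ≤ j → ∀ x, ‖φ.block j f x‖ ≤ B * ((2 : ℝ) ^ (-j)) ^ r) :
    φ.besovNorm r f ≤ ENNReal.ofReal B := by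
  refine iSup₂_le fun j hj => ?_
  rw [← ofReal_zpow_mul j r B, eLpNorm_exponent_top]
  gcongr
  exact eLpNormEssSup_le_of_ae_bound (Eventually.of_forall (h j hj))

theorem ae_norm_block_le {r B : ℝ} {f : 𝓢'(Rd d, X)} (hB : 0 ≤ B)
    (h : φ.besovNorm r f ≤ ENNReal.ofReal B) {j : ℤ} (hj : -1 ≤ j) :
    ∀ᵐ x, ‖φ.block j f x‖ ≤ B * ((2 : ℝ) ^ (-j)) ^ r := by
  have h1 := (le_iSup₂_of_le (f := fun (j : ℤ) (_ : -1 ≤ j) =>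
    ENNReal.ofReal ((2 : ℝ) ^ ((j : ℝ) * r)) * eLpNorm (φ.block j f) ∞ volume) j hj le_rfl).trans h
  rw [← ofReal_zpow_mul j r B, ENNReal.mul_le_mul_iff_right (by positivity) ENNReal.ofReal_ne_top,
    eLpNorm_exponent_top] at h1
  filter_upwards [ae_le_eLpNormEssSup (f := φ.block j f) (μ := volume)] with x hx
  have h2 := hx.trans h1
  rw [← ofReal_norm] at h2
  exact (ENNReal.ofReal_le_ofReal_iff (by positivity)).1 h2

end DyadicCutoff

/-! ### From modelled distributions to the paraproduct-based space. -/

namespace Model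

variable {R : RegularityStructure.{u}} {d : ℕ} {s : Fin d → ℕ+} (M : Model R s)
variable {γ N L : ℝ} {F : Rd d → R.Space} (φ : DyadicCutoff s)

/-- Continuity is not part of the definition of 𝒟^γ. Near x, F^α differs from the continuous
function Γ^α_{·x} F_x by a positive power of the distance. -/
theorem continuous_of_norm_sub_Γ_le (hF : ValuesBelow γ F)
    (hD : ∀ α : R.A, (α : ℝ) < γ → ∀ u v,
      ‖F v α - (M.Γ v u (F u)) α‖ ≤ L * snorm s (v - u) ^ (γ - α)) (α : R.A) :
    Continuous fun x => F x α := by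
  rcases lt_or_ge (α : ℝ) γ with hα | hα
  · refine continuous_iff_continuousAt.2 fun x => ?_
    have h1 := (M.continuous_orbit (hF x) x α).tendsto x
    have h2 : Tendsto (fun y => F y α - M.orbit x (F x) α y) (𝓝 x) (𝓝 0) := by
      refine squeeze_zero_norm (fun y => hD α hα x y) ?_
      have hs : Tendsto (fun y => snorm s (y - x)) (𝓝 x) (𝓝 0) := by
        have := ((continuous_snorm s).comp (continuous_id.sub continuous_const)).tendsto
          (f := fun y => snorm s (y - x)) x
        simpa [snorm_zero] using this
      have hp : 0 < γ - α := by linarith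
      have h3 := (hs.rpow_const (p := γ - α) (Or.inr hp.le)).const_mul L
      rwa [Real.zero_rpow hp.ne', mul_zero] at h3
    have h3 := h2.add h1
    simp only [sub_add_cancel, zero_add] at h3
    rw [orbit, M.Γ_self] at h3
    exact h3
  · simp only [hF _ α hα]
    exact continuous_const

/-- The supremum in the norm runs over all of A; components at or above γ must be shown not to
contribute. -/
theorem sharpNorm_eq_zero (hF : ValuesBelow γ F) {α : R.A} (hα : γ ≤ (α : ℝ)) :
    M.sharpNorm φ γ F α = 0 := by
  have hp : ∀ j x z, M.paraIntegrand φ F α j x z = 0 := fun j x z => by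
    rw [paraIntegrand, M.Γ_apply_eq_zero (hF _) _ _ hα, smul_zero]
  have h0 : Represents (fun _ : Rd d => (0 : R.T α)) 0 := fun η => by simp
  have hg : M.IsSharp φ F α 0 := by
    refine ⟨0, 0, ?_, ⟨fun j _ x => ?_, fun _ => 0, fun n => ?_, hasSum_zero⟩, (sub_zero _).symm⟩
    · simpa only [hF _ α hα] using h0
    · simp only [funext (hp j x)]
      exact integrable_zero _ _ _
    · simpa only [hp, integral_zero] using h0
  rw [hg.sharpNorm_eq, φ.besovNorm_zero]

theorem exists_isSharp (hF : R.IsCb γ N F) {α : R.A} (hα : (α : ℝ) < γ) :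
    ∃ g, M.IsSharp φ F α g := by
  obtain ⟨f, hf⟩ := exists_represents (hF.cont α).aestronglyMeasurable (hF.bound α)
  obtain ⟨P, hP⟩ := M.exists_isParaproduct φ hF hα
  exact ⟨_, f, P, hf, hP, rfl⟩

/-- The sum of the `L¹` norms of the kernels of low frequency. -/
noncomputable def _root_.DyadicCutoff.lowWeight (φ : DyadicCutoff s) : ℝ :=
  ∑ j ∈ Finset.Ico (-1 : ℤ) 3, weightedL1 s (φ.psi j) 0

theorem _root_.DyadicCutoff.weightedL1_le_lowWeight {l : ℤ} (hl : -1 ≤ l) (hl3 : l < 3) :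
    weightedL1 s (φ.psi l) 0 ≤ φ.lowWeight :=
  Finset.single_le_sum (f := fun j => weightedL1 s (φ.psi j) 0)
    (fun _ _ => weightedL1_nonneg s _ _) (Finset.mem_Ico.2 ⟨hl, hl3⟩)

theorem _root_.DyadicCutoff.lowWeight_nonneg : 0 ≤ φ.lowWeight :=
  Finset.sum_nonneg fun _ _ => weightedL1_nonneg s _ _

/-- The constant in the Besov estimate for blocks of low frequency. -/
noncomputable def _root_.DyadicCutoff.lowConst (φ : DyadicCutoff s) (ρ : ℝ) : ℝ :=
  φ.lowWeight * (1 + (φ.gap + 2) * (weightedL1 s (φ.psi 0) 0 + φ.paraConst ρ 0))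

/-- The constant in the Besov estimate. -/
noncomputable def _root_.DyadicCutoff.sharpConst (φ : DyadicCutoff s) (ρ : ℝ) : ℝ :=
  4 ^ ρ * φ.lowConst ρ +
    φ.paraConst ρ 0 * ((φ.gap + 2) * (4 : ℝ) ^ (ρ + 0) * weightedL1 s (φ.psi 0) 0)

theorem _root_.DyadicCutoff.lowConst_nonneg (ρ : ℝ) : 0 ≤ φ.lowConst ρ := by
  have h1 := weightedL1_nonneg s (φ.psi 0) 0
  have h2 := φ.paraConst_nonneg ρ 0
  have h3 := φ.lowWeight_nonneg
  unfold DyadicCutoff.lowConst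
  positivity

theorem _root_.DyadicCutoff.sharpConst_nonneg (ρ : ℝ) : 0 ≤ φ.sharpConst ρ := by
  have h1 := weightedL1_nonneg s (φ.psi 0) 0
  have h2 := φ.paraConst_nonneg ρ 0
  have h3 := φ.lowConst_nonneg ρ
  unfold DyadicCutoff.sharpConst
  positivity

theorem norm_block_sub_le_low (hF : R.IsCb γ N F) (hL : 0 ≤ L) {α : R.A} (hα : (α : ℝ) < γ)
    (hD : ∀ u v, ‖F v α - (M.Γ v u (F u)) α‖ ≤ L * snorm s (v - u) ^ (γ - α))
    {f P : 𝓢'(Rd d, R.T α)} (hf : Represents (fun x => F x α) f) (hP : M.IsParaproduct φ F α P)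
    {l : ℤ} (hl : -1 ≤ l) (hl3 : l < 3) (w : Rd d) :
    ‖φ.block l f w - φ.block l P w‖ ≤ φ.lowConst (γ - α) * (N + L) := by
  have hgap := φ.three_le_gap
  have hN := hF.nonneg
  set W := weightedL1 s (φ.psi 0) 0
  have hW : 0 ≤ W := weightedL1_nonneg s _ _
  set c := φ.paraConst (γ - α) 0
  have hc : 0 ≤ c := φ.paraConst_nonneg _ _
  set V := φ.lowWeight
  have hV : weightedL1 s (φ.psi l) 0 ≤ V := φ.weightedL1_le_lowWeight hl hl3
  have hV0 : 0 ≤ V := (weightedL1_nonneg s _ _).trans hV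
  have hsm : ∀ {E : Rd d → R.T α} {B : ℝ}, 0 ≤ B → (∀ v, ‖E v‖ ≤ B) →
      ‖smear (φ.psi l) E w‖ ≤ B * V := by
    intro E B hB h
    have h1 := norm_smear_le s le_rfl hB (x := w) (fun v => by simpa using h v) (φ.psi l) w
    simp only [Real.rpow_zero, mul_one] at h1
    exact h1.trans (by gcongr)
  -- The term is bounded through its distance to Ψ^i ∗ F^α rather than through the coefficients of
  -- Γ. This keeps ‖Γ‖_γ out of the constant, so the polynomial p can be constant.
  have hpara : ∀ i : ℤ, 0 < i → ∀ y, ‖M.paraTerm φ F α i y‖ ≤ (N + L) * (W + c) := by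
    intro i hi y
    have h1 := M.norm_smear_psi_sub_paraTerm_le φ hF hα hL hD hi y
    have h2 : ‖smear (φ.psi i) (fun v => F v α) y‖ ≤ N * W := by
      rw [φ.psi_eq_rescale hi.le]
      exact norm_smear_le_of_bounded i _ hN (hF.bound α) y
    have h3 : ((2 : ℝ) ^ (-i)) ^ (γ - α) ≤ 1 :=
      Real.rpow_le_one (by positivity) (zpow_le_one_of_nonpos₀ one_le_two (by omega)) (by linarith)
    have h4 : L * c * ((2 : ℝ) ^ (-i)) ^ (γ - α) ≤ L * c :=
      mul_le_of_le_one_right (by positivity) h3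
    have h5 := norm_sub_norm_le (M.paraTerm φ F α i y) (smear (φ.psi i) (fun v => F v α) y)
    rw [norm_sub_rev] at h5
    nlinarith [mul_nonneg hN hc, mul_nonneg hL hW]
  have hf' := hsm hN (hF.bound α)
  have hP' : ‖φ.block l P w‖ ≤ (φ.gap + 2) * ((N + L) * (W + c) * V) := by
    rw [hP.block_eq hF hα hl le_rfl (Or.inl rfl)]
    refine (norm_sum_le_of_le _ fun i hi => hsm (B := (N + L) * (W + c)) (by positivity)
      (hpara i (by have := (Finset.mem_Ico.1 hi).1; omega))).trans ?_
    rw [Finset.sum_const, nsmul_eq_mul, Int.card_Ico]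
    gcongr
    have : (l + (φ.gap : ℤ) - 1).toNat ≤ φ.gap + 2 := by omega
    exact_mod_cast this
  rw [hf.block_eq]
  refine (norm_sub_le _ _).trans ((add_le_add hf' hP').trans ?_)
  have : φ.lowConst (γ - α) = V * (1 + (φ.gap + 2) * (W + c)) := rfl
  rw [this]
  nlinarith [mul_nonneg hL hV0]

/-- For l ≥ 3 the paraproduct matches F^α up to 2^{-i(γ-α)} at every scale of the window. The
finitely many lower blocks need only a uniform bound. -/
theorem besovNorm_sharp_le (hF : R.IsCb γ N F) (hL : 0 ≤ L) {α : R.A} (hα : (α : ℝ) < γ)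
    (hD : ∀ u v, ‖F v α - (M.Γ v u (F u)) α‖ ≤ L * snorm s (v - u) ^ (γ - α))
    {g : 𝓢'(Rd d, R.T α)} (hg : M.IsSharp φ F α g) :
    φ.besovNorm (γ - α) g ≤ ENNReal.ofReal (φ.sharpConst (γ - α) * (N + L)) := by
  obtain ⟨f, P, hf, hP, rfl⟩ := hg
  have hN := hF.nonneg
  have hlow := φ.lowConst_nonneg (γ - α)
  have hW := weightedL1_nonneg s (φ.psi 0) 0
  have hc := φ.paraConst_nonneg (γ - α) 0
  set high := φ.paraConst (γ - α) 0 *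
    ((φ.gap + 2) * (4 : ℝ) ^ (γ - α + 0) * weightedL1 s (φ.psi 0) 0) with hhigh
  have hhigh0 : 0 ≤ high := by positivity
  have hC : φ.sharpConst (γ - α) = 4 ^ (γ - α) * φ.lowConst (γ - α) + high := rfl
  refine φ.besovNorm_le fun l hl w => ?_
  rw [φ.block_sub]
  rcases lt_or_ge l 3 with hl3 | hl3
  · refine (M.norm_block_sub_le_low φ hF hL hα hD hf hP hl hl3 w).trans ?_
    -- Since l ≤ 2, the factor 4^{γ-α} compensates the decay that a low block is not required to
    -- have.
    have h1 : 1 ≤ 4 ^ (γ - α) * ((2 : ℝ) ^ (-l)) ^ (γ - α) := by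
      rw [← Real.mul_rpow (by norm_num) (by positivity)]
      refine Real.one_le_rpow ?_ (by linarith)
      rw [show (4 : ℝ) = 2 ^ (2 : ℤ) by norm_num, ← zpow_add₀ two_ne_zero]
      exact one_le_zpow₀ one_le_two (by omega)
    have h2 : 0 ≤ φ.lowConst (γ - α) * (N + L) := by positivity
    have h3 : 0 ≤ high * (N + L) * ((2 : ℝ) ^ (-l)) ^ (γ - α) := by positivity
    rw [hC]
    nlinarith [mul_le_mul_of_nonneg_left h1 h2]
  · rw [hf.block_eq]
    have h1 := hP.norm_smear_psi_sub_block_le hF hα (hF.polyGrowth s α) (x := w) (b := 0)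
      (ε := γ - α) (K := L * φ.paraConst (γ - α) 0) (by positivity) (by linarith) le_rfl
      (fun i hi y => by
        simpa using M.norm_smear_psi_sub_paraTerm_le φ hF hα hL hD hi y) hl3 w
    refine h1.trans ?_
    rw [Real.rpow_zero, mul_one]
    refine mul_le_mul_of_nonneg_right ?_ (by positivity)
    have h4 : 0 ≤ 4 ^ (γ - α) * φ.lowConst (γ - α) * (N + L) := by positivity
    rw [hC]
    nlinarith [mul_nonneg hhigh0 hN]

/-- At scale 2^{-n} the derivative costs 2^{n|k|}, with |k| the scaled degree, and the modelled
bound gains 2^{-n(γ-α)}; the product decays because |k| < γ-α. -/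
theorem structureCondition_of_norm_sub_Γ_le (hF : R.IsCb γ N F) (hL : 0 ≤ L)
    (hD : ∀ α : R.A, (α : ℝ) < γ → ∀ u v,
      ‖F v α - (M.Γ v u (F u)) α‖ ≤ L * snorm s (v - u) ^ (γ - α)) :
    M.StructureCondition φ γ F := by
  intro x k α hα hk
  refine ⟨Eventually.of_forall fun n =>
    ((hF.polyGrowth s α).sub (M.polyGrowth_orbit hF hα x)).integrable _ x, ?_⟩
  have hρ : 0 ≤ γ - α := by linarith
  set q := (2 : ℝ) ^ ((deg s k : ℝ) - (γ - α))
  have hq : q < 1 := Real.rpow_lt_one_of_one_lt_of_neg one_lt_two (by linarith)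
  have h1 : ∀ n : ℕ, ‖smear (multiDeriv k (φ.psiLT n))
      (fun v => F v α - (M.Γ v x (F x)) α) x‖
      ≤ L * weightedL1 s (multiDeriv k (φ.low 0)) (γ - α) * q ^ n := by
    intro n
    rw [φ.psiLT_eq_rescale n (by omega), sub_self]
    refine (norm_smear_multiDeriv_rescale_le k n _ hρ x x (Eventually.of_forall fun v =>
      (hD α hα x v).trans ?_) hL).trans (le_of_eq ?_)
    · gcongr
      · exact snorm_nonneg s _
      · exact le_add_of_nonneg_left (by positivity)
    · rw [sub_self, snorm_zero, add_zero, ← two_zpow_pow_mul_rpow]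
      ring
  refine squeeze_zero_norm h1 ?_
  have := (tendsto_pow_atTop_nhds_zero_of_lt_one (by positivity) hq).const_mul
    (L * weightedL1 s (multiDeriv k (φ.low 0)) (γ - α))
  rwa [mul_zero] at this

end Model

/-! ### From the paraproduct-based space to modelled distributions. -/

namespace Model

variable {R : RegularityStructure.{u}} {d : ℕ} {s : Fin d → ℕ+} {M : Model R s}
variable {γ N L : ℝ} {F : Rd d → R.Space} {φ : DyadicCutoff s}

/-- `F` belongs to the paraproduct-based space, with norms bounded by `N`. -/
structure IsParamodelled (M : Model R s) (φ : DyadicCutoff s) (γ N : ℝ) (F : Rd d → R.Space) :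
    Prop where
  isCb : R.IsCb γ N F
  sharp : ∀ α : R.A, (α : ℝ) < γ →
    ∃ g, M.IsSharp φ F α g ∧ φ.besovNorm (γ - α) g ≤ ENNReal.ofReal N
  structureCondition : M.StructureCondition φ γ F

/-- Powers of t may be traded for powers of t + r ≥ t. In this way the exponent pairs (β-α, γ-β) for
the different β are all brought to a single pair (ε, b). -/
theorem rpow_mul_rpow_le {t r a b a' b' : ℝ} (ht : 0 < t) (hr : 0 ≤ r) (ha : a ≤ a')
    (hab : a + b = a' + b') :
    t ^ a' * (t + r) ^ b' ≤ t ^ a * (t + r) ^ b := by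
  have h1 : t ^ a' = t ^ a * t ^ (a' - a) := by rw [← Real.rpow_add ht]; congr 1; ring
  have h2 : (t + r) ^ b = (t + r) ^ (a' - a) * (t + r) ^ b' := by
    rw [← Real.rpow_add (by linarith)]; congr 1; linarith
  rw [h1, h2, mul_assoc]
  have h3 : t ^ (a' - a) ≤ (t + r) ^ (a' - a) :=
    Real.rpow_le_rpow ht.le (by linarith) (by linarith)
  have h4 : 0 ≤ (t + r) ^ b' := Real.rpow_nonneg (by linarith) _
  gcongr

/-- The constant in the estimate for the Littlewood–Paley blocks of `Γ^α_{·x} F_x`. -/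
noncomputable def orbitConst (R : RegularityStructure.{u}) (φ : DyadicCutoff s) (γ : ℝ) (α : R.A)
    (b : ℝ) : ℝ :=
  (∑ β ∈ R.between α γ, φ.paraConst (β - α) (γ - β)) *
    ((φ.gap + 2) * (4 : ℝ) ^ (γ - α) * weightedL1 s (φ.psi 0) b)

theorem orbitConst_nonneg (φ : DyadicCutoff s) (γ : ℝ) (α : R.A) (b : ℝ) :
    0 ≤ orbitConst R φ γ α b := by
  have h1 := weightedL1_nonneg s (φ.psi 0) b
  have h2 := Finset.sum_nonneg fun β (_ : β ∈ R.between α γ) => φ.paraConst_nonneg (β - α) (γ - β)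
  unfold orbitConst
  positivity

namespace IsParamodelled

theorem polyGrowth_sub_orbit (H : IsParamodelled M φ γ N F) {α : R.A} (hα : (α : ℝ) < γ) (x : Rd d) :
    PolyGrowth s fun v => F v α - M.orbit x (F x) α v :=
  (H.isCb.polyGrowth s α).sub (M.polyGrowth_orbit H.isCb hα x)

/-- The paraproduct is inserted between F^α and Γ^α_{·x} F_x: the first difference is F^{♯,α},
bounded by the Besov norm, and the second is bounded by means of the higher components. The Besov
norm limits the conclusion to almost every w. -/
theorem ae_norm_smear_psi_le (H : IsParamodelled M φ γ N F) {α : R.A} (hα : (α : ℝ) < γ)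
    (hL : 0 ≤ L) {x : Rd d}
    (hD : ∀ β ∈ R.between α γ, ∀ u, ‖F u β - (M.Γ u x (F x)) β‖ ≤ L * snorm s (u - x) ^ (γ - β))
    {ε b : ℝ} (hε : 0 ≤ ε) (hb : 0 ≤ b) (hεb : ε + b = γ - α)
    (hεβ : ∀ β ∈ R.between α γ, ε ≤ β - α) {l : ℤ} (hl : 3 ≤ l) :
    ∀ᵐ w, ‖smear (φ.psi l) (fun v => F v α - M.orbit x (F x) α v) w‖
      ≤ (N + M.realNormΓ γ * L * orbitConst R φ γ α b) *
        (((2 : ℝ) ^ (-l)) ^ ε * ((2 : ℝ) ^ (-l) + snorm s (w - x)) ^ b) := by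
  have hG := M.realNormΓ_nonneg γ
  have hN := H.isCb.nonneg
  obtain ⟨g, ⟨f, P, hf, hP, rfl⟩, hg⟩ := H.sharp α hα
  set S := ∑ β ∈ R.between α γ, φ.paraConst (β - α) (γ - β) with hS
  have hS0 : 0 ≤ S := Finset.sum_nonneg fun β _ => φ.paraConst_nonneg _ _
  have h1 := hP.norm_smear_psi_sub_block_le H.isCb hα (M.polyGrowth_orbit H.isCb hα x) (x := x)
    (K := M.realNormΓ γ * L * S) (ε := ε) (b := b) (by positivity) hε hb (fun i hi y => by
      refine (M.norm_smear_psi_orbit_sub_paraTerm_le φ H.isCb hα hL hD hi y).trans ?_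
      rw [mul_assoc (M.realNormΓ γ * L), hS, Finset.sum_mul]
      refine mul_le_mul_of_nonneg_left (Finset.sum_le_sum fun β hβ => ?_) (by positivity)
      refine mul_le_mul_of_nonneg_left ?_ (φ.paraConst_nonneg _ _)
      exact rpow_mul_rpow_le (by positivity) (snorm_nonneg s _) (hεβ β hβ) (by linarith)) hl
  filter_upwards [φ.ae_norm_block_le hN hg (show -1 ≤ l by omega)] with w hw
  have h2 := h1 w
  rw [(H.isCb.polyGrowth s α).smear_sub (M.polyGrowth_orbit H.isCb hα x)]
  rw [φ.block_sub, hf.block_eq] at hw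
  have h3 : ((2 : ℝ) ^ (-l)) ^ (γ - α)
      ≤ ((2 : ℝ) ^ (-l)) ^ ε * ((2 : ℝ) ^ (-l) + snorm s (w - x)) ^ b := by
    have := rpow_mul_rpow_le (a' := γ - α) (b' := 0) (t := (2 : ℝ) ^ (-l)) (by positivity)
      (snorm_nonneg s (w - x)) (show ε ≤ γ - α by linarith) (by rw [hεb, add_zero])
    rwa [Real.rpow_zero, mul_one] at this
  have h4 := norm_sub_le (smear (φ.psi l) (fun v => F v α) w - φ.block l P w)
    (smear (φ.psi l) (M.orbit x (F x) α) w - φ.block l P w)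
  rw [sub_sub_sub_cancel_right] at h4
  rw [hεb] at h2
  have h5 : orbitConst R φ γ α b = S *
    ((φ.gap + 2) * (4 : ℝ) ^ (γ - α) * weightedL1 s (φ.psi 0) b) := rfl
  rw [h5]
  refine h4.trans ((add_le_add (hw.trans (mul_le_mul_of_nonneg_left h3 hN)) h2).trans (le_of_eq ?_))
  ring

/-- Convolution with ∂ᵏΨ^{<l+2}, which reproduces the differentiated block, removes the exceptional
null set and supplies the derivative at the cost 2^{l|k|}, with |k| the scaled degree. -/
theorem norm_smear_multiDeriv_psi_le (H : IsParamodelled M φ γ N F) {α : R.A} (hα : (α : ℝ) < γ)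
    {x : Rd d} {K ε b : ℝ} (hK : 0 ≤ K) (hb : 0 ≤ b) {l : ℤ} (hl : 0 ≤ l)
    (h : ∀ᵐ w, ‖smear (φ.psi l) (fun v => F v α - M.orbit x (F x) α v) w‖
      ≤ K * (((2 : ℝ) ^ (-l)) ^ ε * ((2 : ℝ) ^ (-l) + snorm s (w - x)) ^ b))
    (k : Fin d → ℕ) (y : Rd d) :
    ‖smear (multiDeriv k (φ.psi l)) (fun v => F v α - M.orbit x (F x) α v) y‖
      ≤ weightedL1 s (multiDeriv k (φ.low 2)) b * K * (((2 : ℝ) ^ l) ^ deg s k *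
        (((2 : ℝ) ^ (-l)) ^ ε * ((2 : ℝ) ^ (-l) + snorm s (y - x)) ^ b)) := by
  rw [← (H.polyGrowth_sub_orbit hα x).smear_smear
    (φ.integral_multiDeriv_psiLT_mul_psi k (show -1 ≤ l by omega)) y,
    φ.psiLT_eq_rescale l (show 0 ≤ l + 2 by omega), add_sub_cancel_left]
  refine (norm_smear_multiDeriv_rescale_le k l _ hb x y (K := K * ((2 : ℝ) ^ (-l)) ^ ε) ?_
    (by positivity)).trans (le_of_eq (by ring))
  filter_upwards [h] with w hw
  rwa [mul_assoc]

theorem norm_sub_orbit_le (H : IsParamodelled M φ γ N F) {α : R.A} (hα : (α : ℝ) < γ) (x v : Rd d) :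
    ‖F v α - M.orbit x (F x) α v‖ ≤ N * (2 + M.realNormΓ γ * (R.between α γ).card) *
      (1 + snorm s (v - x)) ^ (γ - α) := by
  have hN := H.isCb.nonneg
  have h1 := one_le_one_add_snorm_rpow s (v - x) (show 0 ≤ γ - α by linarith)
  have h2 := M.norm_Γ_apply_le (H.isCb.below x) hN (fun β => H.isCb.bound β x) hα v x
  have h3 := norm_sub_le (F v α) (M.orbit x (F x) α v)
  have h4 := (H.isCb.bound α v).trans (le_mul_of_one_le_right hN h1)
  unfold orbit at h3 ⊢
  linarith

theorem taylorData (H : IsParamodelled M φ γ N F) {α : R.A} (hα : (α : ℝ) < γ)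
    (hL : 0 ≤ L) {x : Rd d}
    (hD : ∀ β ∈ R.between α γ, ∀ u, ‖F u β - (M.Γ u x (F x)) β‖ ≤ L * snorm s (u - x) ^ (γ - β))
    {ε b : ℝ} (hε : 0 ≤ ε) (hb : 0 ≤ b) (hεb : ε + b = γ - α)
    (hεβ : ∀ β ∈ R.between α γ, ε ≤ β - α) :
    TaylorData φ (γ - α) ε b (fun k => weightedL1 s (multiDeriv k (φ.low 2)) b)
      (N * (2 + M.realNormΓ γ * (R.between α γ).card) + M.realNormΓ γ * L * orbitConst R φ γ α b)
      (fun v => F v α - M.orbit x (F x) α v) x := by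
  have hG := M.realNormΓ_nonneg γ
  have hN := H.isCb.nonneg
  have hC := orbitConst_nonneg φ γ α b
  refine ⟨(H.isCb.cont α).sub (M.continuous_orbit (H.isCb.below x) x α), by positivity,
    fun v => ?_, fun k l hl y => ?_, fun k hk => (H.structureCondition x k α hα hk).2⟩
  · refine (H.norm_sub_orbit_le hα x v).trans ?_
    have := one_add_snorm_rpow_nonneg s (v - x) (γ - α)
    gcongr
    exact le_add_of_nonneg_right (by positivity)
  · refine H.norm_smear_multiDeriv_psi_le hα (by positivity) hb (by omega) ?_ k y
    filter_upwards [H.ae_norm_smear_psi_le hα hL hD hε hb hεb hεβ (l := l) (by omega)] with w hw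
    refine hw.trans (mul_le_mul_of_nonneg_right ?_ ?_)
    · have : 0 ≤ N * (1 + M.realNormΓ γ * (R.between α γ).card) := by positivity
      linarith
    · have := snorm_nonneg s (w - x)
      positivity

end IsParamodelled

theorem exists_pos_le_sub (γ : ℝ) {α : R.A} (hα : (α : ℝ) < γ) :
    ∃ ε : ℝ, 0 < ε ∧ ε ≤ γ - α ∧ ∀ β ∈ R.between α γ, ε ≤ β - α := by
  have h1 : ∀ᶠ ε : ℝ in 𝓝[>] 0, ∀ β ∈ R.between α γ, ε ≤ β - α := by
    refine (Finset.eventually_all _).2 fun β hβ => ?_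
    have h2 : (0 : ℝ) < β - α := sub_pos.2 (RegularityStructure.mem_between.1 hβ).2
    filter_upwards [Ioc_mem_nhdsGT h2] with ε hε using hε.2
  have h2 : ∀ᶠ ε : ℝ in 𝓝[>] 0, ε ∈ Set.Ioc 0 (γ - α) := Ioc_mem_nhdsGT (by linarith)
  obtain ⟨ε, h3, h4⟩ := (h1.and h2).exists
  exact ⟨ε, h4.1, h4.2, h3⟩

/-- Induction on the number of homogeneities between α and γ, so that the bounds for all β above α
are available. The constants are chosen before the model, which gives a uniform polynomial
dependence on ‖Γ‖_γ. -/
theorem exists_const_norm_sub_Γ_le (φ : DyadicCutoff s) (hγ : ∀ α ∈ R.A, ∀ n : ℕ, γ ≠ α + n)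
    (α : R.A) (hα : (α : ℝ) < γ) : ∃ (C : ℝ) (m : ℕ), 0 ≤ C ∧
      ∀ (M : Model R s) (N : ℝ) (F : Rd d → R.Space), M.IsParamodelled φ γ N F → ∀ u v,
        ‖F v α - (M.Γ v u (F u)) α‖ ≤
          C * (1 + M.realNormΓ γ) ^ m * N * snorm s (v - u) ^ (γ - α) := by
  induction hn : (R.between α γ).card using Nat.strong_induction_on generalizing α with
  | _ n ih =>
    subst hn
    have ih' : ∀ β : R.A, ∃ (C : ℝ) (m : ℕ), 0 ≤ C ∧ (β ∈ R.between α γ →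
      ∀ (M : Model R s) (N : ℝ) (F : Rd d → R.Space), M.IsParamodelled φ γ N F → ∀ u v,
        ‖F v β - (M.Γ v u (F u)) β‖ ≤
          C * (1 + M.realNormΓ γ) ^ m * N * snorm s (v - u) ^ (γ - β)) := by
      intro β
      by_cases hβ : β ∈ R.between α γ
      · obtain ⟨hβγ, hαβ⟩ := RegularityStructure.mem_between.1 hβ
        have hlt : (R.between β γ).card < (R.between α γ).card := by
          refine Finset.card_lt_card ((Finset.ssubset_iff_of_subset fun δ hδ => ?_).2 ⟨β, hβ, ?_⟩)
          · obtain ⟨h1, h2⟩ := RegularityStructure.mem_between.1 hδ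
            exact RegularityStructure.mem_between.2 ⟨h1, hαβ.trans h2⟩
          · exact fun h => lt_irrefl _ (RegularityStructure.mem_between.1 h).2
        obtain ⟨C, m, hC, h⟩ := ih _ hlt β hβγ rfl
        exact ⟨C, m, hC, fun _ => h⟩
      · exact ⟨0, 0, le_rfl, fun h => absurd h hβ⟩
    choose c m hc hcm using ih'
    obtain ⟨ε, hε, hεγ, hεβ⟩ := exists_pos_le_sub γ hα
    set b := γ - α - ε with hb
    set C' := ∑ β ∈ R.between α γ, c β
    have hC' : 0 ≤ C' := Finset.sum_nonneg fun β _ => hc β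
    set m' := ∑ β ∈ R.between α γ, m β
    set T := TaylorData.const φ (γ - α) ε b
      (fun k => weightedL1 s (multiDeriv k (φ.low 2)) b)
    set O := orbitConst R φ γ α b
    have hO : 0 ≤ O := orbitConst_nonneg φ γ α b
    have hT : 0 ≤ T := TaylorData.const_nonneg φ hε (fun k => weightedL1_nonneg s _ _)
    -- One power of 1 + ‖Γ‖_γ is added at each stage, because Γ acts once on the components already
    -- estimated; m' dominates the powers inherited from them.
    refine ⟨T * (2 + (R.between α γ).card + C' * O), m' + 1, by positivity,
      fun M N F H x y => ?_⟩
    have hG := M.realNormΓ_nonneg γ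
    have hN := H.isCb.nonneg
    set G := M.realNormΓ γ
    have hL : 0 ≤ C' * (1 + G) ^ m' * N := by positivity
    have h1 := H.taylorData hα hL (x := x) (fun β hβ u => by
      refine (hcm β hβ M N F H x u).trans ?_
      have h2 : c β ≤ C' := Finset.single_le_sum (fun β _ => hc β) hβ
      have h3 : m β ≤ m' := Finset.single_le_sum (fun β _ => Nat.zero_le _) hβ
      have h4 : (1 + G) ^ m β ≤ (1 + G) ^ m' := pow_le_pow_right₀ (by linarith) h3
      have h5 := Real.rpow_nonneg (snorm_nonneg s (u - x)) (γ - β)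
      have h6 := hc β
      gcongr) hε.le (b := b) (by linarith) (by linarith) hεβ
    have h2 := h1.norm_le hε (by linarith) (by linarith) (fun k => weightedL1_nonneg s _ _)
      -- Here γ ∉ A + ℕ enters: a critical degree would give γ = α + |k|, with |k| the scaled
      -- degree.
      (fun k hk => hγ α α.2 (deg s k) (by linarith)) y
    refine h2.trans ?_
    refine mul_le_mul_of_nonneg_right ?_ (Real.rpow_nonneg (snorm_nonneg s _) _)
    have h3 : (1 : ℝ) + G ≤ (1 + G) ^ (m' + 1) := le_self_pow₀ (by linarith) (by omega)
    have h4 : G * (1 + G) ^ m' ≤ (1 + G) ^ (m' + 1) := by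
      rw [pow_succ']
      gcongr
      linarith
    have h5 : N * (2 + G * (R.between α γ).card) + G * (C' * (1 + G) ^ m' * N) * O
        ≤ (2 + (R.between α γ).card + C' * O) * (1 + G) ^ (m' + 1) * N := by
      calc _ = (2 + (R.between α γ).card * G + C' * O * (G * (1 + G) ^ m')) * N := by ring
        _ ≤ (2 * (1 + G) ^ (m' + 1) + (R.between α γ).card * (1 + G) ^ (m' + 1)
            + C' * O * (1 + G) ^ (m' + 1)) * N := by
            gcongr
            · linarith
            · linarith
        _ = _ := by ring
    calc _ ≤ T * ((2 + (R.between α γ).card + C' * O) * (1 + G) ^ (m' + 1) * N) := by gcongr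
      _ = _ := by ring

end Model

/-! ### Translation into extended norms and conclusion. -/

namespace Model

variable {R : RegularityStructure.{u}} {d : ℕ} {s : Fin d → ℕ+} {M : Model R s}
variable {γ N L : ℝ} {F : Rd d → R.Space} {φ : DyadicCutoff s}

theorem norm_apply_le_of_cbNorm_le {B : ℝ} (hB : 0 ≤ B) (h : cbNorm F ≤ ENNReal.ofReal B) (α : R.A)
    (x : Rd d) : ‖F x α‖ ≤ B := by
  have h1 := (le_iSup₂ (f := fun (α : R.A) (x : Rd d) => ‖F x α‖ₑ) α x).trans h
  rw [← ofReal_norm] at h1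
  exact (ENNReal.ofReal_le_ofReal_iff hB).1 h1

theorem norm_sub_Γ_le_of_mem_modelled (hF : F ∈ M.modelled γ) (α : R.A)
    (u v : Rd d) : ‖F v α - (M.Γ v u (F u)) α‖
      ≤ (M.modelledNorm γ F).toReal * snorm s (v - u) ^ (γ - α) := by
  by_cases huv : u = v
  · subst huv
    rw [M.Γ_self, sub_self, norm_zero]
    exact mul_nonneg ENNReal.toReal_nonneg (Real.rpow_nonneg (snorm_nonneg s _) _)
  have hpos : 0 < snorm s (v - u) ^ (γ - α) :=
    Real.rpow_pos_of_pos (snorm_pos s (sub_ne_zero.2 (Ne.symm huv))) _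
  have h1 : ‖F v α - (M.Γ v u (F u)) α‖ₑ / ENNReal.ofReal (snorm s (v - u) ^ (γ - α))
      ≤ M.modelledNorm γ F := by
    refine le_trans ?_ le_add_self
    exact le_iSup_of_le α (le_iSup_of_le u (le_iSup₂_of_le v huv le_rfl))
  rw [ENNReal.div_le_iff (by positivity) ENNReal.ofReal_ne_top, ← ENNReal.ofReal_toReal hF.2.ne,
    ← ENNReal.ofReal_mul ENNReal.toReal_nonneg, ← ofReal_norm] at h1
  exact (ENNReal.ofReal_le_ofReal_iff (by positivity)).1 h1

theorem isCb_of_mem_modelled (hF : F ∈ M.modelled γ) : R.IsCb γ (M.modelledNorm γ F).toReal F where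
  below := hF.1
  cont := M.continuous_of_norm_sub_Γ_le hF.1 fun α _ => norm_sub_Γ_le_of_mem_modelled hF α
  bound := norm_apply_le_of_cbNorm_le ENNReal.toReal_nonneg (by
    rw [ENNReal.ofReal_toReal hF.2.ne]
    exact le_self_add)

theorem modelledNorm_le (hF : ValuesBelow γ F)
    (hD : ∀ α : R.A, (α : ℝ) < γ → ∀ u v,
      ‖F v α - (M.Γ v u (F u)) α‖ ≤ L * snorm s (v - u) ^ (γ - α)) :
    M.modelledNorm γ F ≤ cbNorm F + ENNReal.ofReal L := by
  refine add_le_add le_rfl (iSup_le fun α => iSup_le fun x => iSup₂_le fun y hxy => ?_)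
  rcases lt_or_ge (α : ℝ) γ with hα | hα
  · have hpos : 0 < snorm s (y - x) ^ (γ - α) :=
      Real.rpow_pos_of_pos (snorm_pos s (sub_ne_zero.2 (Ne.symm hxy))) _
    rw [ENNReal.div_le_iff (by positivity) ENNReal.ofReal_ne_top, ← ENNReal.ofReal_mul' hpos.le,
      ← ofReal_norm]
    exact ENNReal.ofReal_le_ofReal (hD α hα x y)
  · rw [hF y α hα, M.Γ_apply_eq_zero (hF x) _ _ hα, sub_zero, enorm_zero, ENNReal.zero_div]
    exact zero_le

theorem paraNorm_le (hF : F ∈ M.modelled γ) :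
    M.paraNorm φ γ F ≤ ENNReal.ofReal (1 + 2 * ∑ α ∈ R.below γ, φ.sharpConst (γ - α)) *
      M.modelledNorm γ F := by
  have hC : 0 ≤ ∑ α ∈ R.below γ, φ.sharpConst (γ - α) :=
    Finset.sum_nonneg fun α _ => φ.sharpConst_nonneg _
  have h0 : (0 : ℝ) ≤ (M.modelledNorm γ F).toReal := ENNReal.toReal_nonneg
  rw [ENNReal.ofReal_add zero_le_one (by positivity), ENNReal.ofReal_one, add_mul, one_mul]
  refine add_le_add le_self_add (iSup_le fun α => ?_)
  rcases lt_or_ge (α : ℝ) γ with hα | hα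
  · obtain ⟨g, hg⟩ := M.exists_isSharp φ (isCb_of_mem_modelled hF) hα
    rw [hg.sharpNorm_eq]
    refine (M.besovNorm_sharp_le φ (isCb_of_mem_modelled hF) h0 hα
      (norm_sub_Γ_le_of_mem_modelled hF α) hg).trans ?_
    rw [← ENNReal.ofReal_toReal hF.2.ne, ENNReal.toReal_ofReal h0,
      ← ENNReal.ofReal_mul (by positivity)]
    refine ENNReal.ofReal_le_ofReal ?_
    have h1 : φ.sharpConst (γ - α) ≤ ∑ α ∈ R.below γ, φ.sharpConst (γ - α) :=
      Finset.single_le_sum (f := fun α : R.A => φ.sharpConst (γ - α))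
        (fun α _ => φ.sharpConst_nonneg _) (R.mem_below.2 hα)
    nlinarith
  · rw [M.sharpNorm_eq_zero φ hF.1 hα]
    exact zero_le

theorem mem_paramodelled_of_mem_modelled (φ : DyadicCutoff s) (hF : F ∈ M.modelled γ) :
    F ∈ M.paramodelled φ γ := by
  have h0 : (0 : ℝ) ≤ (M.modelledNorm γ F).toReal := ENNReal.toReal_nonneg
  have hcb := isCb_of_mem_modelled hF
  refine ⟨hF.1, ⟨hcb.cont, lt_of_le_of_lt le_self_add hF.2⟩, fun α hα => ?_,
    M.structureCondition_of_norm_sub_Γ_le φ hcb h0 fun α _ => norm_sub_Γ_le_of_mem_modelled hF α⟩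
  obtain ⟨g, hg⟩ := M.exists_isSharp φ hcb hα
  exact ⟨g, hg, lt_of_le_of_lt (M.besovNorm_sharp_le φ hcb h0 hα
    (norm_sub_Γ_le_of_mem_modelled hF α) hg) ENNReal.ofReal_lt_top⟩

theorem paraNorm_lt_top (hF : F ∈ M.paramodelled φ γ) : M.paraNorm φ γ F < ⊤ := by
  obtain ⟨hb, hcb, hs, -⟩ := hF
  refine ENNReal.add_lt_top.2 ⟨hcb.2, lt_of_le_of_lt (b := ∑ α ∈ R.below γ, M.sharpNorm φ γ F α)
    (iSup_le fun α => ?_) (ENNReal.sum_lt_top.2 fun α hα => ?_)⟩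
  · rcases lt_or_ge (α : ℝ) γ with hα | hα
    · exact Finset.single_le_sum (f := fun α => M.sharpNorm φ γ F α) (fun _ _ => zero_le)
        (R.mem_below.2 hα)
    · rw [M.sharpNorm_eq_zero φ hb hα]
      exact zero_le
  · obtain ⟨g, hg, hlt⟩ := hs α (R.mem_below.1 hα)
    rwa [hg.sharpNorm_eq]

theorem isParamodelled_of_mem_paramodelled (hF : F ∈ M.paramodelled φ γ) :
    M.IsParamodelled φ γ (M.paraNorm φ γ F).toReal F := by
  have hlt := paraNorm_lt_top hF
  obtain ⟨hb, hcb, hs, hst⟩ := hF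
  refine ⟨⟨hb, hcb.1, norm_apply_le_of_cbNorm_le ENNReal.toReal_nonneg ?_⟩, fun α hα => ?_, hst⟩
  · rw [ENNReal.ofReal_toReal hlt.ne]
    exact le_self_add
  · obtain ⟨g, hg, -⟩ := hs α hα
    refine ⟨g, hg, ?_⟩
    rw [ENNReal.ofReal_toReal hlt.ne, ← hg.sharpNorm_eq]
    exact (le_iSup (fun α => M.sharpNorm φ γ F α) α).trans le_add_self

/-- Only finitely many α lie below γ, so their constants and exponents can be summed to dominate
each of them. -/
theorem exists_uniform_const_norm_sub_Γ_le (φ : DyadicCutoff s)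
    (hγ : ∀ α ∈ R.A, ∀ n : ℕ, γ ≠ α + n) : ∃ (C : ℝ≥0) (m : ℕ),
      ∀ (M : Model R s) (N : ℝ) (F : Rd d → R.Space), M.IsParamodelled φ γ N F →
        ∀ α : R.A, (α : ℝ) < γ → ∀ u v, ‖F v α - (M.Γ v u (F u)) α‖ ≤
          C * (1 + M.realNormΓ γ) ^ m * N * snorm s (v - u) ^ (γ - α) := by
  have h : ∀ α : R.A, ∃ (C : ℝ≥0) (m : ℕ), (α : ℝ) < γ →
      ∀ (M : Model R s) (N : ℝ) (F : Rd d → R.Space), M.IsParamodelled φ γ N F → ∀ u v,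
        ‖F v α - (M.Γ v u (F u)) α‖ ≤
          C * (1 + M.realNormΓ γ) ^ m * N * snorm s (v - u) ^ (γ - α) := by
    intro α
    by_cases hα : (α : ℝ) < γ
    · obtain ⟨C, m, hC, h⟩ := exists_const_norm_sub_Γ_le φ hγ α hα
      exact ⟨⟨C, hC⟩, m, fun _ => h⟩
    · exact ⟨0, 0, fun h => absurd h hα⟩
  choose c m hcm using h
  refine ⟨∑ α ∈ R.below γ, c α, ∑ α ∈ R.below γ, m α, fun M N F H α hα u v =>
    (hcm α hα M N F H u v).trans ?_⟩
  have hG := M.realNormΓ_nonneg γ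
  have hN := H.isCb.nonneg
  have h2 : c α ≤ ∑ α ∈ R.below γ, c α :=
    Finset.single_le_sum (fun _ _ => zero_le) (R.mem_below.2 hα)
  have h2' : (c α : ℝ) ≤ (∑ α ∈ R.below γ, c α : ℝ≥0) := by exact_mod_cast h2
  have h3 : m α ≤ ∑ α ∈ R.below γ, m α :=
    Finset.single_le_sum (fun _ _ => Nat.zero_le _) (R.mem_below.2 hα)
  have h4 := pow_le_pow_right₀ (show 1 ≤ 1 + M.realNormΓ γ by linarith) h3
  have h5 := Real.rpow_nonneg (snorm_nonneg s (v - u)) (γ - α)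
  gcongr

end Model

theorem theorem1 {d : ℕ} (s : Fin d → ℕ+) (φ : DyadicCutoff s) (R : RegularityStructure.{u})
    (γ : ℝ) (hγ : ∀ α ∈ R.A, ∀ n : ℕ, γ ≠ α + n) :
    ∃ p q : ℝ≥0[X], ∀ M : Model R s,
      M.modelled γ = M.paramodelled φ γ ∧
      ∀ F ∈ M.modelled γ,
        M.paraNorm φ γ F ≤ Polynomial.aeval (M.normΓ γ) p * M.modelledNorm γ F ∧
        M.modelledNorm γ F ≤ Polynomial.aeval (M.normΓ γ) q * M.paraNorm φ γ F := by
  obtain ⟨C, m, hC⟩ := Model.exists_uniform_const_norm_sub_Γ_le φ hγ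
  -- The factor 2 in p arises because both the supremum bound and the increment bound of F are
  -- estimated by its full norm. In q the summand 1 accounts for the C_b part.
  refine ⟨Polynomial.C (1 + 2 * ∑ α ∈ R.below γ, φ.sharpConst (γ - α)).toNNReal,
    1 + Polynomial.C C * (1 + Polynomial.X) ^ m, fun M => ?_⟩
  have h1 : Polynomial.aeval (M.normΓ γ) (1 + Polynomial.C C * (1 + Polynomial.X) ^ m)
      = 1 + (C : ℝ≥0∞) * (1 + M.normΓ γ) ^ m := by
    simp
    rfl
  have hq : ∀ F ∈ M.paramodelled φ γ, M.modelledNorm γ F ≤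
      Polynomial.aeval (M.normΓ γ) (1 + Polynomial.C C * (1 + Polynomial.X) ^ m) *
        M.paraNorm φ γ F := by
    intro F hF
    have hG := M.realNormΓ_nonneg γ
    have hG' : M.normΓ γ = ENNReal.ofReal (M.realNormΓ γ) :=
      (ENNReal.ofReal_toReal (M.normΓ_lt_top γ).ne).symm
    have hP : M.paraNorm φ γ F = ENNReal.ofReal (M.paraNorm φ γ F).toReal :=
      (ENNReal.ofReal_toReal (Model.paraNorm_lt_top hF).ne).symm
    refine (Model.modelledNorm_le hF.1
      (hC M _ F (Model.isParamodelled_of_mem_paramodelled hF))).trans ?_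
    rw [h1, add_mul, one_mul]
    refine add_le_add le_self_add (le_of_eq ?_)
    rw [ENNReal.ofReal_mul (by positivity), ENNReal.ofReal_mul (by positivity),
      ENNReal.ofReal_coe_nnreal, ENNReal.ofReal_pow (by positivity),
      ENNReal.ofReal_add zero_le_one hG, ENNReal.ofReal_one, ← hG', ← hP]
  have hset : M.modelled γ = M.paramodelled φ γ := by
    refine Set.Subset.antisymm (fun F hF => Model.mem_paramodelled_of_mem_modelled φ hF)
      fun F hF => ⟨hF.1, (hq F hF).trans_lt (ENNReal.mul_lt_top ?_ (Model.paraNorm_lt_top hF))⟩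
    rw [h1]
    have h2 := (M.normΓ_lt_top γ).ne
    exact ENNReal.add_lt_top.2 ⟨ENNReal.one_lt_top, ENNReal.mul_lt_top ENNReal.coe_lt_top
      (ENNReal.pow_lt_top (ENNReal.add_lt_top.2 ⟨ENNReal.one_lt_top, h2.lt_top⟩))⟩
  refine ⟨hset, fun F hF => ⟨?_, hq F (hset ▸ hF)⟩⟩
  rw [Polynomial.aeval_C]
  exact Model.paraNorm_le hF
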